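/- Let $G$ be a connected undirected simple graph with $n=|V(G)|$ vertices and $m=|E(G)|$ edges. Call $F\subseteq E(G)$ a *cycle* if every vertex has even degree in the spanning subgraph $(V(G),F)$, and a *cut* if there is $W\subseteq V(G)$ such that $F$ is the set of edges of $G$ with exactly one end in $W$. A set of cycles (of cuts) is *independent* if the incidence vectors of its members are linearly independent in $GF(2)^{E(G)}$. A *cycle basis* (a *cut basis*) is an inclusion-maximal independent set of cycles (of cuts). There is an algorithm that, given any such $G$ as a list of its edges, outputs every cycle basis of $G$ exactly once, with delay $O(m^5)$ (read as $O(1)$ if $m=0$), and there is an algorithm that, given any such $G$, outputs every cut basis of $G$ exactly once, with delay $O(n^5)$. Here time is the number of elementary steps on a word RAM with words of $O(\log(n+m))$ bits; a basis is output by writing the incidence vectors of its members; and the delay is the largest amount of time that passes before the first output is complete, between the completion of two consecutive outputs, or after the last output until the algorithm halts. The constants in the $O$-bounds and the algorithms do not depend on $G$. -/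

import Mathlib

/-! ## Cycles, cuts, and the bases of the two binary matroids of a graph -/

namespace GraphBases

/-- The incidence vector of a set of edges, over the field with two elements. -/
def incVec {V : Type*} [DecidableEq V] (G : SimpleGraph V) (F : Finset (Sym2 V)) : G.edgeSet → ZMod 2 :=
  fun e => if (e : Sym2 V) ∈ F then 1 else 0

/-- A set of edges `F` is a cycle of `G` if all vertex degrees in the spanning subgraph
with edge set `F` are even. -/
def IsCycle {V : Type*} [DecidableEq V] (G : SimpleGraph V) (F : Finset (Sym2 V)) : Prop :=
  (F : Set (Sym2 V)) ⊆ G.edgeSet ∧ ∀ v : V, Even (F.filter (fun e => v ∈ e)).card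

/-- A set of edges `F` is a cut of `G` if, for some vertex set `W`, it consists of exactly the
edges of `G` with one end in `W` and the other end outside `W`. -/
def IsCut {V : Type*} (G : SimpleGraph V) (F : Finset (Sym2 V)) : Prop :=
  ∃ W : Set V, ∀ e : Sym2 V,
    e ∈ F ↔ e ∈ G.edgeSet ∧ ∃ s t : V, s ∈ W ∧ t ∉ W ∧ e = s(s, t)

/-- A basis of the binary matroid whose ground set is the family `U` of edge sets of `G`
and whose independent sets are the subfamilies with linearly independent incidence vectors:
a maximal independent set. -/
def IsBasis {V : Type*} [DecidableEq V] (G : SimpleGraph V) (U : Finset (Sym2 V) → Prop)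
    (B : Finset (Finset (Sym2 V))) : Prop :=
  Maximal (fun I : Finset (Finset (Sym2 V)) =>
    (∀ F ∈ I, U F) ∧ LinearIndepOn (ZMod 2) (incVec G) (I : Set (Finset (Sym2 V)))) B

/-- Cycle bases of `G`. -/
def IsCycleBasis {V : Type*} [DecidableEq V] (G : SimpleGraph V)
    (B : Finset (Finset (Sym2 V))) : Prop :=
  IsBasis G (IsCycle G) B

/-- Cut bases of `G`. -/
def IsCutBasis {V : Type*} [DecidableEq V] (G : SimpleGraph V)
    (B : Finset (Finset (Sym2 V))) : Prop :=
  IsBasis G (IsCut G) B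

end GraphBases

/-! ## A word RAM with structured programs, a clock and an output tape -/

namespace WordRAM

/-- Word operations; comparisons return `1` for true and `0` for false, and
subtraction is truncated at `0`. -/
inductive Op where
  | add | sub | mul | lt | eq

def Op.eval : Op → ℕ → ℕ → ℕ
  | .add, a, b => a + b
  | .sub, a, b => a - b
  | .mul, a, b => a * b
  | .lt, a, b => if a < b then 1 else 0
  | .eq, a, b => if a = b then 1 else 0

/-- Expressions: constants, registers, memory cells (random access), operations. -/
inductive Expr where
  | lit (k : ℕ)
  | reg (i : ℕ)
  | load (a : Expr)
  | bin (o : Op) (a b : Expr)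

/-- Programs. `emit e` writes the word `e` to the output tape, and `endSol` declares that the
words written since the previous `endSol` form one complete output. -/
inductive Prog where
  | nop
  | setReg (i : ℕ) (e : Expr)
  | store (a e : Expr)
  | emit (e : Expr)
  | endSol
  | seq (p q : Prog)
  | ite (c : Expr) (p q : Prog)
  | loop (c : Expr) (p : Prog)

/-- Machine states: registers, memory, elapsed time, the words of the output in progress,
and the completed outputs in chronological order, each with its time of completion. -/
structure State where
  reg : ℕ → ℕ
  mem : ℕ → ℕ
  time : ℕ
  buf : List ℕ
  out : List (List ℕ × ℕ)

def Expr.eval (σ : State) : Expr → ℕ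
  | .lit k => k
  | .reg i => σ.reg i
  | .load a => σ.mem (a.eval σ)
  | .bin o a b => o.eval (a.eval σ) (b.eval σ)

/-- The time to evaluate an expression: one unit for each constant, register access, memory
access and operation in it. -/
def Expr.cost : Expr → ℕ
  | .lit _ => 1
  | .reg _ => 1
  | .load a => a.cost + 1
  | .bin _ a b => a.cost + b.cost + 1

/-- Let `t` units of time pass. -/
def State.tick (σ : State) (t : ℕ) : State := { σ with time := σ.time + t }

/-- `Exec W p σ σ'`: on a machine with words in `{0, …, W - 1}`, program `p` started in state
`σ` halts in state `σ'`. Every word that is written, and every address that is written to, must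
be smaller than `W`; otherwise the run is stuck and has no final state. (A program is a fixed
finite object, so what occurs inside one expression is also at most polynomial in `W`.) -/
inductive Exec (W : ℕ) : Prog → State → State → Prop where
  | nop (σ : State) : Exec W .nop σ (σ.tick 1)
  | setReg (i : ℕ) (e : Expr) (σ : State) (he : e.eval σ < W) :
      Exec W (.setReg i e) σ
        ({ σ with reg := Function.update σ.reg i (e.eval σ) }.tick (e.cost + 1))
  | store (a e : Expr) (σ : State) (ha : a.eval σ < W) (he : e.eval σ < W) :
      Exec W (.store a e) σ
        ({ σ with mem := Function.update σ.mem (a.eval σ) (e.eval σ) }.tick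
          (a.cost + e.cost + 1))
  | emit (e : Expr) (σ : State) (he : e.eval σ < W) :
      Exec W (.emit e) σ ({ σ with buf := σ.buf ++ [e.eval σ] }.tick (e.cost + 1))
  | endSol (σ : State) :
      Exec W .endSol σ
        ({ σ with buf := [], out := σ.out ++ [(σ.buf, σ.time + 1)] }.tick 1)
  | seq (p q : Prog) (σ τ υ : State) (hp : Exec W p σ τ) (hq : Exec W q τ υ) :
      Exec W (.seq p q) σ υ
  | ite_true (c : Expr) (p q : Prog) (σ τ : State) (hc : c.eval σ ≠ 0)
      (hp : Exec W p (σ.tick (c.cost + 1)) τ) : Exec W (.ite c p q) σ τ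
  | ite_false (c : Expr) (p q : Prog) (σ τ : State) (hc : c.eval σ = 0)
      (hq : Exec W q (σ.tick (c.cost + 1)) τ) : Exec W (.ite c p q) σ τ
  | loop_true (c : Expr) (p : Prog) (σ τ υ : State) (hc : c.eval σ ≠ 0)
      (hp : Exec W p (σ.tick (c.cost + 1)) τ) (hl : Exec W (.loop c p) τ υ) :
      Exec W (.loop c p) σ υ
  | loop_false (c : Expr) (p : Prog) (σ : State) (hc : c.eval σ = 0) :
      Exec W (.loop c p) σ (σ.tick (c.cost + 1))

/-- A run is determined by the program and the initial state. -/
theorem Exec.det {W : ℕ} {p : Prog} {σ τ τ' : State} (h : Exec W p σ τ)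
    (h' : Exec W p σ τ') : τ = τ' := by
  induction h generalizing τ' with
  | nop | setReg | store | emit | endSol => cases h'; rfl
  | seq p q σ τ υ _ _ ihp ihq =>
    cases h' with
    | seq _ _ _ τ₂ _ h₁ h₂ =>
      cases ihp h₁
      exact ihq h₂
  | ite_true c p q σ τ hc _ ih =>
    cases h' with
    | ite_true _ _ _ _ _ _ h₁ => exact ih h₁
    | ite_false _ _ _ _ _ hc' _ => exact absurd hc' hc
  | ite_false c p q σ τ hc _ ih =>
    cases h' with
    | ite_true _ _ _ _ _ hc' _ => exact absurd hc hc'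
    | ite_false _ _ _ _ _ _ h₁ => exact ih h₁
  | loop_true c p σ τ υ hc _ _ ihp ihl =>
    cases h' with
    | loop_true _ _ _ τ₂ _ _ h₁ h₂ =>
      cases ihp h₁
      exact ihl h₂
    | loop_false _ _ _ hc' => exact absurd hc' hc
  | loop_false c p σ hc =>
    cases h' with
    | loop_true _ _ _ _ _ hc' _ _ => exact absurd hc hc'
    | loop_false => rfl

end WordRAM

/-! ## Enumeration of families of edge sets of a graph with a given delay -/

namespace GraphBases

open WordRAM

/-- `es` lists every edge of `G` exactly once, each in one of its two orientations. -/
def IsEdgeList {n m : ℕ} (G : SimpleGraph (Fin n)) (es : Fin m → Fin n × Fin n) : Prop :=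
  Function.Injective (fun k => s((es k).1, (es k).2)) ∧
    Set.range (fun k => s((es k).1, (es k).2)) = G.edgeSet

/-- The input: register `0` holds the number of vertices, register `1` the number of edges,
and memory cells `2 * k` and `2 * k + 1` hold the two ends of the `k`-th edge. All the other
registers and cells are `0`. -/
def initState {n m : ℕ} (es : Fin m → Fin n × Fin n) : State where
  reg i := if i = 0 then n else if i = 1 then m else 0
  mem a :=
    if h : a / 2 < m then
      if a % 2 = 0 then ((es ⟨a / 2, h⟩).1 : ℕ) else ((es ⟨a / 2, h⟩).2 : ℕ)
    else 0
  time := 0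
  buf := []
  out := []

/-- The word list `w` is a written representation of the family `B` of edge sets: the members
of `B`, each once and in some order, are written one after the other, each as its `0`-`1`
incidence vector of length `m`. -/
def Encodes {n m : ℕ} (es : Fin m → Fin n × Fin n) (w : List ℕ)
    (B : Finset (Finset (Sym2 (Fin n)))) : Prop :=
  ∃ rows : List (Finset (Sym2 (Fin n))), rows.Nodup ∧ rows.toFinset = B ∧
    w = rows.flatMap
      (fun F => List.ofFn (fun k : Fin m => if s((es k).1, (es k).2) ∈ F then 1 else 0))

/-- On a machine with words in `{0, …, W - 1}` and the input `es`, the program `p` halts, and it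
outputs exactly the families `B` with `Sol B`, each exactly once, with delay at most `D`: at most
`D` units of time pass before the first output is complete, between the completion of
consecutive outputs, and from the last output to the end of the run. -/
def EnumeratesWithDelay {n m : ℕ} (p : Prog) (W : ℕ) (es : Fin m → Fin n × Fin n)
    (Sol : Finset (Finset (Sym2 (Fin n))) → Prop) (D : ℕ) : Prop :=
  ∃ σ : State, Exec W p (initState es) σ ∧
    (∃ sols : List (Finset (Finset (Sym2 (Fin n)))),
      sols.Nodup ∧ (∀ B, B ∈ sols ↔ Sol B) ∧
      List.Forall₂ (fun o B => Encodes es o.1 B) σ.out sols) ∧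
    σ.buf = [] ∧
    List.IsChain (fun a b => b ≤ a + D) (0 :: (σ.out.map Prod.snd ++ [σ.time]))

end GraphBases

/-! ## A program logic for the word RAM with a three-dimensional view of the memory -/

namespace WordRAM

/-! Cycles and cuts each form a subspace `U` of the edge space over GF(2), and the maximal
independent families are exactly the vector space bases of `U`. Once a single basis `e 0, …, e (r -
1)` of `U` has been computed, the task is to list all unordered bases of an `r`-dimensional space in
coordinates, without repetition and without dead ends.

Encoding. In a basis of the span of `e 0, …, e i`, let `p` be the smallest member with nonzero
coordinate `i`, where coordinates are read as binary digits and a higher index is more significant.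
Adding `p` to the other members with nonzero coordinate `i` leaves, apart from `p`, a basis of the
span of `e 0, …, e (i - 1)`. Conversely, given such a smaller basis `b 0, …, b (i - 1)`, a vector `p
= e i + x` with `x` in the smaller span, and a set of indices `j` for which `b j` is replaced by `b
j + p`, the result is a basis. In it `p` is the smallest member with coordinate `i` precisely if,
for each chosen `j`, `p` vanishes at the last nonzero coordinate of `b j`. Row `2 * i` of a word
records `x`, row `2 * i + 1` the chosen indices, and `Allowed` is this condition. By `exists_word`
and `rows_eq`, valid words and bases correspond bijectively; `exists_valid_famSet_eq` and
`famSet_injective` carry this over to `e`.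

Enumeration. Whether a position may hold `1` depends on earlier rows only, and `0` is always
permitted. So the lexicographic successor arises by raising the last zero that can be raised and
clearing everything behind it (`IsLast.valid_next`, `IsLast.next_le`). The pass that decodes a word
into its basis, by `O(r ^ 2)` row additions, finds this position as well; a round therefore costs a
constant times `(r + 1) ^ 2 * (m + 1)` (`enumLoop_spec`).

Starting bases. In a connected graph the cuts around all vertices but one are a basis
(`linearIndependent_cobdry`, `span_cobdry`); with `r = n - 1` and `m ≤ n ^ 2` the delay is of order
`n ^ 4`. For cycles the edges are inserted one by one into a labelled forest that keeps a path from
each vertex to its label, and an edge inside a component yields a fundamental cycle (`Forest.chord`,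
`Forest.link`, `Forest.span_eq`). Since `n ≤ m + 1`, preparation and delay are of order `m ^ 3 + 1`.
-/

/-- Expressions over a memory that is seen as a three-dimensional array: `ld t i j` is the cell
`j` of row `i` of table `t`. -/
inductive Ex where
  | lit (k : ℕ)
  | reg (i : ℕ)
  | ld (t : ℕ) (i j : Ex)
  | bin (o : Op) (a b : Ex)

/-- The contents of all tables. -/
abbrev Arr := ℕ → ℕ → ℕ → ℕ

/-- The address of a cell; the row length is kept in register `2`. -/
def cellExpr (t : ℕ) (i j : Expr) : Expr :=
  .bin .add (.bin .mul (.bin .add (.bin .mul (.lit t) (.reg 2)) i) (.reg 2)) j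

def Ex.toExpr : Ex → Expr
  | .lit k => .lit k
  | .reg i => .reg i
  | .ld t i j => .load (cellExpr t i.toExpr j.toExpr)
  | .bin o a b => .bin o a.toExpr b.toExpr

@[simp] def Ex.ev (env : List ℕ) (A : Arr) : Ex → ℕ
  | .lit k => k
  | .reg i => env.getD i 0
  | .ld t i j => A t (i.ev env A) (j.ev env A)
  | .bin o a b => o.eval (a.ev env A) (b.ev env A)

-- Indices have to stay below the row length, since beyond it an address runs into another row or
-- table and the three-dimensional view no longer describes the memory.
@[simp] def Ex.Ok (L : ℕ) (env : List ℕ) (A : Arr) : Ex → Prop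
  | .lit _ => True
  | .reg i => i < env.length
  | .ld _ i j => env[2]? = some L ∧ i.Ok L env A ∧ j.Ok L env A ∧ i.ev env A < L ∧ j.ev env A < L
  | .bin _ a b => a.Ok L env A ∧ b.Ok L env A

def Rep (L : ℕ) (μ : ℕ → ℕ) (A : Arr) : Prop :=
  ∀ t i j, i < L → j < L → μ ((t * L + i) * L + j) = A t i j

/-- Only the registers in the list are constrained; the later ones are free scratch space, so that
nested blocks may leave arbitrary values there. -/
def Agree (env : List ℕ) (ρ : ℕ → ℕ) : Prop := ∀ j, j < env.length → ρ j = env.getD j 0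

theorem Agree.of_getElem? {env : List ℕ} {ρ : ℕ → ℕ} (h : Agree env ρ) {i v : ℕ}
    (hi : env[i]? = some v) : ρ i = v := by
  obtain ⟨hlt, rfl⟩ := List.getElem?_eq_some_iff.1 hi
  rw [h i hlt]; simp [List.getD, hi]

theorem Ex.eval_toExpr {L : ℕ} {env : List ℕ} {A : Arr} {σ : State} (hρ : Agree env σ.reg)
    (hμ : Rep L σ.mem A) (e : Ex) (he : e.Ok L env A) : e.toExpr.eval σ = e.ev env A := by
  induction e with
  | lit k => rfl
  | reg i => exact hρ i he
  | ld t i j ihi ihj =>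
    obtain ⟨h2, hi, hj, hi', hj'⟩ := he
    simp only [toExpr, cellExpr, Expr.eval, Op.eval, ihi hi, ihj hj, hρ.of_getElem? h2, ev]
    exact hμ _ _ _ hi' hj'
  | bin o a b iha ihb => simp only [toExpr, Expr.eval, iha he.1, ihb he.2, ev]

def upd (A : Arr) (t i j v : ℕ) : Arr :=
  fun t' i' j' => if t' = t ∧ i' = i ∧ j' = j then v else A t' i' j'

/-- Uniqueness of digits in base `L`, applied twice; the leading digit `t` needs no bound. -/
theorem cell_inj {L t i j t' i' j' : ℕ} (hi : i < L) (hj : j < L) (hi' : i' < L) (hj' : j' < L)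
    (h : (t * L + i) * L + j = (t' * L + i') * L + j') : t = t' ∧ i = i' ∧ j = j' := by
  have hL : 0 < L := by omega
  have key : ∀ a b c d : ℕ, b < L → d < L → a * L + b = c * L + d → a = c ∧ b = d := by
    intro a b c d hb hd h
    have h1 := congrArg (· / L) h
    have h2 := congrArg (· % L) h
    simp only [mul_comm _ L, Nat.mul_add_div hL, Nat.div_eq_of_lt hb, Nat.div_eq_of_lt hd,
      Nat.mul_add_mod, Nat.mod_eq_of_lt hb, Nat.mod_eq_of_lt hd] at h1 h2
    exact ⟨by simpa using h1, h2⟩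
  obtain ⟨h1, rfl⟩ := key _ _ _ _ hj hj' h
  obtain ⟨rfl, rfl⟩ := key _ _ _ _ hi hi' h1
  exact ⟨rfl, rfl, rfl⟩

theorem Rep.update {L : ℕ} {μ : ℕ → ℕ} {A : Arr} (h : Rep L μ A) {t i j : ℕ} (v : ℕ) (hi : i < L)
    (hj : j < L) : Rep L (Function.update μ ((t * L + i) * L + j) v) (upd A t i j v) := by
  intro t' i' j' hi' hj'
  simp only [upd, Function.update_apply]
  by_cases hc : t' = t ∧ i' = i ∧ j' = j
  · obtain ⟨rfl, rfl, rfl⟩ := hc; simp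
  · rw [if_neg hc, if_neg fun h' => hc (cell_inj hi' hj' hi hj h')]
    exact h _ _ _ hi' hj'

/-! ### Timed Hoare triples and their rules -/

/-- Started with registers `env` and tables `A`, program `p` halts within time `T`, leaves the
registers `env` as they are, and produces tables `A'` and emits words `l` with `Q A' l`. -/
def Runs (W L : ℕ) (p : Prog) (T : ℕ) (env : List ℕ) (A : Arr) (Q : Arr → List ℕ → Prop) : Prop :=
  ∀ ρ μ, Agree env ρ → Rep L μ A → ∃ t ≤ T, ∃ ρ' μ' A' l, Agree env ρ' ∧ Rep L μ' A' ∧ Q A' l ∧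
    ∀ s buf out, Exec W p ⟨ρ, μ, s, buf, out⟩ ⟨ρ', μ', s + t, buf ++ l, out⟩

/-- `Runs` for a program that emits nothing. -/
def Does (W L : ℕ) (p : Prog) (T : ℕ) (env : List ℕ) (A : Arr) (Q : Arr → Prop) : Prop :=
  Runs W L p T env A fun A' l => l = [] ∧ Q A'

variable {W L T T₁ T₂ : ℕ} {env : List ℕ} {A : Arr} {p q : Prog} {Q R : Arr → List ℕ → Prop}
  {Q' R' : Arr → Prop}

theorem Runs.mono (h : Runs W L p T₁ env A Q) (hT : T₁ ≤ T) (hQ : ∀ A l, Q A l → R A l) :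
    Runs W L p T env A R := by
  intro ρ μ hρ hμ
  obtain ⟨t, ht, ρ', μ', A', l, h1, h2, h3, h4⟩ := h ρ μ hρ hμ
  exact ⟨t, ht.trans hT, ρ', μ', A', l, h1, h2, hQ _ _ h3, h4⟩

theorem Does.mono (h : Does W L p T₁ env A Q') (hT : T₁ ≤ T) (hQ : ∀ A, Q' A → R' A) :
    Does W L p T env A R' :=
  Runs.mono h hT fun A _ h => ⟨h.1, hQ A h.2⟩

/-- The postcondition of the first program is a triple for the second one, so intermediate
assertions never have to be spelled out: a specification is applied and the proof goes on from the
resulting tables. -/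
theorem Runs.seq (hp : Runs W L p T₁ env A fun A' l => Runs W L q T₂ env A' fun A'' l' =>
    Q A'' (l ++ l')) (hT : T₁ + T₂ ≤ T) : Runs W L (.seq p q) T env A Q := by
  intro ρ μ hρ hμ
  obtain ⟨t, ht, ρ', μ', A', l, h1, h2, h3, h4⟩ := hp ρ μ hρ hμ
  obtain ⟨t', ht', ρ'', μ'', A'', l', h1', h2', h3', h4'⟩ := h3 ρ' μ' h1 h2
  refine ⟨t + t', by omega, ρ'', μ'', A'', l ++ l', h1', h2', h3', fun s buf out => ?_⟩
  refine Exec.seq _ _ _ _ _ (h4 s buf out) ?_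
  simpa [add_assoc] using h4' (s + t) (buf ++ l) out

theorem Does.seq (hp : Does W L p T₁ env A fun A' => Does W L q T₂ env A' Q') (hT : T₁ + T₂ ≤ T) :
    Does W L (.seq p q) T env A Q' :=
  Runs.seq (Runs.mono hp le_rfl fun A l h => by obtain ⟨rfl, h⟩ := h; exact h) hT

theorem Does.nop (hT : 1 ≤ T) (hQ : Q' A) : Does W L .nop T env A Q' := by
  intro ρ μ hρ hμ
  refine ⟨1, hT, ρ, μ, A, [], hρ, hμ, ⟨rfl, hQ⟩, fun s buf out => ?_⟩
  simpa [State.tick] using Exec.nop (W := W) ⟨ρ, μ, s, buf, out⟩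

/-- Write the value of `e` to a cell. -/
def st (t : ℕ) (i j e : Ex) : Prog := .store (cellExpr t i.toExpr j.toExpr) e.toExpr

/-- Nine tables of `L * L` cells fit below `W`, which makes every address of a table `t < 9` a legal
word. -/
theorem Does.st {t : ℕ} {i j e : Ex} (h2 : env[2]? = some L) (ht : t < 9) (hW : 9 * L * L ≤ W)
    (hi : i.Ok L env A) (hj : j.Ok L env A) (he : e.Ok L env A) (hi' : i.ev env A < L)
    (hj' : j.ev env A < L) (he' : e.ev env A < W)
    (hT : (cellExpr t i.toExpr j.toExpr).cost + e.toExpr.cost + 1 ≤ T)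
    (hQ : Q' (upd A t (i.ev env A) (j.ev env A) (e.ev env A))) :
    Does W L (st t i j e) T env A Q' := by
  intro ρ μ hρ hμ
  refine ⟨_, hT, ρ, _, _, [], hρ, hμ.update (t := t) (e.ev env A) hi' hj', ⟨rfl, hQ⟩,
    fun s buf out => ?_⟩
  have ha : (cellExpr t i.toExpr j.toExpr).eval ⟨ρ, μ, s, buf, out⟩ =
      (t * L + i.ev env A) * L + j.ev env A := by
    simp only [cellExpr, Expr.eval, Op.eval, Ex.eval_toExpr (σ := ⟨ρ, μ, s, buf, out⟩) hρ hμ i hi,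
      Ex.eval_toExpr (σ := ⟨ρ, μ, s, buf, out⟩) hρ hμ j hj, hρ.of_getElem? h2]
  have hv := Ex.eval_toExpr (σ := ⟨ρ, μ, s, buf, out⟩) hρ hμ e he
  have h := Exec.store (W := W) (cellExpr t i.toExpr j.toExpr) e.toExpr ⟨ρ, μ, s, buf, out⟩
    (by rw [ha]; nlinarith) (by rw [hv]; exact he')
  simpa [State.tick, ha, hv, WordRAM.st] using h

theorem Runs.emit {e : Ex} (he : e.Ok L env A) (he' : e.ev env A < W)
    (hT : e.toExpr.cost + 1 ≤ T) (hQ : Q A [e.ev env A]) :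
    Runs W L (.emit e.toExpr) T env A Q := by
  intro ρ μ hρ hμ
  refine ⟨_, hT, ρ, μ, A, _, hρ, hμ, hQ, fun s buf out => ?_⟩
  have hv := Ex.eval_toExpr (σ := ⟨ρ, μ, s, buf, out⟩) hρ hμ e he
  simpa [State.tick, hv] using
    Exec.emit (W := W) e.toExpr ⟨ρ, μ, s, buf, out⟩ (by rw [hv]; exact he')

theorem Does.ite {c : Ex} (hc : c.Ok L env A) (hp : c.ev env A ≠ 0 → Does W L p T₁ env A Q')
    (hq : c.ev env A = 0 → Does W L q T₁ env A Q') (hT : c.toExpr.cost + 1 + T₁ ≤ T) :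
    Does W L (.ite c.toExpr p q) T env A Q' := by
  intro ρ μ hρ hμ
  have hv := fun s buf out => Ex.eval_toExpr (σ := ⟨ρ, μ, s, buf, out⟩) hρ hμ c hc
  by_cases h0 : c.ev env A = 0
  · obtain ⟨t, ht, ρ', μ', A', l, h1, h2, h3, h4⟩ := hq h0 ρ μ hρ hμ
    refine ⟨c.toExpr.cost + 1 + t, by omega, ρ', μ', A', l, h1, h2, h3, fun s buf out => ?_⟩
    refine Exec.ite_false _ _ _ _ _ ((hv _ _ _).trans h0) ?_
    simpa [State.tick, add_assoc] using h4 (s + (c.toExpr.cost + 1)) buf out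
  · obtain ⟨t, ht, ρ', μ', A', l, h1, h2, h3, h4⟩ := hp h0 ρ μ hρ hμ
    refine ⟨c.toExpr.cost + 1 + t, by omega, ρ', μ', A', l, h1, h2, h3, fun s buf out => ?_⟩
    refine Exec.ite_true _ _ _ _ _ (by rw [hv]; exact h0) ?_
    simpa [State.tick, add_assoc] using h4 (s + (c.toExpr.cost + 1)) buf out

theorem Agree.snoc {ρ : ℕ → ℕ} (h : Agree env ρ) (v : ℕ) :
    Agree (env ++ [v]) (Function.update ρ env.length v) := by
  intro j hj
  simp only [List.length_append, List.length_singleton] at hj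
  rcases Nat.lt_succ_iff_lt_or_eq.1 hj with hj | rfl
  · rw [Function.update_of_ne hj.ne, h j hj, List.getD_append _ _ _ _ hj]
  · simp [List.getD]

theorem Agree.of_snoc {ρ : ℕ → ℕ} {v : ℕ} (h : Agree (env ++ [v]) ρ) :
    Agree env ρ ∧ ρ env.length = v := by
  refine ⟨fun j hj => ?_, ?_⟩
  · rw [h j (by simp; omega), List.getD_append _ _ _ _ hj]
  · rw [h _ (by simp)]; simp [List.getD]

/-- Evaluate `e` into the fresh register `k` and run `p`. -/
def letIn (k : ℕ) (e : Ex) (p : Prog) : Prog := .seq (.setReg k e.toExpr) p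

/-- Registers are scoped like a stack: the new one is the first beyond `env`, and it is forgotten
when the block ends. -/
theorem Runs.letIn {k : ℕ} {e : Ex} (hk : k = env.length) (he : e.Ok L env A)
    (he' : e.ev env A < W) (hp : Runs W L p T₁ (env ++ [e.ev env A]) A Q)
    (hT : e.toExpr.cost + 1 + T₁ ≤ T) : Runs W L (letIn k e p) T env A Q := by
  intro ρ μ hρ hμ
  subst hk
  have hv := fun s buf out => Ex.eval_toExpr (σ := ⟨ρ, μ, s, buf, out⟩) hρ hμ e he
  obtain ⟨t, ht, ρ', μ', A', l, h1, h2, h3, h4⟩ := hp _ μ (hρ.snoc _) hμ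
  refine ⟨e.toExpr.cost + 1 + t, by omega, ρ', μ', A', l, h1.of_snoc.1, h2, h3,
    fun s buf out => ?_⟩
  refine Exec.seq _ _ _ _ _ (Exec.setReg _ _ _ (by rw [hv]; exact he')) ?_
  simpa [State.tick, add_assoc, hv] using h4 (s + (e.toExpr.cost + 1)) buf out

theorem Does.letIn {k : ℕ} {e : Ex} (hk : k = env.length) (he : e.Ok L env A)
    (he' : e.ev env A < W) (hp : Does W L p T₁ (env ++ [e.ev env A]) A Q')
    (hT : e.toExpr.cost + 1 + T₁ ≤ T) : Does W L (letIn k e p) T env A Q' :=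
  Runs.letIn hk he he' hp hT

/-- Run `p` with the fresh register `k` set to `0, 1, …` up to the value of register `b`
(exclusive). -/
def forr (k b : ℕ) (p : Prog) : Prog :=
  .seq (.setReg k (.lit 0)) (.loop (.bin .lt (.reg k) (.reg b))
    (.seq p (.setReg k (.bin .add (.reg k) (.lit 1)))))

/-- Each round pays 4 for the test and 4 for the increment besides its body; the 6 outside the
rounds are 2 for the initialization and 4 for the failing test. -/
theorem Runs.forr {k b N c : ℕ} (I : ℕ → Arr → List ℕ → Prop) (hk : k = env.length)
    (hb : env[b]? = some N) (hN : N < W) (h0 : I 0 A [])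
    (hstep : ∀ i < N, ∀ A l, I i A l →
      Runs W L p c (env ++ [i]) A fun A' l' => I (i + 1) A' (l ++ l'))
    (hT : N * (c + 8) + 6 ≤ T) (hQ : ∀ A l, I N A l → Q A l) :
    Runs W L (forr k b p) T env A Q := by
  subst hk
  have hbl : b < env.length := (List.getElem?_eq_some_iff.1 hb).1
  -- Induction on the number `d` of rounds that remain, with the counter at `i`.
  have key : ∀ d i, i + d = N → ∀ A l ρ μ, I i A l → Agree (env ++ [i]) ρ → Rep L μ A →
      ∃ t ≤ d * (c + 8) + 4, ∃ ρ' μ' A' l', Agree env ρ' ∧ Rep L μ' A' ∧ I N A' (l ++ l') ∧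
      ∀ s buf out, Exec W (.loop (.bin .lt (.reg env.length) (.reg b))
          (.seq p (.setReg env.length (.bin .add (.reg env.length) (.lit 1)))))
        ⟨ρ, μ, s, buf, out⟩ ⟨ρ', μ', s + t, buf ++ l', out⟩ := by
    intro d
    induction d with
    | zero =>
      intro i hi A l ρ μ hI hρ hμ
      obtain rfl : i = N := by omega
      refine ⟨4, by omega, ρ, μ, A, [], hρ.of_snoc.1, hμ, by simpa using hI, fun s buf out => ?_⟩
      have := Exec.loop_false (W := W) (.bin .lt (.reg env.length) (.reg b))
        (.seq p (.setReg env.length (.bin .add (.reg env.length) (.lit 1))))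
        ⟨ρ, μ, s, buf, out⟩ (by
          simp [Expr.eval, Op.eval, hρ.of_snoc.2, hρ.of_snoc.1.of_getElem? hb])
      simpa [State.tick, Expr.cost] using this
    | succ d ih =>
      intro i hi A l ρ μ hI hρ hμ
      obtain ⟨t, ht, ρ', μ', A', l', h1, h2, h3, h4⟩ := hstep i (by omega) A l hI ρ μ hρ hμ
      have hag : Agree (env ++ [i + 1]) (Function.update ρ' env.length (i + 1)) :=
        h1.of_snoc.1.snoc _
      obtain ⟨t', ht', ρ'', μ'', A'', l'', h1', h2', h3', h4'⟩ :=
        ih (i + 1) (by omega) A' (l ++ l') _ μ' h3 hag h2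
      refine ⟨4 + t + 4 + t', by rw [Nat.succ_mul]; omega, ρ'', μ'', A'', l' ++ l'', h1', h2',
        by simpa using h3', fun s buf out => ?_⟩
      refine Exec.loop_true _ _ _ ⟨Function.update ρ' env.length (i + 1), μ', s + (4 + t + 4),
        buf ++ l', out⟩ _ ?_ ?_ ?_
      · have : i < N := by omega
        simp [Expr.eval, Op.eval, hρ.of_snoc.2, hρ.of_snoc.1.of_getElem? hb, this]
      · refine Exec.seq _ _ _ _ _ (h4 (s + 4) buf out) ?_
        have := Exec.setReg (W := W) env.length (.bin .add (.reg env.length) (.lit 1))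
          ⟨ρ', μ', s + 4 + t, buf ++ l', out⟩ (by
            simp only [Expr.eval, Op.eval, h1.of_snoc.2]; omega)
        simpa [State.tick, Expr.cost, Expr.eval, Op.eval, h1.of_snoc.2, add_assoc] using this
      · simpa [add_assoc] using h4' (s + (4 + t + 4)) (buf ++ l') out
  intro ρ μ hρ hμ
  obtain ⟨t, ht, ρ', μ', A', l', h1, h2, h3, h4⟩ :=
    key N 0 (by omega) A [] _ μ h0 (hρ.snoc 0) hμ
  refine ⟨2 + t, by omega, ρ', μ', A', l', h1, h2, hQ _ _ (by simpa using h3),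
    fun s buf out => ?_⟩
  refine Exec.seq _ _ _ _ _ (Exec.setReg _ _ _ (by simp only [Expr.eval]; omega)) ?_
  simpa [State.tick, Expr.cost, Expr.eval, add_assoc] using h4 (s + 2) buf out

theorem Does.forr {k b N c : ℕ} (I : ℕ → Arr → Prop) (hk : k = env.length)
    (hb : env[b]? = some N) (hN : N < W) (h0 : I 0 A)
    (hstep : ∀ i < N, ∀ A, I i A → Does W L p c (env ++ [i]) A (I (i + 1)))
    (hT : N * (c + 8) + 6 ≤ T) (hQ : ∀ A, I N A → Q' A) :
    Does W L (forr k b p) T env A Q' := by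
  refine Runs.forr (fun i A l => l = [] ∧ I i A) hk hb hN ⟨rfl, h0⟩ ?_ hT
    fun A l h => ⟨h.1, hQ A h.2⟩
  rintro i hi A l ⟨rfl, h⟩
  exact hstep i hi A h

/-- Replace the first `N` cells of row `i` of table `t` by the values of `f`. -/
def setRow (A : Arr) (t i N : ℕ) (f : ℕ → ℕ) : Arr :=
  fun t' i' j' => if t' = t ∧ i' = i ∧ j' < N then f j' else A t' i' j'

/-- A loop that fills a row, where the new value of a cell depends only on the old values of
this cell and of cells in other rows. -/
theorem Does.fillRow {k b N t i : ℕ} {row e : Ex} {c : ℕ} (f : ℕ → ℕ) (hk : k = env.length)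
    (hb : env[b]? = some N) (hN : N ≤ L) (h2 : env[2]? = some L) (ht : t < 9) (hi : i < L)
    (hW : 9 * L * L ≤ W)
    (hrow : ∀ x A, row.Ok L (env ++ [x]) A ∧ row.ev (env ++ [x]) A = i)
    (he : ∀ x < N, ∀ A', (∀ t' i' j', ¬ (t' = t ∧ i' = i ∧ j' < x) → A' t' i' j' = A t' i' j') →
      e.Ok L (env ++ [x]) A' ∧ e.ev (env ++ [x]) A' = f x ∧ f x < W)
    (hc : (cellExpr t row.toExpr (.reg k)).cost + e.toExpr.cost + 1 ≤ c)
    (hT : N * (c + 8) + 6 ≤ T) (hQ : Q' (setRow A t i N f)) :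
    Does W L (WordRAM.forr k b (WordRAM.st t row (.reg k) e)) T env A Q' := by
  subst hk
  have h2' : ∀ x, (env ++ [x])[2]? = some L := fun x => by
    rw [List.getElem?_append_left (List.getElem?_eq_some_iff.1 h2).1, h2]
  have hNW : N < W := by nlinarith
  refine Does.forr (fun x A' => A' = setRow A t i x f) rfl hb hNW ?_ ?_ hT ?_
  · funext t' i' j'; simp [setRow]
  · rintro x hx _ rfl
    obtain ⟨he1, he2, he3⟩ := he x hx (setRow A t i x f) fun t' i' j' h => by
      simp only [setRow, if_neg h]
    obtain ⟨hr1, hr2⟩ := hrow x (setRow A t i x f)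
    have hreg : (Ex.reg env.length).ev (env ++ [x]) (setRow A t i x f) = x := by
      simp [List.getD]
    refine Does.st (h2' x) ht hW hr1 (by simp) he1 (hr2.trans_lt hi) (by rw [hreg]; omega)
      (he2.trans_lt he3) hc ?_
    rw [hreg, hr2, he2]
    funext t' i' j'
    simp only [upd, setRow]
    by_cases h1 : t' = t ∧ i' = i
    · rcases lt_trichotomy j' x with h3 | h3 | h3
      · simp [h1, h3, h3.ne, Nat.lt_succ_of_lt h3]
      · simp [h1, h3]
      · simp [h1, h3.ne', not_lt.2 h3.le, show ¬ j' < x + 1 by omega]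
    · have h4 : ¬ (t' = t ∧ i' = i ∧ j' = x) := fun h => h1 ⟨h.1, h.2.1⟩
      have h5 : ∀ y, ¬ (t' = t ∧ i' = i ∧ j' < y) := fun y h => h1 ⟨h.1, h.2.1⟩
      rw [if_neg h4, if_neg (h5 x), if_neg (h5 (x + 1))]
  · rintro _ rfl; exact hQ

end WordRAM

/-! ## Binary words that encode the unordered bases of a space over the field with two elements -/

namespace BasisWords

open Finset
open scoped Classical

section Definitions

variable {V : Type*} [AddCommGroup V]

/-- The vector that joins the basis at level `i`. -/
def piv (e : ℕ → V) (w : ℕ → ℕ → ℕ) (i : ℕ) : V :=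
  e i + ∑ j ∈ range i, if w (2 * i) j ≠ 0 then e j else 0

/-- The basis of the span of `e 0, …, e (i - 1)` encoded by the rows `0, …, 2 * i - 1` of `w`. -/
def fam (e : ℕ → V) (w : ℕ → ℕ → ℕ) : ℕ → ℕ → V
  | 0, _ => 0
  | i + 1, j => if j = i then piv e w i else
      if j < i ∧ w (2 * i + 1) j ≠ 0 then fam e w i j + piv e w i else fam e w i j

/-- The last nonzero coordinate of the vector `j` of the basis at level `i`. -/
def lead (w : ℕ → ℕ → ℕ) : ℕ → ℕ → ℕ
  | 0, _ => 0
  | i + 1, j => if j = i ∨ j < i ∧ w (2 * i + 1) j ≠ 0 then i else lead w i j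

/-- Whether the rows of `w` before row `q` permit a nonzero entry in position `j` of row `q`. -/
def Allowed (w : ℕ → ℕ → ℕ) (q j : ℕ) : Prop :=
  j < q / 2 ∧ (q % 2 = 1 → w (q - 1) (lead w (q / 2) j) = 0)

def ValidUpTo (r : ℕ) (w : ℕ → ℕ → ℕ) : Prop :=
  ∀ q < 2 * r, ∀ j, w q j ≤ 1 ∧ (w q j ≠ 0 → Allowed w q j)

/-- Pinning the unused rows to zero makes equality of functions the same as equality of words. -/
def Valid (r : ℕ) (w : ℕ → ℕ → ℕ) : Prop :=
  ValidUpTo r w ∧ ∀ q, 2 * r ≤ q → ∀ j, w q j = 0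

theorem ValidUpTo.mono {r s : ℕ} {w : ℕ → ℕ → ℕ} (h : ValidUpTo s w) (hrs : r ≤ s) :
    ValidUpTo r w := fun q hq => h q (by omega)

theorem piv_congr {e : ℕ → V} {w w' : ℕ → ℕ → ℕ} {i : ℕ} (h : w (2 * i) = w' (2 * i)) :
    piv e w i = piv e w' i := by simp only [piv, h]

theorem fam_congr {e : ℕ → V} {w w' : ℕ → ℕ → ℕ} {i : ℕ} (h : ∀ q < 2 * i, w q = w' q) (j : ℕ) :
    fam e w i j = fam e w' i j := by
  induction i generalizing j with
  | zero => rfl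
  | succ i ih =>
    simp only [fam, ih (fun q hq => h q (by omega)), h (2 * i + 1) (by omega),
      piv_congr (h (2 * i) (by omega))]

theorem lead_congr {w w' : ℕ → ℕ → ℕ} {i : ℕ} (h : ∀ q < 2 * i, w q = w' q) (j : ℕ) :
    lead w i j = lead w' i j := by
  induction i generalizing j with
  | zero => rfl
  | succ i ih =>
    simp only [lead, ih (fun q hq => h q (by omega)), h (2 * i + 1) (by omega)]

/-- Legality of an entry looks at strictly earlier rows only. This is the reason why a word can be
changed at one position and cleared behind it without any search. -/
theorem allowed_congr {w w' : ℕ → ℕ → ℕ} {q : ℕ} (h : ∀ q' < q, w q' = w' q') (j : ℕ) :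
    Allowed w q j ↔ Allowed w' q j := by
  have h1 : lead w (q / 2) j = lead w' (q / 2) j := lead_congr (fun q' hq' => h q' (by omega)) j
  unfold Allowed
  refine and_congr_right fun _ => forall_congr' fun h2 => ?_
  rw [h1, h (q - 1) (by omega)]

theorem lead_lt {w : ℕ → ℕ → ℕ} {i j : ℕ} (hj : j < i) : lead w i j < i := by
  induction i with
  | zero => omega
  | succ i ih =>
    simp only [lead]
    split_ifs with h
    · omega
    · have := ih (by omega); omega

theorem map_piv {V' : Type*} [AddCommGroup V'] (f : V →+ V') (e : ℕ → V) (w : ℕ → ℕ → ℕ) (i : ℕ) :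
    f (piv e w i) = piv (fun k => f (e k)) w i := by
  simp only [piv, map_add, map_sum]
  congr 1
  exact sum_congr rfl fun j _ => by split_ifs <;> simp

/-- The construction uses only sums, so it commutes with additive maps; questions about arbitrary
`e` reduce to unit vectors. -/
theorem map_fam {V' : Type*} [AddCommGroup V'] (f : V →+ V') (e : ℕ → V) (w : ℕ → ℕ → ℕ)
    (i j : ℕ) : f (fam e w i j) = fam (fun k => f (e k)) w i j := by
  induction i generalizing j with
  | zero => simp [fam]
  | succ i ih =>
    simp only [fam]
    split_ifs <;> simp [ih, map_piv]

theorem piv_congr_left {e e' : ℕ → V} {w : ℕ → ℕ → ℕ} {i : ℕ} (h : ∀ k ≤ i, e k = e' k) :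
    piv e w i = piv e' w i := by
  simp only [piv, h i le_rfl]
  congr 1
  refine sum_congr rfl fun j hj => ?_
  rw [h j (mem_range.1 hj).le]

theorem fam_congr_left {e e' : ℕ → V} {w : ℕ → ℕ → ℕ} {i : ℕ} (h : ∀ k < i, e k = e' k) (j : ℕ) :
    fam e w i j = fam e' w i j := by
  induction i generalizing j with
  | zero => rfl
  | succ i ih =>
    simp only [fam, ih (fun k hk => h k (by omega)),
      piv_congr_left (w := w) (fun k (hk : k ≤ i) => h k (by omega))]

end Definitions

theorem zmod_two (a : ZMod 2) : a = 0 ∨ a = 1 := by revert a; decide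

theorem add_self_zmod_two {V : Type*} [AddCommGroup V] [Module (ZMod 2) V] (v : V) : v + v = 0 := by
  have h : (2 : ZMod 2) • v = v + v := two_smul _ v
  rw [← h, show (2 : ZMod 2) = 0 from rfl, zero_smul]

theorem _root_.LinearIndependent.of_eq {ι V : Type*} [AddCommGroup V] [Module (ZMod 2) V]
    {f g : ι → V} (h : LinearIndependent (ZMod 2) f) (hfg : ∀ i, f i = g i) :
    LinearIndependent (ZMod 2) g := (funext hfg : f = g) ▸ h

/-! ### The families encoded in coordinates are bases -/

/-- The standard unit vectors. -/
def unit (k : ℕ) : ℕ → ZMod 2 := Pi.single k 1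

abbrev cfam (w : ℕ → ℕ → ℕ) (i j : ℕ) : ℕ → ZMod 2 := fam unit w i j

/-- The vectors whose coordinates from `r` on vanish. -/
def below (r : ℕ) : Submodule (ZMod 2) (ℕ → ZMod 2) where
  carrier := {v | ∀ k, r ≤ k → v k = 0}
  add_mem' := fun ha hb k hk => by simp [ha k hk, hb k hk]
  zero_mem' := fun _ _ => rfl
  smul_mem' := fun c v hv k hk => by simp [hv k hk]

theorem piv_apply (w : ℕ → ℕ → ℕ) (i k : ℕ) : piv unit w i k =
    if k = i then 1 else if k < i ∧ w (2 * i) k ≠ 0 then 1 else 0 := by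
  simp only [piv, Pi.add_apply, Finset.sum_apply]
  have h : ∀ j, (if w (2 * i) j ≠ 0 then unit j else 0) k =
      if j = k then (if w (2 * i) k ≠ 0 then 1 else 0) else 0 := by
    intro j
    by_cases hj : j = k
    · subst hj
      by_cases h : w (2 * i) j = 0 <;> simp [unit, h]
    · rw [if_neg hj]
      split_ifs
      · simp [unit, Ne.symm hj]
      · rfl
  simp only [h, sum_ite_eq', mem_range]
  by_cases hk : k = i
  · subst hk; simp [unit]
  · rw [if_neg hk, unit, Pi.single_eq_of_ne hk, zero_add]
    by_cases h1 : k < i <;> simp [h1]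

theorem piv_mem (w : ℕ → ℕ → ℕ) (i : ℕ) : piv unit w i ∈ below (i + 1) := by
  intro k hk
  rw [piv_apply, if_neg (by omega), if_neg (by omega)]

theorem piv_self (w : ℕ → ℕ → ℕ) (i : ℕ) : piv unit w i i = 1 := by simp [piv_apply]

theorem below_mono {r s : ℕ} (h : r ≤ s) : below r ≤ below s := fun _ hv k hk => hv k (by omega)

theorem cfam_mem (w : ℕ → ℕ → ℕ) (i j : ℕ) : cfam w i j ∈ below i := by
  induction i generalizing j with
  | zero => exact zero_mem _
  | succ i ih =>
    have h1 := below_mono (Nat.le_succ i) (ih j)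
    simp only [cfam, fam]
    split_ifs
    · exact piv_mem w i
    · exact add_mem h1 (piv_mem w i)
    · exact h1

/-- Before level `i` all vectors vanish at coordinate `i`, where the pivot is `1`; so adding the
pivot moves the last nonzero coordinate to `i`, and otherwise it stays. -/
theorem cfam_lead (w : ℕ → ℕ → ℕ) {i j : ℕ} (hj : j < i) :
    cfam w i j (lead w i j) = 1 ∧ ∀ k, lead w i j < k → cfam w i j k = 0 := by
  induction i with
  | zero => omega
  | succ i ih =>
    have hi : cfam w i j i = 0 := cfam_mem w i j i le_rfl
    have hm := cfam_mem w (i + 1) j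
    by_cases h1 : j = i
    · subst h1
      have h2 : lead w (j + 1) j = j := by simp [lead]
      have h3 : cfam w (j + 1) j = piv unit w j := by simp [cfam, fam]
      rw [h2]
      exact ⟨by rw [h3, piv_self], fun k hk => hm k hk⟩
    · by_cases h2 : j < i ∧ w (2 * i + 1) j ≠ 0
      · have h3 : lead w (i + 1) j = i := by simp [lead, h2]
        have h4 : cfam w (i + 1) j = cfam w i j + piv unit w i := by
          simp only [cfam, fam]; rw [if_neg h1, if_pos h2]
        rw [h3]
        exact ⟨by rw [h4, Pi.add_apply, hi, piv_self, zero_add], fun k hk => hm k hk⟩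
      · have h3 : lead w (i + 1) j = lead w i j := by
          simp only [lead]; rw [if_neg (by tauto)]
        have h4 : cfam w (i + 1) j = cfam w i j := by
          simp only [cfam, fam]; rw [if_neg h1, if_neg h2]
        rw [h3, h4]
        exact ih (by omega)

/-- The pivot is independent of the older vectors because they all vanish at coordinate `i`; adding
it to some of them is an invertible change of the family. -/
theorem linearIndependent_cfam (w : ℕ → ℕ → ℕ) (i : ℕ) :
    LinearIndependent (ZMod 2) (fun j : Fin i => cfam w i j) := by
  induction i with
  | zero => exact linearIndependent_empty_type
  | succ i ih =>
    have h1 : LinearIndependent (ZMod 2)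
        (Fin.snoc (fun j : Fin i => cfam w i j) (piv unit w i) : Fin (i + 1) → ℕ → ZMod 2) := by
      refine linearIndependent_finSnoc.2 ⟨ih, fun h => ?_⟩
      have h2 : Submodule.span (ZMod 2) (Set.range fun j : Fin i => cfam w i j) ≤ below i := by
        rw [Submodule.span_le]
        rintro _ ⟨j, rfl⟩
        exact cfam_mem w i j
      have := h2 h i le_rfl
      rw [piv_self] at this
      exact one_ne_zero this
    have h2 := (linearIndependent_add_smul_iff (R := ZMod 2) (i := Fin.last i)
      (v := (Fin.snoc (fun j : Fin i => cfam w i j) (piv unit w i) : Fin (i + 1) → ℕ → ZMod 2))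
      (c := fun j => if (j : ℕ) < i ∧ w (2 * i + 1) j ≠ 0 then 1 else 0) (by simp)).2 h1
    refine h2.of_eq fun j => ?_
    refine Fin.lastCases ?_ (fun j => ?_) j
    · simp [cfam, fam]
    · have := j.2
      simp only [cfam, fam, Pi.add_apply, Fin.snoc_castSucc, Fin.snoc_last,
        Fin.val_castSucc, if_neg this.ne]
      split_ifs <;> simp

theorem cfam_injOn (w : ℕ → ℕ → ℕ) {i j k : ℕ} (hj : j < i) (hk : k < i)
    (h : cfam w i j = cfam w i k) : j = k := by
  have := (linearIndependent_cfam w i).injective (a₁ := ⟨j, hj⟩) (a₂ := ⟨k, hk⟩) h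
  simpa using this

theorem cfam_ne_zero (w : ℕ → ℕ → ℕ) {i j : ℕ} (hj : j < i) : cfam w i j ≠ 0 :=
  (linearIndependent_cfam w i).ne_zero ⟨j, hj⟩

/-- `B` is a basis of the `r`-dimensional space `U`. -/
def IsBasisOf {V : Type*} [AddCommGroup V] [Module (ZMod 2) V] (U : Submodule (ZMod 2) V) (r : ℕ)
    (B : Finset V) : Prop :=
  (∀ v ∈ B, v ∈ U) ∧ LinearIndepOn (ZMod 2) id (B : Set V) ∧ B.card = r

/-- The basis encoded by `w`, as a set. -/
noncomputable def famSet {V : Type*} [AddCommGroup V] (e : ℕ → V) (w : ℕ → ℕ → ℕ) (r : ℕ) :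
    Finset V := (range r).image (fam e w r)

theorem isBasisOf_image {V : Type*} [AddCommGroup V] [Module (ZMod 2) V]
    {U : Submodule (ZMod 2) V} {ι : Type*} {s : Finset ι} {f : ι → V} (hU : ∀ i ∈ s, f i ∈ U)
    (hf : LinearIndependent (ZMod 2) (fun i : s => f i)) : IsBasisOf U s.card (s.image f) := by
  refine ⟨by simpa using hU, ?_, card_image_of_injOn fun a ha b hb h => ?_⟩
  · rw [coe_image]
    exact LinearIndepOn.id_image hf
  · simpa using hf.injective (a₁ := ⟨a, ha⟩) (a₂ := ⟨b, hb⟩) h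

theorem isBasisOf_famSet_of_linearIndependent {V : Type*} [AddCommGroup V] [Module (ZMod 2) V]
    {U : Submodule (ZMod 2) V} {e : ℕ → V} {w : ℕ → ℕ → ℕ} {r : ℕ}
    (hU : ∀ j < r, fam e w r j ∈ U)
    (hf : LinearIndependent (ZMod 2) (fun j : Fin r => fam e w r j)) :
    IsBasisOf U r (famSet e w r) := by
  have h := isBasisOf_image (s := range r) (f := fam e w r) (U := U)
    (fun j hj => hU j (mem_range.1 hj))
    (hf.comp (fun i : range r => (⟨i, mem_range.1 i.2⟩ : Fin r)) fun a b h =>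
      Subtype.ext (Fin.mk.inj_iff.1 h))
  rwa [card_range] at h

theorem isBasisOf_below (w : ℕ → ℕ → ℕ) (r : ℕ) : IsBasisOf (below r) r (famSet unit w r) :=
  isBasisOf_famSet_of_linearIndependent (fun j _ => cfam_mem w r j) (linearIndependent_cfam w r)

/-! ### The binary order on vectors -/

/-- The number with binary digits `v 0, …, v (r - 1)`. -/
def num (v : ℕ → ZMod 2) (r : ℕ) : ℕ := ∑ k ∈ range r, (v k).val * 2 ^ k

theorem num_lt (v : ℕ → ZMod 2) (r : ℕ) : num v r < 2 ^ r := by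
  induction r with
  | zero => simp [num]
  | succ r ih =>
    have h : (v r).val * 2 ^ r ≤ 1 * 2 ^ r :=
      Nat.mul_le_mul_right _ (Nat.le_of_lt_succ (ZMod.val_lt (v r)))
    rw [num, sum_range_succ, ← num, pow_succ]
    omega

/-- Binary numbers compare at the highest digit in which they differ, whatever the lower digits are.
-/
theorem num_lt_num {u v : ℕ → ZMod 2} {l r : ℕ} (hl : l < r) (hu : u l = 0) (hv : v l = 1)
    (h : ∀ k, l < k → u k = v k) : num u r < num v r := by
  induction r with
  | zero => omega
  | succ r ih =>
    rw [num, num, sum_range_succ, sum_range_succ, ← num, ← num]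
    rcases Nat.lt_succ_iff_lt_or_eq.1 hl with hl | rfl
    · have := ih hl
      rw [h r hl]
      omega
    · have h1 : (v l).val = 1 := by rw [hv]; rfl
      have := num_lt u l
      rw [hu, h1]
      simp only [ZMod.val_zero]
      omega

/-- Adding a vector with last nonzero coordinate `l` to a vector that vanishes there. -/
theorem num_lt_num_add {p b : ℕ → ZMod 2} {l r : ℕ} (hl : l < r) (hb : b l = 1)
    (hb' : ∀ k, l < k → b k = 0) (hp : p l = 0) : num p r < num (b + p) r :=
  num_lt_num hl hp (by simp [hb, hp]) fun k hk => by simp [hb' k hk]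

theorem num_add_lt_num {p b : ℕ → ZMod 2} {l r : ℕ} (hl : l < r) (hb : b l = 1)
    (hb' : ∀ k, l < k → b k = 0) (hp : p l = 1) : num (b + p) r < num p r :=
  num_lt_num hl (by rw [Pi.add_apply, hb, hp]; rfl) hp fun k hk => by simp [hb' k hk]

/-! ### Every basis is encoded by exactly one word -/

/-- Remove the last coordinate with the help of `p`. -/
def fold (p : ℕ → ZMod 2) (r : ℕ) (v : ℕ → ZMod 2) : ℕ → ZMod 2 := v + v r • p

theorem fold_mem {p v : ℕ → ZMod 2} {r : ℕ} (hp : p ∈ below (r + 1)) (hpr : p r = 1)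
    (hv : v ∈ below (r + 1)) : fold p r v ∈ below r := by
  intro k hk
  rcases hk.lt_or_eq with hk | rfl
  · simp [fold, hp k hk, hv k hk]
  · simp only [fold, Pi.add_apply, Pi.smul_apply, hpr, smul_eq_mul, mul_one]
    exact add_self_zmod_two (v r)

/-- This undoes one level of the construction: subtracting multiples of `p` from the other members
keeps independence, and it clears coordinate `r`. -/
theorem IsBasisOf.fold {r : ℕ} {B : Finset (ℕ → ZMod 2)} (hB : IsBasisOf (below (r + 1)) (r + 1) B)
    {p : ℕ → ZMod 2} (hp : p ∈ B) (hpr : p r = 1) :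
    IsBasisOf (below r) r ((B.erase p).image (fold p r)) := by
  have hcard : (B.erase p).card = r := by rw [card_erase_of_mem hp, hB.2.2]; rfl
  have h : LinearIndependent (ZMod 2) (fun v : B.erase p => BasisWords.fold p r v) := by
    have h1 := (linearIndependent_add_smul_iff (R := ZMod 2) (i := (⟨p, hp⟩ : B))
      (v := fun v : B => (v : ℕ → ZMod 2))
      (c := fun v => if v = ⟨p, hp⟩ then 0 else (v : ℕ → ZMod 2) r) (by simp)).2 hB.2.1
    have h2 := h1.comp (fun v : B.erase p => (⟨v, mem_of_mem_erase v.2⟩ : B))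
      fun a b h => Subtype.ext (congrArg (fun x : B => (x : ℕ → ZMod 2)) h)
    refine h2.of_eq fun v => ?_
    have := ne_of_mem_erase v.2
    simp [BasisWords.fold, Subtype.ext_iff, this]
  have := isBasisOf_image (U := below r)
    (fun v hv => fold_mem (hB.1 p hp) hpr (hB.1 v (mem_of_mem_erase hv))) h
  rwa [hcard] at this

/-- Restriction to the first `r` coordinates is injective on `below r`, so the bound is the
dimension of `Fin r → ZMod 2`. -/
theorem card_le_of_below {r : ℕ} {B : Finset (ℕ → ZMod 2)} (hB : ∀ v ∈ B, v ∈ below r)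
    (hli : LinearIndepOn (ZMod 2) id (B : Set (ℕ → ZMod 2))) : B.card ≤ r := by
  let f : (ℕ → ZMod 2) →ₗ[ZMod 2] (Fin r → ZMod 2) := LinearMap.funLeft _ _ (fun j : Fin r => (j : ℕ))
  have h : LinearIndependent (ZMod 2) (f ∘ fun v : B => (v : ℕ → ZMod 2)) := by
    refine LinearIndependent.map_injOn hli f fun a ha b hb hab => ?_
    have h2 : Submodule.span (ZMod 2) (Set.range fun v : B => (v : ℕ → ZMod 2)) ≤ below r := by
      rw [Submodule.span_le]
      rintro _ ⟨v, rfl⟩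
      exact hB v v.2
    funext k
    by_cases hk : k < r
    · exact congrFun hab ⟨k, hk⟩
    · rw [h2 ha k (by omega), h2 hb k (by omega)]
  simpa using h.fintype_card_le_finrank

/-- Peel off the smallest member `p` with nonzero last coordinate, fold the rest with it, and encode
the folded basis by induction. Minimality of `p` is what makes the two new rows legal. -/
theorem exists_word {r : ℕ} {B : Finset (ℕ → ZMod 2)} (hB : IsBasisOf (below r) r B) :
    ∃ w, Valid r w ∧ famSet unit w r = B := by
  induction r generalizing B with
  | zero =>
    refine ⟨fun _ _ => 0, ⟨fun q hq => by omega, fun _ _ _ => rfl⟩, ?_⟩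
    rw [card_eq_zero.1 hB.2.2]; rfl
  | succ r ih =>
    -- Otherwise all `r + 1` independent vectors would lie in the `r`-dimensional space `below r`.
    have hne : (B.filter fun v => v r = 1).Nonempty := by
      by_contra hemp
      rw [not_nonempty_iff_eq_empty, filter_eq_empty_iff] at hemp
      have := card_le_of_below (r := r) (B := B) (fun v hv k hk => by
        rcases hk.lt_or_eq with hk | rfl
        · exact hB.1 v hv k hk
        · exact (zmod_two _).resolve_right (hemp hv)) hB.2.1
      rw [hB.2.2] at this
      omega
    obtain ⟨p, hp, hmin⟩ := exists_min_image _ (fun v => num v r) hne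
    rw [mem_filter] at hp
    obtain ⟨hp, hpr⟩ := hp
    obtain ⟨w', hw', hfam⟩ := ih (hB.fold hp hpr)
    -- Row `2 * r` holds the digits of `p`; row `2 * r + 1` marks the folded vectors that occur in
    -- `B` with `p` added.
    let w : ℕ → ℕ → ℕ := fun q j => if q < 2 * r then w' q j else
      if q = 2 * r ∧ j < r then (p j).val else
      if q = 2 * r + 1 ∧ j < r ∧ cfam w' r j + p ∈ B then 1 else 0
    have hww : ∀ q < 2 * r, w q = w' q := fun q hq => by funext j; simp only [w, if_pos hq]
    have hx : ∀ j, w (2 * r) j = if j < r then (p j).val else 0 := fun j => by simp [w]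
    have hs : ∀ j, w (2 * r + 1) j = if j < r ∧ cfam w' r j + p ∈ B then 1 else 0 :=
      fun j => by simp [w]
    have hpiv : piv unit w r = p := by
      funext k
      rw [piv_apply]
      by_cases h1 : k = r
      · rw [h1, if_pos rfl, hpr]
      · rw [if_neg h1]
        by_cases h2 : k < r
        · rcases zmod_two (p k) with h3 | h3
          · simp [hx, h2, h3]
          · rw [if_pos ⟨h2, by rw [hx, if_pos h2, h3]; decide⟩, h3]
        · rw [if_neg (by tauto)]
          exact (hB.1 p hp k (by omega)).symm
    refine ⟨w, ⟨?_, ?_⟩, ?_⟩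
    · intro q hq j
      by_cases h1 : q < 2 * r
      · rw [hww q h1, allowed_congr (fun q' hq' => hww q' (by omega))]
        exact hw'.1 q h1 j
      · obtain rfl | rfl : q = 2 * r ∨ q = 2 * r + 1 := by omega
        · rw [hx]
          split_ifs with h2
          · exact ⟨Nat.le_of_lt_succ (ZMod.val_lt (p j)), fun _ => ⟨by omega, fun h => by omega⟩⟩
          · exact ⟨by omega, fun h => absurd rfl h⟩
        · rw [hs]
          split_ifs with h2
          · refine ⟨le_rfl, fun _ => ⟨by omega, fun _ => ?_⟩⟩
            rw [show (2 * r + 1) / 2 = r by omega, show 2 * r + 1 - 1 = 2 * r by omega,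
              lead_congr hww, hx, if_pos (lead_lt h2.1)]
            rcases zmod_two (p (lead w' r j)) with h3 | h3
            · rw [h3]; rfl
            -- If `p` were `1` at this leading coordinate, the member of `B` obtained by adding `p`
            -- would be smaller than `p`.
            · obtain ⟨h4, h5⟩ := cfam_lead w' h2.1
              have h6 := num_add_lt_num (lead_lt h2.1) h4 h5 h3
              have h7 := hmin (cfam w' r j + p) (mem_filter.2 ⟨h2.2, by
                rw [Pi.add_apply, cfam_mem w' r j r le_rfl, hpr, zero_add]⟩)
              omega
          · exact ⟨by omega, fun h => absurd rfl h⟩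
    · intro q hq j
      simp only [w]
      rw [if_neg (by omega), if_neg (by omega), if_neg (by omega)]
    · refine eq_of_subset_of_card_le ?_ ?_
      · intro v hv
        obtain ⟨j, hj, rfl⟩ := mem_image.1 hv
        rw [mem_range] at hj
        simp only [fam, hpiv, fam_congr hww]
        by_cases h1 : j = r
        · rw [if_pos h1]; exact hp
        · rw [if_neg h1]
          have hj' : j < r := by omega
          have h2 : cfam w' r j ∈ (B.erase p).image (fold p r) := by
            rw [← hfam]; exact mem_image_of_mem _ (mem_range.2 hj')
          by_cases h3 : cfam w' r j + p ∈ B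
          · rw [if_pos ⟨hj', by simp [hs, hj', h3]⟩]; exact h3
          · rw [if_neg (by simp [hs, h3])]
            -- The folded vector comes from some `v` in `B`: either it is `v` itself, or adding `p`
            -- gives back `v`, against the assumption that this sum is not in `B`.
            obtain ⟨v, hv, hv'⟩ := mem_image.1 h2
            rcases zmod_two (v r) with h4 | h4
            · simp only [fold, h4, zero_smul, add_zero] at hv'
              change cfam w' r j ∈ B
              rw [← hv']
              exact mem_of_mem_erase hv
            · simp only [fold, h4, one_smul] at hv'
              rw [← hv', add_assoc, add_self_zmod_two, add_zero] at h3
              exact absurd (mem_of_mem_erase hv) h3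
      · rw [(isBasisOf_below w (r + 1)).2.2, hB.2.2]

theorem cfam_succ_of_lt (w : ℕ → ℕ → ℕ) {r j : ℕ} (hj : j < r) :
    cfam w (r + 1) j = if w (2 * r + 1) j ≠ 0 then cfam w r j + piv unit w r else cfam w r j := by
  simp only [cfam, fam]
  rw [if_neg hj.ne]
  simp only [hj, true_and]

theorem cfam_succ_self (w : ℕ → ℕ → ℕ) (r : ℕ) : cfam w (r + 1) r = piv unit w r := by
  simp [cfam, fam]

theorem piv_mem_famSet (w : ℕ → ℕ → ℕ) (r : ℕ) : piv unit w r ∈ famSet unit w (r + 1) :=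
  mem_image.2 ⟨r, by simp, cfam_succ_self w r⟩

/-- The other members with nonzero coordinate `r` are sums of an older vector and the pivot.
Validity makes the pivot vanish at the leading coordinate of the older vector, so the sum is larger.
-/
theorem piv_minimal {w : ℕ → ℕ → ℕ} {r : ℕ} (hw : ValidUpTo (r + 1) w) {v : ℕ → ZMod 2}
    (hv : v ∈ famSet unit w (r + 1)) (hvr : v r = 1) (hne : v ≠ piv unit w r) :
    num (piv unit w r) r < num v r := by
  obtain ⟨j, hj, rfl⟩ := mem_image.1 hv
  rw [mem_range] at hj
  by_cases h1 : j = r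
  · subst h1; exact absurd (cfam_succ_self w j) hne
  · have hj' : j < r := by omega
    have h2 := cfam_succ_of_lt w hj'
    by_cases h3 : w (2 * r + 1) j = 0
    · rw [if_neg (by simpa using h3)] at h2
      rw [show fam unit w (r + 1) j = cfam w r j from h2, cfam_mem w r j r le_rfl] at hvr
      exact absurd hvr zero_ne_one
    · rw [if_pos h3] at h2
      rw [show fam unit w (r + 1) j = _ from h2]
      obtain ⟨h4, h5⟩ := cfam_lead w hj'
      refine num_lt_num_add (lead_lt hj') h4 h5 ?_
      have h6 := ((hw (2 * r + 1) (by omega) j).2 h3).2 (by omega)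
      rw [show (2 * r + 1) / 2 = r by omega, show 2 * r + 1 - 1 = 2 * r by omega] at h6
      rw [piv_apply, if_neg (lead_lt hj').ne, if_neg (by simp [h6])]

theorem famSet_eq_fold (w : ℕ → ℕ → ℕ) (r : ℕ) :
    famSet unit w r = ((famSet unit w (r + 1)).erase (piv unit w r)).image
      (fold (piv unit w r) r) := by
  have hB := isBasisOf_below w (r + 1)
  refine eq_of_subset_of_card_le ?_ ?_
  · intro v hv
    obtain ⟨j, hj, rfl⟩ := mem_image.1 hv
    rw [mem_range] at hj
    refine mem_image.2 ⟨cfam w (r + 1) j, mem_erase.2 ⟨?_, mem_image_of_mem _ (by simp; omega)⟩, ?_⟩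
    · rw [← cfam_succ_self w r]
      exact fun h => hj.ne (cfam_injOn w (by omega) (by omega) h)
    · have h0 : cfam w r j r = 0 := cfam_mem w r j r le_rfl
      rw [cfam_succ_of_lt w hj, fold]
      split_ifs
      · rw [Pi.add_apply, h0, piv_self, zero_add, one_smul, add_assoc, add_self_zmod_two, add_zero]
      · rw [h0, zero_smul, add_zero]
  · rw [(hB.fold (piv_mem_famSet w r) (piv_self w r)).2.2, (isBasisOf_below w r).2.2]

/-- The set determines the pivot as its unique minimum with nonzero coordinate `r`, hence also the
folded basis. Induction gives the earlier rows, the digits of the pivot give row `2 * r`, and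
membership of the sums gives row `2 * r + 1`. -/
theorem rows_eq {r : ℕ} {w w' : ℕ → ℕ → ℕ} (hw : ValidUpTo r w) (hw' : ValidUpTo r w')
    (h : famSet unit w r = famSet unit w' r) : ∀ q < 2 * r, w q = w' q := by
  induction r with
  | zero => intro q hq; omega
  | succ r ih =>
    have hp : piv unit w r = piv unit w' r := by
      by_contra hne
      have h1 := piv_minimal hw' (h ▸ piv_mem_famSet w r) (piv_self w r) hne
      have h2 := piv_minimal hw (h.symm ▸ piv_mem_famSet w' r) (piv_self w' r) (Ne.symm hne)
      omega
    have hrow := ih (hw.mono (Nat.le_succ r)) (hw'.mono (Nat.le_succ r)) (by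
      rw [famSet_eq_fold w, famSet_eq_fold w', h, hp])
    have hle : ∀ {u : ℕ → ℕ → ℕ}, ValidUpTo (r + 1) u → ∀ q, q < 2 * (r + 1) → ∀ j, r ≤ j →
        u q j = 0 := by
      intro u hu q hq j hj
      by_contra h1
      have := ((hu q hq j).2 h1).1
      omega
    have h01 : ∀ {a b : ℕ}, a ≤ 1 → b ≤ 1 → (a ≠ 0 ↔ b ≠ 0) → a = b := by omega
    -- One implication for the odd row, used twice by symmetry. The sum has coordinate `r` equal to
    -- `1`, so in the other family it is the pivot, which would make an older vector zero, or a sum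
    -- with the same older vector.
    have hsub : ∀ {u u' : ℕ → ℕ → ℕ}, (∀ q < 2 * r, u q = u' q) → piv unit u r = piv unit u' r →
        famSet unit u (r + 1) = famSet unit u' (r + 1) → ∀ j < r, u (2 * r + 1) j ≠ 0 →
        u' (2 * r + 1) j ≠ 0 := by
      intro u u' hrow hp h j hj h1 h2
      have h3 : cfam u r j + piv unit u r ∈ famSet unit u' (r + 1) := by
        rw [← h]
        refine mem_image.2 ⟨j, by simp; omega, ?_⟩
        rw [show fam unit u (r + 1) j = _ from cfam_succ_of_lt u hj, if_pos h1]
      obtain ⟨k, hk, hk'⟩ := mem_image.1 h3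
      rw [mem_range] at hk
      have h4 : cfam u r j = cfam u' r j := fam_congr hrow j
      by_cases hkr : k = r
      · rw [hkr, show fam unit u' (r + 1) r = _ from cfam_succ_self u' r, hp] at hk'
        exact cfam_ne_zero u hj (by simpa using hk')
      · have hk2 : k < r := by omega
        rw [show fam unit u' (r + 1) k = _ from cfam_succ_of_lt u' hk2] at hk'
        split_ifs at hk' with h5
        · rw [hp, h4] at hk'
          exact h5 (cfam_injOn u' hk2 hj (add_right_cancel hk') ▸ h2)
        · have h6 := congrFun hk' r
          rw [Pi.add_apply, piv_self, cfam_mem u r j r le_rfl, cfam_mem u' r k r le_rfl] at h6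
          simp at h6
    intro q hq
    by_cases h1 : q < 2 * r
    · exact hrow q h1
    funext j
    by_cases hj : j < r
    · refine h01 (hw q hq j).1 (hw' q hq j).1 ?_
      obtain rfl | rfl : q = 2 * r ∨ q = 2 * r + 1 := by omega
      · have := congrFun hp j
        rw [piv_apply, piv_apply, if_neg hj.ne, if_neg hj.ne] at this
        simp only [hj, true_and] at this
        refine ⟨fun h1 h2 => ?_, fun h1 h2 => ?_⟩
        · rw [if_pos h1, if_neg (not_not.2 h2)] at this; exact one_ne_zero this
        · rw [if_pos h1, if_neg (not_not.2 h2)] at this; exact zero_ne_one this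
      · exact ⟨hsub hrow hp h j hj, hsub (fun q hq => (hrow q hq).symm) hp.symm h.symm j hj⟩
    · rw [hle hw q hq j (by omega), hle hw' q hq j (by omega)]

/-! ### Transport from unit vectors to an arbitrary basis -/

section Transport

variable {V : Type*} [AddCommGroup V] [Module (ZMod 2) V] {e : ℕ → V} {r : ℕ}

/-- The linear map that sends the unit vectors to `e 0, …, e (r - 1)`. -/
def comb (e : ℕ → V) (r : ℕ) : (ℕ → ZMod 2) →ₗ[ZMod 2] V :=
  ∑ k ∈ range r, (LinearMap.proj k : (ℕ → ZMod 2) →ₗ[ZMod 2] ZMod 2).smulRight (e k)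

theorem comb_apply (v : ℕ → ZMod 2) : comb e r v = ∑ k ∈ range r, v k • e k := by simp [comb]

theorem comb_unit {k : ℕ} (hk : k < r) : comb e r (unit k) = e k := by
  rw [comb_apply, sum_eq_single k]
  · simp [unit]
  · intro j _ hj; simp [unit, hj]
  · intro h; exact absurd (mem_range.2 hk) h

theorem comb_fam (w : ℕ → ℕ → ℕ) (j : ℕ) : comb e r (cfam w r j) = fam e w r j :=
  (map_fam (comb e r).toAddMonoidHom unit w r j).trans
    (fam_congr_left (fun _ hk => comb_unit hk) j)

theorem comb_injOn (he : LinearIndependent (ZMod 2) (fun j : Fin r => e j)) :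
    Set.InjOn (comb e r) (below r) := by
  intro a ha b hb hab
  have h1 : ∑ k : Fin r, (a k - b k) • e k = 0 := by
    rw [Fin.sum_univ_eq_sum_range (fun k => (a k - b k) • e k), ← sub_eq_zero.2 hab, comb_apply,
      comb_apply, ← sum_sub_distrib]
    simp only [sub_smul]
  funext k
  by_cases hk : k < r
  · exact sub_eq_zero.1 (Fintype.linearIndependent_iff.1 he _ h1 ⟨k, hk⟩)
  · rw [ha k (by omega), hb k (by omega)]

theorem exists_comb_eq {v : V} (hv : v ∈ Submodule.span (ZMod 2) (Set.range fun j : Fin r => e j)) :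
    ∃ x ∈ below r, comb e r x = v := by
  obtain ⟨c, rfl⟩ := (Submodule.mem_span_range_iff_exists_fun (ZMod 2)).1 hv
  refine ⟨fun k => if h : k < r then c ⟨k, h⟩ else 0, fun k hk => dif_neg (by omega), ?_⟩
  rw [comb_apply, ← Fin.sum_univ_eq_sum_range
    (fun k => (if h : k < r then c ⟨k, h⟩ else 0) • e k)]
  simp

theorem comb_mem {x : ℕ → ZMod 2} :
    comb e r x ∈ Submodule.span (ZMod 2) (Set.range fun j : Fin r => e j) := by
  rw [comb_apply]
  exact sum_mem fun k hk =>
    Submodule.smul_mem _ _ (Submodule.subset_span ⟨⟨k, mem_range.1 hk⟩, rfl⟩)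

theorem linearIndependent_fam (he : LinearIndependent (ZMod 2) (fun j : Fin r => e j))
    (w : ℕ → ℕ → ℕ) : LinearIndependent (ZMod 2) (fun j : Fin r => fam e w r j) := by
  have h := (linearIndependent_cfam w r).map_injOn (comb e r) ((comb_injOn he).mono (by
    change (Submodule.span _ _ : Submodule _ _) ≤ below r
    rw [Submodule.span_le]
    rintro _ ⟨v, rfl⟩
    exact cfam_mem w r v))
  exact h.of_eq fun j => comb_fam w j

theorem isBasisOf_famSet (he : LinearIndependent (ZMod 2) (fun j : Fin r => e j))
    (w : ℕ → ℕ → ℕ) :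
    IsBasisOf (Submodule.span (ZMod 2) (Set.range fun j : Fin r => e j)) r (famSet e w r) :=
  isBasisOf_famSet_of_linearIndependent (fun j _ => by rw [← comb_fam]; exact comb_mem)
    (linearIndependent_fam he w)

theorem image_comb_famSet (w : ℕ → ℕ → ℕ) :
    (famSet unit w r).image (comb e r) = famSet e w r := by
  rw [famSet, famSet, image_image]
  exact image_congr fun j _ => comb_fam w j

theorem exists_valid_famSet_eq {B : Finset V}
    (hB : IsBasisOf (Submodule.span (ZMod 2) (Set.range fun j : Fin r => e j)) r B) :
    ∃ w, Valid r w ∧ famSet e w r = B := by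
  choose! f hf hf' using fun v hv => exists_comb_eq (e := e) (r := r) (v := v) hv
  have h : LinearIndependent (ZMod 2) (fun v : B => f v) := by
    refine LinearIndependent.of_comp (comb e r) ?_
    refine LinearIndependent.of_eq hB.2.1 fun v => ?_
    exact (hf' v (hB.1 v v.2)).symm
  have h2 := isBasisOf_image (U := below r) (fun v hv => hf v (hB.1 v hv)) h
  rw [hB.2.2] at h2
  obtain ⟨w, hw, hw'⟩ := exists_word h2
  refine ⟨w, hw, ?_⟩
  rw [← image_comb_famSet, hw', image_image]
  conv_rhs => rw [← image_id (s := B)]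
  exact image_congr fun v hv => hf' v (hB.1 v hv)

theorem famSet_injective (he : LinearIndependent (ZMod 2) (fun j : Fin r => e j))
    {w w' : ℕ → ℕ → ℕ} (hw : Valid r w) (hw' : Valid r w') (h : famSet e w r = famSet e w' r) :
    w = w' := by
  have hsub : ∀ u, (famSet unit u r : Set (ℕ → ZMod 2)) ⊆ below r := fun u v hv =>
    (isBasisOf_below u r).1 v hv
  rw [← image_comb_famSet w, ← image_comb_famSet w', ← coe_inj, coe_image, coe_image,
    (comb_injOn he).image_eq_image_iff (hsub w) (hsub w'), coe_inj] at h
  funext q j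
  by_cases hq : q < 2 * r
  · rw [rows_eq hw.1 hw'.1 h q hq]
  · rw [hw.2 q (by omega), hw'.2 q (by omega)]

end Transport

end BasisWords

/-! ## The lexicographic successor of a word -/

namespace BasisWords

/-- The words in lexicographic order. -/
def key (w : ℕ → ℕ → ℕ) : Lex (ℕ → Lex (ℕ → ℕ)) := toLex fun q => toLex (w q)

theorem key_injective : Function.Injective key := fun _ _ h => h

theorem key_lt_key {w x : ℕ → ℕ → ℕ} : key w < key x ↔
    ∃ q j, (∀ q' < q, w q' = x q') ∧ (∀ j' < j, w q j' = x q j') ∧ w q j < x q j :=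
  ⟨fun ⟨q, h, j, h', h''⟩ => ⟨q, j, h, h', h''⟩, fun ⟨q, j, h, h', h''⟩ => ⟨q, h, j, h', h''⟩⟩

/-- The number of a position; positive, so that `0` can stand for no position. -/
def pos (L q j : ℕ) : ℕ := q * L + j + 1

theorem pos_lt_pos {L q j q' j' : ℕ} (hj : j < L) (h : q < q' ∨ q = q' ∧ j < j') :
    pos L q j < pos L q' j' := by
  unfold pos
  rcases h with h | ⟨rfl, h⟩
  · nlinarith
  · omega

theorem pos_trichotomy {L q j q' j' : ℕ} (hj : j < L) (hj' : j' < L) :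
    pos L q j < pos L q' j' ∧ (q < q' ∨ q = q' ∧ j < j') ∨
    pos L q j = pos L q' j' ∧ q = q' ∧ j = j' ∨
    pos L q' j' < pos L q j ∧ (q' < q ∨ q' = q ∧ j' < j) := by
  rcases lt_trichotomy q q' with h | h | h
  · exact Or.inl ⟨pos_lt_pos hj (Or.inl h), Or.inl h⟩
  · rcases lt_trichotomy j j' with h' | h' | h'
    · exact Or.inl ⟨pos_lt_pos hj (Or.inr ⟨h, h'⟩), Or.inr ⟨h, h'⟩⟩
    · exact Or.inr (Or.inl ⟨by rw [h, h'], h, h'⟩)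
    · exact Or.inr (Or.inr ⟨pos_lt_pos hj' (Or.inr ⟨h.symm, h'⟩), Or.inr ⟨h.symm, h'⟩⟩)
  · exact Or.inr (Or.inr ⟨pos_lt_pos hj' (Or.inl h), Or.inl h⟩)

/-- A position in which a zero of `w` can be raised. -/
def Cand (r : ℕ) (w : ℕ → ℕ → ℕ) (q j : ℕ) : Prop := q < 2 * r ∧ Allowed w q j ∧ w q j = 0

/-- `l` is the number of the last position in which `w` can be raised, or `0` if there is none. -/
def IsLast (L r : ℕ) (w : ℕ → ℕ → ℕ) (l : ℕ) : Prop :=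
  (∀ q j, Cand r w q j → pos L q j ≤ l) ∧ (l = 0 ∨ ∃ q j, Cand r w q j ∧ pos L q j = l)

/-- Raise `w` at the position with number `l` and clear it after that. -/
def next (L r : ℕ) (w : ℕ → ℕ → ℕ) (l q j : ℕ) : ℕ :=
  if q < 2 * r ∧ j < r then
    if pos L q j < l then w q j else if pos L q j = l then 1 else 0
  else w q j

variable {L r l : ℕ} {w x : ℕ → ℕ → ℕ}

theorem Valid.eq_zero (hw : Valid r w) {q j : ℕ} (h : ¬ (q < 2 * r ∧ j < r)) : w q j = 0 := by
  by_cases hq : q < 2 * r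
  · by_contra h0
    have := ((hw.1 q hq j).2 h0).1
    omega
  · exact hw.2 q (by omega) j

theorem Valid.le_one (hw : Valid r w) (q j : ℕ) : w q j ≤ 1 := by
  by_cases hq : q < 2 * r
  · exact (hw.1 q hq j).1
  · rw [hw.2 q (by omega) j]; omega

theorem Cand.lt {q j : ℕ} (h : Cand r w q j) : j < r := by
  have := h.1; have := h.2.1.1; omega

theorem next_of_lt {q j : ℕ} (h : pos L q j < l) : next L r w l q j = w q j := by
  unfold next; split_ifs <;> rfl

theorem next_of_lt_position (hL : r ≤ L) {q j q' j' : ℕ} (h : q < q' ∨ q = q' ∧ j < j') : next L r w (pos L q' j') q j = w q j := by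
  by_cases hq : q < 2 * r ∧ j < r
  · exact next_of_lt (pos_lt_pos (by omega) h)
  · rw [next, if_neg hq]

/-- At the first difference from a larger valid word the entry rises from `0` to `1`, and that this
is legal depends on the rows the two words share. -/
theorem cand_of_key_lt (hx : Valid r x) {q j : ℕ} (h : ∀ q' < q, w q' = x q')
    (h' : w q j < x q j) : Cand r w q j := by
  have h1 := hx.le_one q j
  have h2 : x q j ≠ 0 := by omega
  have hq : q < 2 * r := by
    by_contra hq
    exact h2 (hx.2 q (by omega) j)
  exact ⟨hq, (allowed_congr h j).2 ((hx.1 q hq j).2 h2), by omega⟩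

theorem IsLast.eq_of_le (hl : IsLast L r w 0) (hx : Valid r x)
    (h : key w ≤ key x) : x = w := by
  rcases h.lt_or_eq with h | h
  · obtain ⟨q, j, h1, -, h3⟩ := key_lt_key.1 h
    have := hl.1 q j (cand_of_key_lt hx h1 h3)
    simp [pos] at this
  · exact (key_injective h).symm

/-- The rows that decide about the raised entry are untouched, and zeros are always legal, so
clearing the rest does no harm. -/
theorem IsLast.valid_next (hl : IsLast L r w l) (hL : r ≤ L) (hw : Valid r w) (hl0 : l ≠ 0) :
    Valid r (next L r w l) := by
  obtain ⟨q₀, j₀, hc, rfl⟩ := hl.2.resolve_left hl0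
  have hj₀ := hc.lt
  refine ⟨fun q hq j => ?_, fun q hq j => ?_⟩
  · by_cases hj : j < r
    · rcases pos_trichotomy (L := L) (q := q) (j := j) (q' := q₀) (j' := j₀) (by omega) (by omega)
        with ⟨-, h⟩ | ⟨-, rfl, rfl⟩ | ⟨h, -⟩
      · rw [next_of_lt_position hL h, allowed_congr (w' := w) fun q' hq' => by
          funext j'; exact next_of_lt_position hL (Or.inl (by omega))]
        exact hw.1 q hq j
      · refine ⟨by simp [next, hq, hj], fun _ => ?_⟩
        rw [allowed_congr (w' := w) fun q' hq' => by
          funext j'; exact next_of_lt_position hL (Or.inl (by omega))]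
        exact hc.2.1
      · have : next L r w (pos L q₀ j₀) q j = 0 := by
          simp [next, hq, hj, h.not_gt, h.ne']
        rw [this]
        exact ⟨by omega, fun h => absurd rfl h⟩
    · rw [next, if_neg (by tauto), hw.eq_zero (by tauto)]
      exact ⟨by omega, fun h => absurd rfl h⟩
  · rw [next, if_neg (by omega), hw.2 q hq j]

theorem IsLast.key_lt_next (hl : IsLast L r w l) (hL : r ≤ L) (hl0 : l ≠ 0) :
    key w < key (next L r w l) := by
  obtain ⟨q₀, j₀, hc, rfl⟩ := hl.2.resolve_left hl0
  have hj₀ := hc.lt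
  refine key_lt_key.2 ⟨q₀, j₀, fun q' hq' => ?_, fun j' hj' => ?_, ?_⟩
  · funext j'
    exact (next_of_lt_position hL (Or.inl hq')).symm
  · exact (next_of_lt_position hL (Or.inr ⟨rfl, hj'⟩)).symm
  · rw [hc.2.2]; simp [next, hc.1, hj₀]

theorem IsLast.next_le (hl : IsLast L r w l) (hL : r ≤ L) (hw : Valid r w) (hl0 : l ≠ 0)
    (hx : Valid r x) (h : key w < key x) : key (next L r w l) ≤ key x := by
  obtain ⟨q, j, h1, h2, h3⟩ := key_lt_key.1 h
  have hcand := cand_of_key_lt hx h1 h3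
  have hle := hl.1 q j hcand
  obtain ⟨q₀, j₀, hc, rfl⟩ := hl.2.resolve_left hl0
  have hj₀ := hc.lt
  have hj := hcand.lt
  -- A first difference of `w` and `x` before the raised position makes `x` larger than the
  -- successor as well. At that position the successor is the least word with the given prefix.
  -- After it there is no candidate.
  rcases pos_trichotomy (L := L) (q := q) (j := j) (q' := q₀) (j' := j₀) (by omega) (by omega)
    with ⟨-, h⟩ | ⟨-, rfl, rfl⟩ | ⟨h, -⟩
  · refine (key_lt_key.2 ⟨q, j, fun q' hq' => ?_, fun j' hj' => ?_, ?_⟩).le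
    · rw [← h1 q' hq']
      funext j'
      exact next_of_lt_position hL (by omega)
    · rw [← h2 j' hj']
      exact next_of_lt_position hL (by omega)
    · rwa [next_of_lt_position hL h]
  · refine not_lt.1 fun hlt => ?_
    obtain ⟨q', j', h4, h5, h6⟩ := key_lt_key.1 hlt
    by_cases hr : q' < 2 * r ∧ j' < r
    · rcases pos_trichotomy (L := L) (q := q') (j := j') (q' := q) (j' := j) (by omega) (by omega)
        with ⟨-, h⟩ | ⟨-, rfl, rfl⟩ | ⟨h, -⟩
      · rw [next_of_lt_position hL h] at h6
        rcases h with h | ⟨rfl, h⟩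
        · rw [h1 q' h] at h6; omega
        · rw [h2 j' h] at h6; omega
      · have := hcand.2.2
        simp only [next, if_pos hr, lt_irrefl, if_false, if_true] at h6
        omega
      · simp only [next, if_pos hr, if_neg h.not_gt, if_neg h.ne'] at h6
        omega
    · rw [next, if_neg hr, hw.eq_zero hr] at h6
      omega
  · omega

theorem finite_valid (r : ℕ) : {w | Valid r w}.Finite := by
  let f : (ℕ → ℕ → ℕ) → (Fin (2 * r) × Fin r → Fin 2) := fun w a =>
    Fin.ofNat 2 (w a.1 a.2)
  refine Set.Finite.of_injOn (f := f) (t := Set.univ) (fun _ _ => trivial) ?_ Set.finite_univ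
  intro w hw x hx h
  funext q j
  by_cases hr : q < 2 * r ∧ j < r
  · have h1 := congrArg Fin.val (congrFun h (⟨q, hr.1⟩, ⟨j, hr.2⟩))
    have h2 := hw.le_one q j
    have h3 := hx.le_one q j
    simp only [f, Fin.ofNat] at h1
    omega
  · rw [Valid.eq_zero hw hr, Valid.eq_zero hx hr]

/-- Induction along the lexicographic order, from the last word backwards. -/
theorem Valid.induction_gt {r : ℕ} {P : ∀ w : ℕ → ℕ → ℕ, Valid r w → Prop}
    (h : ∀ w hw, (∀ x hx, key w < key x → P x hx) → P w hw) (w : ℕ → ℕ → ℕ)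
    (hw : Valid r w) : P w hw := by
  have hfin : ∀ w, {x | Valid r x ∧ key w < key x}.Finite := fun w =>
    (finite_valid r).subset fun x hx => hx.1
  suffices H : ∀ d w hw, {x | Valid r x ∧ key w < key x}.ncard = d → P w hw from
    H _ w hw rfl
  intro d
  induction d using Nat.strong_induction_on with
  | _ d ih =>
    intro w hw hd
    refine h w hw fun x hx hwx => ih _ ?_ x hx rfl
    rw [← hd]
    refine Set.ncard_lt_ncard ?_ (hfin w)
    refine ⟨fun y hy => ⟨hy.1, hwx.trans hy.2⟩, fun hsub => ?_⟩
    exact lt_irrefl _ (hsub (⟨hx, hwx⟩ : x ∈ {y | Valid r y ∧ key w < key y})).2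

end BasisWords

/-! ## The enumeration program -/

namespace BasisWords

open WordRAM Finset
open scoped Classical

def xorE (a b : Ex) : Ex := .bin .sub (.lit 1) (.bin .eq a b)

def twice (a : Ex) : Ex := .bin .mul (.lit 2) a

def succE (a : Ex) : Ex := .bin .add a (.lit 1)

/-- The number of the position in row `q` and column `j`. -/
def posE (q j : Ex) : Ex := succE (.bin .add (.bin .mul q (.reg 2)) j)

/-- The number of the last position in which the word can be raised. -/
def lastE : Ex := .ld 5 (.lit 0) (.lit 0)

/-- Add row `reg b` of table `t'` to row `reg a` of table `t`, with loop register `k`. -/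
def addRow (k t a t' b : ℕ) : Prog :=
  forr k 1 (st t (.reg a) (.reg k) (xorE (.ld t (.reg a) (.reg k)) (.ld t' (.reg b) (.reg k))))

def copyRow (k t a t' b : ℕ) : Prog :=
  forr k 1 (st t (.reg a) (.reg k) (.ld t' (.reg b) (.reg k)))

def setLast (q j : Ex) : Prog := st 5 (.lit 0) (.lit 0) (posE q j)

/-- Table `1` holds the given basis, table `2` the basis under construction, table `3` the word, row
`0` of table `4` the leading coordinates, and cell `(0, 0)` of table `5` the last raisable position;
register `4` is the level. In an even row every zero left of the diagonal can be raised. -/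
def pivStep : Prog :=
  .ite (Ex.ld 3 (twice (.reg 4)) (.reg 5)).toExpr (addRow 6 2 4 1 5)
    (setLast (twice (.reg 4)) (.reg 5))

/-- A zero of an odd row can be raised only if the even row before it vanishes at the leading
coordinate of the older vector, which is looked up in table `4`. -/
def addStep : Prog :=
  .ite (Ex.ld 3 (succE (twice (.reg 4))) (.reg 5)).toExpr
    (.seq (addRow 6 2 5 2 4) (st 4 (.lit 0) (.reg 5) (.reg 4)))
    (.ite (Ex.ld 3 (twice (.reg 4)) (.ld 4 (.lit 0) (.reg 5))).toExpr .nop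
      (setLast (succE (twice (.reg 4))) (.reg 5)))

def level : Prog :=
  .seq (copyRow 5 2 4 1 4) (.seq (forr 5 4 pivStep)
    (.seq (st 4 (.lit 0) (.reg 4) (.reg 4)) (forr 5 4 addStep)))

/-- Compute the basis encoded by the word and the last position that can be raised. -/
def decodeProg : Prog := .seq (st 5 (.lit 0) (.lit 0) (.lit 0)) (forr 4 3 level)

def outputProg : Prog := forr 4 3 (forr 5 1 (.emit (Ex.ld 2 (.reg 4) (.reg 5)).toExpr))

/-- Branch-free: the old entry survives before the last position, `1` is written at it, and `0`
after it. -/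
def advanceProg : Prog :=
  letIn 4 (twice (.reg 3)) (forr 5 4 (forr 6 3 (st 3 (.reg 5) (.reg 6)
    (.bin .add (.bin .mul (.bin .lt (posE (.reg 5) (.reg 6)) lastE) (.ld 3 (.reg 5) (.reg 6)))
      (.bin .eq (posE (.reg 5) (.reg 6)) lastE)))))

def enumLoop : Prog :=
  .loop lastE.toExpr (.seq decodeProg (.seq outputProg (.seq .endSol advanceProg)))

/-- The cell for the last position also serves as loop condition. Its initial value `1` only forces
the first round, which outputs the basis of the zero word. -/
def enumProg : Prog := .seq (st 5 (.lit 0) (.lit 0) (.lit 1)) enumLoop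

/-! ### Rows of cells as vectors, and the row operations -/

/-- A row of cells as a vector. -/
def vec (m : ℕ) (a : ℕ → ℕ) : Fin m → ZMod 2 := fun k => (a k : ZMod 2)

def Bits (m : ℕ) (a : ℕ → ℕ) : Prop := ∀ k < m, a k ≤ 1

def xor (a b : ℕ) : ℕ := 1 - if a = b then 1 else 0

theorem xor_le (a b : ℕ) : xor a b ≤ 1 := Nat.sub_le _ _

theorem cast_xor {a b : ℕ} (ha : a ≤ 1) (hb : b ≤ 1) :
    ((xor a b : ℕ) : ZMod 2) = (a : ZMod 2) + (b : ZMod 2) := by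
  interval_cases a <;> interval_cases b <;> decide

theorem vec_xor {m : ℕ} {a b : ℕ → ℕ} (ha : Bits m a) (hb : Bits m b) :
    vec m (fun k => xor (a k) (b k)) = vec m a + vec m b := by
  funext k
  exact cast_xor (ha k k.2) (hb k k.2)

theorem val_vec {m : ℕ} {a : ℕ → ℕ} (ha : Bits m a) (k : Fin m) : (vec m a k).val = a k := by
  have h := ha k k.2
  simp only [vec, ZMod.val_natCast]
  omega

variable {W L n m r : ℕ} {A : Arr} {Q : Arr → Prop}

/-- Numerical conditions under which the programs fit the machine. -/
structure Fits (W L m r : ℕ) : Prop where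
  hW : 9 * L * L ≤ W
  hL : 6 ≤ L
  hm : m < L
  hr : 2 * r < L

theorem Fits.lt (h : Fits W L m r) : L < W := by have := h.hW; have := h.hL; nlinarith

theorem Fits.pos_lt (h : Fits W L m r) {q j : ℕ} (hq : q < L) (hj : j < L) : pos L q j < W := by
  have := h.hW; have := h.hL
  unfold pos
  nlinarith

theorem addRow_spec (hF : Fits W L m r) {env : List ℕ} {k t a t' b i i' : ℕ}
    (hk : k = env.length) (h1 : env[1]? = some m) (h2 : env[2]? = some L) (ha : env[a]? = some i)
    (hb : env[b]? = some i') (hi : i < L) (hi' : i' < L) (ht : t < 9) (htt : ¬ (t' = t ∧ i' = i))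
    (hQ : Q (setRow A t i m fun j => xor (A t i j) (A t' i' j))) :
    Does W L (addRow k t a t' b) (50 * (m + 1)) env A Q := by
  have hget : ∀ {c v : ℕ}, env[c]? = some v → ∀ x, c < (env ++ [x]).length ∧
      (env ++ [x]).getD c 0 = v := by
    intro c v hc x
    have hlt := (List.getElem?_eq_some_iff.1 hc).1
    exact ⟨by simp; omega, by rw [List.getD_append _ _ _ _ hlt]; simp [List.getD, hc]⟩
  have hk' : ∀ x, k < (env ++ [x]).length ∧ (env ++ [x]).getD k 0 = x := by
    intro x; subst hk; exact ⟨by simp, by simp [List.getD]⟩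
  have h2' : ∀ x, (env ++ [x])[2]? = some L := fun x => by
    rw [List.getElem?_append_left (List.getElem?_eq_some_iff.1 h2).1, h2]
  have hW := hF.lt
  have := hF.hL
  have hm := hF.hm
  refine Does.fillRow (c := 33) _ hk h1 hF.hm.le h2 ht hi hF.hW
    (fun x A => ⟨(hget ha x).1, (hget ha x).2⟩) (fun x hx A' hA' => ?_) (by
      simp [cellExpr, Ex.toExpr, Expr.cost, xorE]) (by omega) hQ
  have e1 : A' t i x = A t i x := hA' _ _ _ (by omega)
  have e2 : A' t' i' x = A t' i' x := hA' _ _ _ (by tauto)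
  have hx' : x < L := by omega
  refine ⟨?_, ?_, ?_⟩
  · simp only [xorE, Ex.Ok, Ex.ev, h2', (hget ha x).1, (hget hb x).1, (hk' x).1, (hget ha x).2,
      (hget hb x).2, (hk' x).2, hi, hi', hx', and_self]
  · simp only [xorE, Ex.ev, (hget ha x).2, (hget hb x).2, (hk' x).2, e1, e2, Op.eval, xor]
  · have := xor_le (A t i x) (A t' i' x); omega

theorem copyRow_spec (hF : Fits W L m r) {env : List ℕ} {k t a t' b i i' : ℕ}
    (hk : k = env.length) (h1 : env[1]? = some m) (h2 : env[2]? = some L) (ha : env[a]? = some i)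
    (hb : env[b]? = some i') (hi : i < L) (hi' : i' < L) (ht : t < 9) (htt : ¬ (t' = t ∧ i' = i))
    (hA : Bits m (A t' i')) (hQ : Q (setRow A t i m (A t' i'))) :
    Does W L (copyRow k t a t' b) (50 * (m + 1)) env A Q := by
  have hget : ∀ {c v : ℕ}, env[c]? = some v → ∀ x, c < (env ++ [x]).length ∧
      (env ++ [x]).getD c 0 = v := by
    intro c v hc x
    have hlt := (List.getElem?_eq_some_iff.1 hc).1
    exact ⟨by simp; omega, by rw [List.getD_append _ _ _ _ hlt]; simp [List.getD, hc]⟩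
  have hk' : ∀ x, k < (env ++ [x]).length ∧ (env ++ [x]).getD k 0 = x := by
    intro x; subst hk; exact ⟨by simp, by simp [List.getD]⟩
  have h2' : ∀ x, (env ++ [x])[2]? = some L := fun x => by
    rw [List.getElem?_append_left (List.getElem?_eq_some_iff.1 h2).1, h2]
  have hW := hF.lt
  have := hF.hL
  have hm := hF.hm
  refine Does.fillRow (c := 33) _ hk h1 hF.hm.le h2 ht hi hF.hW
    (fun x A => ⟨(hget ha x).1, (hget ha x).2⟩) (fun x hx A' hA' => ?_) (by
      simp [cellExpr, Ex.toExpr, Expr.cost]) (by omega) hQ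
  have e2 : A' t' i' x = A t' i' x := hA' _ _ _ (by tauto)
  have hx' : x < L := by omega
  refine ⟨?_, ?_, ?_⟩
  · simp only [Ex.Ok, Ex.ev, h2', (hget hb x).1, (hk' x).1,
      (hget hb x).2, (hk' x).2, hi', hx', and_self]
  · simp only [Ex.ev, (hget hb x).2, (hk' x).2, e2]
  · have := hA x hx; omega

/-! ### Correctness of decoding -/

/-- The part of `IsLast` that is known when the positions before `(q, j)` have been seen. -/
def LastBefore (L r : ℕ) (w : ℕ → ℕ → ℕ) (q j l : ℕ) : Prop :=
  (∀ q' j', Cand r w q' j' → q' < q ∨ q' = q ∧ j' < j → pos L q' j' ≤ l) ∧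
    (l = 0 ∨ ∃ q' j', Cand r w q' j' ∧ pos L q' j' = l)

variable {w : ℕ → ℕ → ℕ} {q j l : ℕ}

theorem LastBefore.skip (h : LastBefore L r w q j l) (hc : ¬ Cand r w q j) :
    LastBefore L r w q (j + 1) l := by
  refine ⟨fun q' j' hc' h' => h.1 q' j' hc' ?_, h.2⟩
  rcases h' with h' | ⟨rfl, h'⟩
  · exact Or.inl h'
  · refine Or.inr ⟨rfl, lt_of_le_of_ne (by omega) ?_⟩
    rintro rfl
    exact hc hc'

theorem LastBefore.take (hL : r ≤ L) (hc : Cand r w q j) :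
    LastBefore L r w q (j + 1) (pos L q j) := by
  refine ⟨fun q' j' hc' h' => ?_, Or.inr ⟨q, j, hc, rfl⟩⟩
  have := hc'.lt
  by_cases h : q' = q ∧ j' = j
  · rw [h.1, h.2]
  · exact (pos_lt_pos (by omega) (by omega)).le

/-- Row `q` has no legal position from column `q / 2` on. -/
theorem LastBefore.nextRow (h : LastBefore L r w q (q / 2) l) : LastBefore L r w (q + 1) 0 l := by
  refine ⟨fun q' j' hc' h' => h.1 q' j' hc' ?_, h.2⟩
  by_cases hq : q' = q
  · subst hq; exact Or.inr ⟨rfl, hc'.2.1.1⟩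
  · exact Or.inl (by omega)

theorem LastBefore.isLast (h : LastBefore L r w (2 * r) 0 l) : IsLast L r w l :=
  ⟨fun q' j' hc' => h.1 q' j' hc' (Or.inl hc'.1), h.2⟩

variable {a : ℕ → ℕ → ℕ}

/-- The state before level `i`. -/
structure LevelInv (L m r : ℕ) (a w : ℕ → ℕ → ℕ) (i : ℕ) (A : Arr) : Prop where
  rows : A 1 = a
  word : A 3 = w
  basis : ∀ j < i, Bits m (A 2 j) ∧ vec m (A 2 j) = fam (fun i => vec m (a i)) w i j
  lead : ∀ j < i, A 4 0 j = lead w i j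
  last : LastBefore L r w (2 * i) 0 (A 5 0 0)

theorem setLast_spec (hF : Fits W L m r) {env : List ℕ} {eq ej : Ex} {q j T : ℕ}
    (h2 : env[2]? = some L)
    (hq : eq.Ok L env A ∧ eq.ev env A = q) (hj : ej.Ok L env A ∧ ej.ev env A = j) (hqL : q < L)
    (hjL : j < L) (hT : eq.toExpr.cost + ej.toExpr.cost + 20 ≤ T) (hQ : Q (upd A 5 0 0 (pos L q j))) :
    Does W L (setLast eq ej) T env A Q := by
  have hL := hF.hL
  have h2' := List.getElem?_eq_some_iff.1 h2
  have h3 : env.getD 2 0 = L := by simp [List.getD, h2]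
  have hev : (posE eq ej).ev env A = pos L q j := by
    simp only [posE, succE, Ex.ev, Op.eval, hq.2, hj.2, h3, pos]
  refine Does.st h2 (by omega) hF.hW trivial trivial ⟨⟨⟨hq.1, h2'.1⟩, hj.1⟩, trivial⟩
    (by simp only [Ex.ev]; omega) (by simp only [Ex.ev]; omega) ?_ ?_ ?_
  · rw [hev]; exact hF.pos_lt hqL hjL
  · simp only [cellExpr, posE, succE, Ex.toExpr, Expr.cost]; omega
  · rw [hev]; exact hQ

/-- Absorbs the overhead of a loop into a product; the shifts `r + 1` and `K + 1` keep the bound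
valid for empty loops. -/
theorem loop_cost {i r c K D : ℕ} (hi : i ≤ r) (hc : c + 8 ≤ D * (K + 1)) :
    i * (c + 8) + 6 ≤ D * ((r + 1) * (K + 1)) := by
  have h1 : i * (c + 8) ≤ r * (D * (K + 1)) := Nat.mul_le_mul hi hc
  have h2 : D * ((r + 1) * (K + 1)) = r * (D * (K + 1)) + D * (K + 1) := by ring
  have h3 : D * 1 ≤ D * (K + 1) := Nat.mul_le_mul_left _ (by omega)
  omega

theorem le_cost {r K D : ℕ} : D * (K + 1) ≤ D * ((r + 1) * (K + 1)) :=
  Nat.mul_le_mul_left _ (Nat.le_mul_of_pos_left _ (by omega))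

/-- The state inside level `i`, when the first `j` summands of the new vector have been added. -/
structure PivInv (L m r : ℕ) (a w : ℕ → ℕ → ℕ) (i j : ℕ) (A : Arr) : Prop where
  rows : A 1 = a
  word : A 3 = w
  basis : ∀ j < i, Bits m (A 2 j) ∧ vec m (A 2 j) = fam (fun i => vec m (a i)) w i j
  new : Bits m (A 2 i) ∧ vec m (A 2 i) =
    vec m (a i) + ∑ j' ∈ range j, if w (2 * i) j' ≠ 0 then vec m (a j') else 0
  lead : ∀ j < i, A 4 0 j = lead w i j
  last : LastBefore L r w (2 * i) j (A 5 0 0)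

/-- The state inside level `i`, when the new vector has been added to the first `j` vectors. -/
structure AddInv (L m r : ℕ) (a w : ℕ → ℕ → ℕ) (i j : ℕ) (A : Arr) : Prop where
  rows : A 1 = a
  word : A 3 = w
  old : ∀ j' < i, j ≤ j' → Bits m (A 2 j') ∧ vec m (A 2 j') = fam (fun i => vec m (a i)) w i j'
  new : ∀ j' ≤ i, j' < j ∨ j' = i → Bits m (A 2 j') ∧
    vec m (A 2 j') = fam (fun i => vec m (a i)) w (i + 1) j'
  leadOld : ∀ j' < i, j ≤ j' → A 4 0 j' = BasisWords.lead w i j'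
  leadNew : ∀ j' ≤ i, j' < j ∨ j' = i → A 4 0 j' = BasisWords.lead w (i + 1) j'
  last : LastBefore L r w (2 * i + 1) j (A 5 0 0)

theorem bits_setRow_xor {t i t' i' : ℕ} (hA : Bits m (A t i)) (hA' : Bits m (A t' i')) :
    Bits m (setRow A t i m (fun j => xor (A t i j) (A t' i' j)) t i) ∧
    vec m (setRow A t i m (fun j => xor (A t i j) (A t' i' j)) t i) =
      vec m (A t i) + vec m (A t' i') := by
  have h : ∀ k < m, setRow A t i m (fun j => xor (A t i j) (A t' i' j)) t i k =
      xor (A t i k) (A t' i' k) := fun k hk => by simp [setRow, hk]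
  refine ⟨fun k hk => by rw [h k hk]; exact xor_le _ _, ?_⟩
  rw [← vec_xor hA hA']
  funext k
  simp only [vec, h k k.2]

theorem setRow_of_ne {t i N : ℕ} {f : ℕ → ℕ} {t' i' : ℕ} (h : ¬ (t' = t ∧ i' = i)) :
    setRow A t i N f t' i' = A t' i' := by
  funext j
  rw [setRow, if_neg fun h' => h ⟨h'.1, h'.2.1⟩]

theorem setRow_table {t i N : ℕ} {f : ℕ → ℕ} {t' : ℕ} (h : t' ≠ t) :
    setRow A t i N f t' = A t' := funext fun _ => setRow_of_ne fun h' => h h'.1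

theorem upd_of_ne {t i j v t' i' : ℕ} (h : ¬ (t' = t ∧ i' = i)) :
    upd A t i j v t' i' = A t' i' := by
  funext j'
  rw [upd, if_neg fun h' => h ⟨h'.1, h'.2.1⟩]

theorem upd_table {t i j v t' : ℕ} (h : t' ≠ t) : upd A t i j v t' = A t' :=
  funext fun _ => upd_of_ne fun h' => h h'.1

theorem upd_self {t i j v : ℕ} : upd A t i j v t i j = v := by simp [upd]

theorem pivStep_spec (hF : Fits W L m r) (ha : ∀ i < r, Bits m (a i)) {i j : ℕ}
    (hi : i < r) (hj : j < i) (hA : PivInv L m r a w i j A) :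
    Does W L pivStep (100 * (m + 1)) [n, m, L, r, i, j] A (PivInv L m r a w i (j + 1)) := by
  have hL := hF.hL
  have hr := hF.hr
  have hm := hF.hm
  refine Does.ite (T₁ := 50 * (m + 1)) ?_ (fun hc => ?_) (fun hc => ?_) (by
    simp [Ex.toExpr, Expr.cost, cellExpr, twice]; omega)
  · simp [twice, Op.eval]; omega
  · have hc' : w (2 * i) j ≠ 0 := by simpa [twice, Op.eval, hA.word] using hc
    refine addRow_spec hF rfl rfl rfl (i := i) (i' := j) rfl rfl (by omega) (by omega) (by omega)
      (by omega) ?_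
    have h1 := bits_setRow_xor hA.new.1 (A := A) (t' := 1) (i' := j)
      (by rw [hA.rows]; exact ha j (by omega))
    refine ⟨by rw [setRow_table (by omega), hA.rows], by rw [setRow_table (by omega), hA.word],
      fun j' hj' => ?_, ⟨h1.1, ?_⟩, ?_, ?_⟩
    · rw [setRow_of_ne (by omega)]; exact hA.basis j' hj'
    · rw [h1.2, hA.new.2, hA.rows, sum_range_succ, if_pos hc', add_assoc]
    · rw [setRow_table (by omega)]; exact hA.lead
    · rw [setRow_table (by omega)]
      exact hA.last.skip fun h => hc' h.2.2
  · have hc' : w (2 * i) j = 0 := by simpa [twice, Op.eval, hA.word] using hc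
    refine setLast_spec hF (q := 2 * i) (j := j) rfl (by simp [twice, Op.eval]) (by simp)
      (by omega) (by omega) (by simp [Ex.toExpr, Expr.cost, twice]; omega) ?_
    refine ⟨by rw [upd_table (by omega), hA.rows], by rw [upd_table (by omega), hA.word],
      ?_, ?_, ?_, ?_⟩
    · rw [upd_table (by omega)]; exact hA.basis
    · rw [upd_table (by omega), sum_range_succ, if_neg (not_not.2 hc'), add_zero]; exact hA.new
    · rw [upd_table (by omega)]; exact hA.lead
    · rw [upd_self]
      exact LastBefore.take (by omega) ⟨by omega, ⟨by omega, fun h => by omega⟩, hc'⟩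

theorem fam_succ_of_lt {V : Type*} [AddCommGroup V] (e : ℕ → V) (w : ℕ → ℕ → ℕ) {i j : ℕ}
    (hj : j < i) : fam e w (i + 1) j =
      if w (2 * i + 1) j ≠ 0 then fam e w i j + piv e w i else fam e w i j := by
  simp only [fam]
  rw [if_neg hj.ne]
  simp only [hj, true_and]

theorem lead_succ_of_lt (w : ℕ → ℕ → ℕ) {i j : ℕ} (hj : j < i) :
    lead w (i + 1) j = if w (2 * i + 1) j ≠ 0 then i else lead w i j := by
  simp only [lead, hj.ne, hj, true_and, false_or]

theorem AddInv.keep {i : ℕ} {A' : Arr} (hA : AddInv L m r a w i j A) (hj : j < i)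
    (h0 : w (2 * i + 1) j = 0) (h1 : A' 1 = A 1) (h2 : A' 2 = A 2) (h3 : A' 3 = A 3)
    (h4 : A' 4 = A 4) (h5 : LastBefore L r w (2 * i + 1) (j + 1) (A' 5 0 0)) :
    AddInv L m r a w i (j + 1) A' := by
  refine ⟨h1.trans hA.rows, h3.trans hA.word, fun j' h h' => ?_, fun j' h h' => ?_,
    fun j' h h' => ?_, fun j' h h' => ?_, h5⟩
  · rw [h2]; exact hA.old j' h (by omega)
  · rw [h2]
    by_cases hjj : j' = j
    · subst hjj
      rw [fam_succ_of_lt _ _ hj, if_neg (not_not.2 h0)]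
      exact hA.old j' hj le_rfl
    · exact hA.new j' h (by omega)
  · rw [h4]; exact hA.leadOld j' h (by omega)
  · rw [h4]
    by_cases hjj : j' = j
    · subst hjj
      rw [lead_succ_of_lt _ hj, if_neg (not_not.2 h0)]
      exact hA.leadOld j' hj le_rfl
    · exact hA.leadNew j' h (by omega)

theorem addStep_spec (hF : Fits W L m r) {i j : ℕ}
    (hi : i < r) (hj : j < i) (hA : AddInv L m r a w i j A) :
    Does W L addStep (150 * (m + 1)) [n, m, L, r, i, j] A (AddInv L m r a w i (j + 1)) := by
  have hL := hF.hL
  have hr := hF.hr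
  have hm := hF.hm
  have hLW := hF.lt
  have hlead : lead w i j < i := lead_lt hj
  have hpiv : Bits m (A 2 i) ∧ vec m (A 2 i) = piv (fun i => vec m (a i)) w i := by
    have := hA.new i le_rfl (Or.inr rfl)
    simpa [fam] using this
  have hcand : Cand r w (2 * i + 1) j ↔ w (2 * i) (lead w i j) = 0 ∧ w (2 * i + 1) j = 0 := by
    have h1 : (2 * i + 1) / 2 = i := by omega
    have h2 : (2 * i + 1) % 2 = 1 := by omega
    simp only [Cand, Allowed, h1, h2, Nat.add_sub_cancel, forall_const, hj, true_and,
      show 2 * i + 1 < 2 * r by omega]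
  refine Does.ite (T₁ := 130 * (m + 1)) ?_ (fun hc => ?_) (fun hc => ?_) (by
    simp [Ex.toExpr, Expr.cost, cellExpr, twice, succE]; omega)
  · simp [twice, succE, Op.eval]; omega
  · have hc' : w (2 * i + 1) j ≠ 0 := by simpa [twice, succE, Op.eval, hA.word] using hc
    refine Does.seq (T₁ := 50 * (m + 1)) (T₂ := 30) ?_ (by omega)
    refine addRow_spec hF rfl rfl rfl (i := j) (i' := i) rfl rfl (by omega) (by omega) (by omega)
      (by omega) ?_
    refine Does.st rfl (by omega) hF.hW trivial (by simp) (by simp) (by simp; omega)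
      (by simp; omega) (by simp; omega) (by simp [Ex.toExpr, Expr.cost, cellExpr]) ?_
    have hold := hA.old j hj le_rfl
    have h1 := bits_setRow_xor (A := A) hold.1 hpiv.1
    simp only [Ex.ev, List.getD_cons_succ, List.getD_cons_zero]
    refine ⟨by rw [upd_table (by omega), setRow_table (by omega), hA.rows],
      by rw [upd_table (by omega), setRow_table (by omega), hA.word],
      fun j' h h' => ?_, fun j' h h' => ?_, fun j' h h' => ?_, fun j' h h' => ?_, ?_⟩
    · rw [upd_table (by omega), setRow_of_ne (by omega)]; exact hA.old j' h (by omega)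
    · rw [upd_table (by omega)]
      by_cases hjj : j' = j
      · subst hjj
        refine ⟨h1.1, ?_⟩
        rw [h1.2, hold.2, hpiv.2, fam_succ_of_lt _ _ hj, if_pos hc']
      · rw [setRow_of_ne (by omega)]; exact hA.new j' h (by omega)
    · rw [upd, if_neg (by omega), setRow_table (by omega)]; exact hA.leadOld j' h (by omega)
    · by_cases hjj : j' = j
      · subst hjj
        rw [upd_self, lead_succ_of_lt _ hj, if_pos hc']
      · rw [upd, if_neg (by omega), setRow_table (by omega)]; exact hA.leadNew j' h (by omega)
    · rw [upd_table (by omega), setRow_table (by omega)]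
      exact hA.last.skip fun h => hc' h.2.2
  · have hc' : w (2 * i + 1) j = 0 := by simpa [twice, succE, Op.eval, hA.word] using hc
    have h4 := hA.leadOld j hj le_rfl
    refine Does.ite (T₁ := 60) ?_ (fun hd => ?_) (fun hd => ?_) (by
      simp [Ex.toExpr, Expr.cost, cellExpr, twice]; omega)
    · simp [twice, Op.eval, h4]; omega
    · have hd' : w (2 * i) (lead w i j) ≠ 0 := by
        simpa [twice, Op.eval, hA.word, h4] using hd
      refine Does.nop (by omega) ?_
      exact hA.keep hj hc' rfl rfl rfl rfl (hA.last.skip fun h => hd' (hcand.1 h).1)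
    · have hd' : w (2 * i) (lead w i j) = 0 := by
        simpa [twice, Op.eval, hA.word, h4] using hd
      refine setLast_spec hF (q := 2 * i + 1) (j := j) rfl (by simp [twice, succE, Op.eval])
        (by simp) (by omega) (by omega) (by simp [Ex.toExpr, Expr.cost, twice, succE]) ?_
      refine hA.keep hj hc' (upd_table (by omega)) (upd_table (by omega)) (upd_table (by omega))
        (upd_table (by omega)) ?_
      rw [upd_self]
      exact LastBefore.take (by omega) (hcand.2 ⟨hd', hc'⟩)

theorem level_spec (hF : Fits W L m r) (ha : ∀ i < r, Bits m (a i)) {i : ℕ}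
    (hi : i < r) (hA : LevelInv L m r a w i A) :
    Does W L level (500 * ((r + 1) * (m + 1))) [n, m, L, r, i] A (LevelInv L m r a w (i + 1)) := by
  have hL := hF.hL
  have hr := hF.hr
  have hm := hF.hm
  have hLW := hF.lt
  have hle := le_cost (r := r) (K := m) (D := 50)
  refine Does.seq (T₁ := 50 * (m + 1)) (T₂ := 450 * ((r + 1) * (m + 1))) ?_ (by omega)
  refine copyRow_spec hF rfl rfl rfl (i := i) (i' := i) rfl rfl (by omega)
    (by omega) (by omega) (by omega) (by rw [hA.rows]; exact ha i hi) ?_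
  refine Does.seq (T₁ := 110 * ((r + 1) * (m + 1))) (T₂ := 250 * ((r + 1) * (m + 1))) ?_ (by omega)
  refine Does.forr (PivInv L m r a w i) rfl rfl (by omega) ?_
    (fun j hj A' hA' => pivStep_spec hF ha hi hj hA') (loop_cost hi.le (by omega))
    fun A₁ h₁ => ?_
  · have h1 : ∀ k < m, setRow A 2 i m (A 1 i) 2 i k = a i k := fun k hk => by
      simp [setRow, hk, hA.rows]
    refine ⟨by rw [setRow_table (by omega), hA.rows], by rw [setRow_table (by omega), hA.word],
      fun j' hj' => ?_, ⟨fun k hk => by rw [h1 k hk]; exact ha i hi k hk, ?_⟩, ?_, ?_⟩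
    · rw [setRow_of_ne (by omega)]; exact hA.basis j' hj'
    · rw [range_zero, sum_empty, add_zero]
      funext k
      simp only [vec, h1 k k.2]
    · rw [setRow_table (by omega)]; exact hA.lead
    · rw [setRow_table (by omega)]; exact hA.last
  refine Does.seq (T₁ := 30) (T₂ := 160 * ((r + 1) * (m + 1))) ?_ (by omega)
  refine Does.st rfl (by omega) hF.hW trivial (by simp) (by simp) (by simp; omega)
      (by simp; omega) (by simp; omega) (by simp [Ex.toExpr, Expr.cost, cellExpr]) ?_
  simp only [Ex.ev, List.getD_cons_succ, List.getD_cons_zero]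
  refine Does.forr (AddInv L m r a w i) rfl rfl (by omega) ?_
    (fun j hj A' hA' => addStep_spec hF hi hj hA') (loop_cost hi.le (by omega))
    fun A₂ h₂ => ?_
  -- The even row is complete after `i = 2 * i / 2` columns, and the scan moves on to the odd row.
  · have hlast : LastBefore L r w (2 * i + 1) 0 (A₁ 5 0 0) := by
      refine LastBefore.nextRow ?_
      rw [show 2 * i / 2 = i by omega]
      exact h₁.last
    refine ⟨by rw [upd_table (by omega), h₁.rows], by rw [upd_table (by omega), h₁.word],
      fun j' h h' => ?_, fun j' h h' => ?_, fun j' h h' => ?_, fun j' h h' => ?_, ?_⟩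
    · rw [upd_table (by omega)]; exact h₁.basis j' h
    · rw [upd_table (by omega)]
      obtain rfl : j' = i := by omega
      refine ⟨h₁.new.1, ?_⟩
      rw [h₁.new.2]
      simp [fam, piv]
    · rw [upd, if_neg (by omega)]; exact h₁.lead j' h
    · obtain rfl : j' = i := by omega
      rw [upd_self]
      simp [BasisWords.lead]
    · rw [upd_table (by omega)]; exact hlast
  · refine ⟨h₂.rows, h₂.word, fun j' h => h₂.new j' (by omega) (by omega),
      fun j' h => h₂.leadNew j' (by omega) (by omega), ?_⟩
    refine LastBefore.nextRow (q := 2 * i + 1) ?_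
    rw [show (2 * i + 1) / 2 = i by omega]
    exact h₂.last

theorem decodeProg_spec (hF : Fits W L m r) (ha : ∀ i < r, Bits m (a i)) (h1 : A 1 = a)
    (h3 : A 3 = w) :
    Does W L decodeProg (600 * ((r + 1) * ((r + 1) * (m + 1)))) [n, m, L, r] A
      (LevelInv L m r a w r) := by
  have hL := hF.hL
  have hr := hF.hr
  have hLW := hF.lt
  have hpos : 0 < (r + 1) * ((r + 1) * (m + 1)) := by positivity
  have hpos' : 0 < (r + 1) * (m + 1) := by positivity
  have hcost : r * (500 * ((r + 1) * (m + 1)) + 8) + 6 ≤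
      550 * ((r + 1) * ((r + 1) * (m + 1))) := by
    obtain ⟨K, hK⟩ : ∃ K, (r + 1) * (m + 1) = K + 1 := ⟨_, (Nat.succ_pred hpos'.ne').symm⟩
    rw [hK]
    exact loop_cost le_rfl (by omega)
  refine Does.seq (T₁ := 30) (T₂ := 550 * ((r + 1) * ((r + 1) * (m + 1)))) ?_ (by omega)
  refine Does.st rfl (by omega) hF.hW trivial trivial trivial (by simp; omega) (by simp; omega)
    (by simp; omega) (by simp [Ex.toExpr, Expr.cost, cellExpr]) ?_
  refine Does.forr (LevelInv L m r a w) rfl rfl (by omega) ?_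
    (fun i hi A' hA' => level_spec hF ha hi hA') hcost fun _ h => h
  refine ⟨by rw [upd_table (by omega), h1], by rw [upd_table (by omega), h3],
    fun _ h => by omega, fun _ h => by omega, ?_⟩
  refine ⟨fun q' j' _ h => by omega, Or.inl ?_⟩
  simp [upd]

end BasisWords

/-! ### Correctness and delay of the enumeration loop -/

namespace BasisWords

open WordRAM Finset
open scoped Classical

variable {W L n m r : ℕ} {A : Arr} {w a : ℕ → ℕ → ℕ} {l : ℕ}

theorem outputProg_spec (hF : Fits W L m r) (hA : ∀ j < r, Bits m (A 2 j)) :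
    Runs W L outputProg (50 * ((r + 1) * (m + 1))) [n, m, L, r] A fun A' l =>
      A' = A ∧ l = (List.range r).flatMap fun j => (List.range m).map (A 2 j) := by
  have hL := hF.hL
  have hr := hF.hr
  have hm := hF.hm
  have hLW := hF.lt
  refine Runs.forr (c := 30 * (m + 1)) (fun i A' l => A' = A ∧
    l = (List.range i).flatMap fun j => (List.range m).map (A 2 j)) rfl rfl (by omega)
    ⟨rfl, rfl⟩ ?_ (loop_cost le_rfl (by omega)) fun _ _ h => h
  rintro i hi B _ ⟨rfl, rfl⟩
  refine Runs.forr (c := 20) (fun k A' l => A' = B ∧ l = (List.range k).map (B 2 i)) rfl rfl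
    (by omega) ⟨rfl, rfl⟩ ?_ (by omega) ?_
  · rintro k hk _ _ ⟨rfl, rfl⟩
    have := hA i hi k hk
    refine Runs.emit (by simp; omega) (by simp; omega) (by simp [Ex.toExpr, Expr.cost, cellExpr])
      ⟨rfl, ?_⟩
    simp [List.range_succ]
  · rintro _ _ ⟨rfl, rfl⟩
    simp [List.range_succ]

theorem advanceProg_spec (hF : Fits W L m r) (h3 : A 3 = w) (hw : ∀ q j, w q j ≤ 1)
    (hl : A 5 0 0 = l) :
    Does W L advanceProg (1000 * ((r + 1) * (r + 1))) [n, m, L, r] A fun A' =>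
      A' 1 = A 1 ∧ A' 3 = next L r w l ∧ A' 5 = A 5 := by
  have hL := hF.hL
  have hr := hF.hr
  have hLW := hF.lt
  have hc : 2 * r * (200 * (r + 1) + 8) + 6 ≤ 900 * ((r + 1) * (r + 1)) := by nlinarith
  refine Does.letIn (T₁ := 900 * ((r + 1) * (r + 1))) rfl (by simp [twice]) ?_ ?_ ?_
  · simp [twice, Op.eval]; omega
  · refine Does.forr (N := 2 * r) (c := 200 * (r + 1))
      (fun q A' => A' = fun t i j => if t = 3 ∧ i < q ∧ j < r then next L r w l i j else A t i j)
      rfl (by simp [twice, Op.eval]) (by omega) (by simp) ?_ hc ?_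
    · rintro q hq _ rfl
      refine Does.fillRow (N := r) (i := q) (c := 150) (next L r w l q) rfl rfl (by omega) rfl (by omega)
        (by omega) hF.hW (fun x A => by simp [twice]) ?_ (by
          simp [Ex.toExpr, Expr.cost, cellExpr, posE, succE, lastE]) (by omega) ?_
      · intro x hx A' hA'
        have e1 : A' 5 0 0 = l := by rw [hA' _ _ _ (by omega), if_neg (by omega), hl]
        have e2 : A' 3 q x = w q x := by
          rw [hA' _ _ _ (by omega), if_neg (by omega), h3]
        have e3 : q * L + x + 1 = pos L q x := rfl
        refine ⟨?_, ?_, ?_⟩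
        · simp [twice, lastE, posE, succE]; omega
        · simp only [twice, lastE, posE, succE, Ex.ev, Op.eval, List.cons_append, List.nil_append,
            List.getD_cons_succ, List.getD_cons_zero, e1, e2, e3, next, hq, hx, and_self,
            if_true]
          rcases lt_trichotomy (pos L q x) l with h | h | h
          · simp [h, h.ne]
          · simp [h]
          · simp [h.not_gt, h.ne']
        · have := hw q x
          unfold next
          split_ifs <;> omega
      · funext t i j
        simp only [setRow]
        by_cases h : t = 3 ∧ j < r
        · rcases lt_trichotomy i q with h' | h' | h'
          · simp [h, h', h'.ne, Nat.lt_succ_of_lt h']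
          · simp [h, h']
          · simp [h'.not_gt, h'.ne', show ¬ i < q + 1 by omega]
        · rw [if_neg (by tauto), if_neg (by tauto), if_neg (by tauto)]
    · rintro _ rfl
      refine ⟨by simp, ?_, by simp⟩
      funext q j
      simp only [true_and]
      split_ifs with h
      · rfl
      · rw [h3, next, if_neg h]
  · simp only [Ex.toExpr, Expr.cost, twice]
    nlinarith

/-- The written form of the basis encoded by `w`. -/
def code (m r : ℕ) (a w : ℕ → ℕ → ℕ) : List ℕ :=
  (List.range r).flatMap fun j => List.ofFn fun k : Fin m => (fam (fun i => vec m (a i)) w r j k).val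

theorem output_eq_code (h : LevelInv L m r a w r A) :
    ((List.range r).flatMap fun j => (List.range m).map (A 2 j)) = code m r a w := by
  unfold code
  rw [List.flatMap_def, List.flatMap_def]
  congr 1
  refine List.map_congr_left fun j hj => ?_
  obtain ⟨h1, h2⟩ := h.basis j (List.mem_range.1 hj)
  rw [← h2]
  refine List.ext_getElem (by simp) fun k hk hk' => ?_
  simp only [List.length_ofFn] at hk'
  simpa using (val_vec h1 ⟨k, hk'⟩).symm

/-- Backward induction along the lexicographic order. In the delay claim `s₀` is the time of the
previous output (or the start), and `D` covers the gap from there to the entry of the loop: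
preparation at first, later one run of `advanceProg`. The summand with `700` covers the loop test,
decoding and writing. -/
theorem enumLoop_spec (hF : Fits W L m r) (ha : ∀ i < r, Bits m (a i)) (hw : Valid r w)
    (h1 : A 1 = a) (h3 : A 3 = w) (h5 : A 5 0 0 ≠ 0) {ρ μ : ℕ → ℕ} (hρ : Agree [n, m, L, r] ρ)
    (hμ : Rep L μ A) (s : ℕ) (out : List (List ℕ × ℕ)) :
    ∃ ρ' μ' s' os ws, Exec W enumLoop ⟨ρ, μ, s, [], out⟩ ⟨ρ', μ', s', [], out ++ os⟩ ∧
      ws.Nodup ∧ (∀ x, x ∈ ws ↔ Valid r x ∧ key w ≤ key x) ∧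
      List.Forall₂ (fun o x => o.1 = code m r a x) os ws ∧
      ∀ D s₀, 1000 * ((r + 1) * (r + 1)) ≤ D → s ≤ s₀ + D →
        List.IsChain (fun x y => y ≤ x + (D + 700 * ((r + 1) * ((r + 1) * (m + 1)))))
          (s₀ :: (os.map Prod.snd ++ [s'])) := by
  have hL := hF.hL
  have hr := hF.hr
  induction w, hw using Valid.induction_gt generalizing A ρ μ s out with
  | h w hw ih =>
    have hcost : lastE.toExpr.cost = 10 := rfl
    obtain ⟨t₁, ht₁, ρ₁, μ₁, A₁, l₁, hρ₁, hμ₁, ⟨rfl, hA₁⟩, hex₁⟩ :=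
      decodeProg_spec (n := n) hF ha h1 h3 ρ μ hρ hμ
    have hlast := hA₁.last.isLast
    obtain ⟨t₂, ht₂, ρ₂, μ₂, A₂, l₂, hρ₂, hμ₂, ⟨rfl, rfl⟩, hex₂⟩ :=
      outputProg_spec (n := n) hF (fun j hj => (hA₁.basis j hj).1) ρ₁ μ₁ hρ₁ hμ₁
    obtain ⟨t₃, ht₃, ρ₃, μ₃, A₃, l₃, hρ₃, hμ₃, ⟨rfl, hA₃⟩, hex₃⟩ :=
      advanceProg_spec (n := n) hF hA₁.word hw.le_one rfl ρ₂ μ₂ hρ₂ hμ₂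
    obtain ⟨hrow₃, hword₃, hlast₃⟩ := hA₃
    set l := A₂ 5 0 0 with hl
    -- Time of completion of this output: 11 for the loop test, then decoding and writing, and 1 for
    -- `endSol`.
    set t := s + 11 + t₁ + t₂ + 1 with ht
    have hstep : ∀ τ, Exec W enumLoop
          ⟨ρ₃, μ₃, t + t₃, [], out ++ [(code m r a w, t)]⟩ τ →
        Exec W enumLoop ⟨ρ, μ, s, [], out⟩ τ := by
      intro τ hτ
      refine Exec.loop_true _ _ _ ⟨ρ₃, μ₃, t + t₃, [], out ++ [(code m r a w, t)]⟩ _ ?_ ?_ hτ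
      · rw [Ex.eval_toExpr hρ hμ lastE (by simp [lastE]; omega)]
        simpa [lastE] using h5
      · refine Exec.seq _ _ _ _ _ (hex₁ (s + 11) [] out) ?_
        refine Exec.seq _ _ _ _ _ (hex₂ _ _ _) ?_
        refine Exec.seq _ _ _ _ _ (Exec.endSol _) ?_
        have := hex₃ t [] (out ++ [(code m r a w, t)])
        simpa [State.tick, output_eq_code hA₁] using this
    have hbound : t ≤ s + 700 * ((r + 1) * ((r + 1) * (m + 1))) := by
      have h1 : 50 * ((r + 1) * (m + 1)) ≤ 50 * ((r + 1) * ((r + 1) * (m + 1))) :=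
        Nat.mul_le_mul_left _ (Nat.le_mul_of_pos_left _ (by omega))
      have h2 : 0 < (r + 1) * ((r + 1) * (m + 1)) := by positivity
      omega
    by_cases hl0 : l = 0
    · refine ⟨ρ₃, μ₃, t + t₃ + 11, [(code m r a w, t)], [w], hstep _ ?_, by simp, ?_, by simp, ?_⟩
      · have := Exec.loop_false (W := W) lastE.toExpr
          (.seq decodeProg (.seq outputProg (.seq .endSol advanceProg)))
          ⟨ρ₃, μ₃, t + t₃, [], out ++ [(code m r a w, t)]⟩ (by
            rw [Ex.eval_toExpr hρ₃ hμ₃ lastE (by simp [lastE]; omega)]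
            simpa [lastE, hlast₃] using hl0)
        simpa [State.tick, hcost, enumLoop] using this
      · intro x
        rw [List.mem_singleton]
        refine ⟨by rintro rfl; exact ⟨hw, le_rfl⟩, fun h => ?_⟩
        rw [hl0] at hlast
        exact hlast.eq_of_le h.1 h.2
      · intro D s₀ hD hs
        have h2 : 0 < (r + 1) * ((r + 1) * (m + 1)) := by positivity
        simp only [List.map_cons, List.map_nil, List.cons_append, List.nil_append,
          List.isChain_cons_cons, List.isChain_singleton, and_true]
        omega
    · have hlt := hlast.key_lt_next (by omega) hl0
      obtain ⟨ρ', μ', s', os, ws, hex, hnd, hmem, hall, hch⟩ :=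
        ih _ (hlast.valid_next (by omega) hw hl0) hlt (hrow₃.trans hA₁.rows) hword₃
          (by rw [hlast₃]; exact hl0) hρ₃ hμ₃ (t + t₃) (out ++ [(code m r a w, t)])
      refine ⟨ρ', μ', s', (code m r a w, t) :: os, w :: ws, hstep _ (by simpa using hex), ?_, ?_,
        hall.cons rfl, ?_⟩
      · refine List.nodup_cons.2 ⟨fun h => ?_, hnd⟩
        exact absurd ((hmem w).1 h).2 (not_le.2 hlt)
      · intro x
        rw [List.mem_cons, hmem]
        constructor
        · rintro (rfl | ⟨h, h'⟩)
          · exact ⟨hw, le_rfl⟩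
          · exact ⟨h, hlt.le.trans h'⟩
        · rintro ⟨h, h'⟩
          rcases h'.lt_or_eq with h' | h'
          · exact Or.inr ⟨h, hlast.next_le (by omega) hw hl0 h h'⟩
          · exact Or.inl (key_injective h').symm
      · intro D s₀ hD hs
        simp only [List.map_cons, List.cons_append, List.isChain_cons_cons]
        have h1 : t + t₃ ≤ t + D := by omega
        rw [← add_assoc]
        exact ⟨hbound.trans (Nat.add_le_add_right hs _), hch D t hD h1⟩

/-- Run from tables whose word is zero, `enumProg` lists the codes of all valid words. -/
theorem enumProg_spec (hF : Fits W L m r) (ha : ∀ i < r, Bits m (a i))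
    (h1 : A 1 = a) (h3 : ∀ q j, A 3 q j = 0) {ρ μ : ℕ → ℕ}
    (hρ : Agree [n, m, L, r] ρ) (hμ : Rep L μ A) (s : ℕ) :
    ∃ ρ' μ' s' os ws, Exec W enumProg ⟨ρ, μ, s, [], []⟩ ⟨ρ', μ', s', [], os⟩ ∧
      ws.Nodup ∧ (∀ x, x ∈ ws ↔ Valid r x) ∧
      List.Forall₂ (fun o x => o.1 = code m r a x) os ws ∧
      ∀ D, 1000 * ((r + 1) * (r + 1)) + s + 30 ≤ D →
        List.IsChain (fun x y => y ≤ x + (D + 700 * ((r + 1) * ((r + 1) * (m + 1)))))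
          (0 :: (os.map Prod.snd ++ [s'])) := by
  have hL := hF.hL
  have hLW := hF.lt
  have hst : Does W L (st 5 (.lit 0) (.lit 0) (.lit 1)) 30 [n, m, L, r] A
      fun A' => A' = upd A 5 0 0 1 :=
    Does.st rfl (by omega) hF.hW trivial trivial trivial (by simp; omega) (by simp; omega)
      (by simp; omega) (by simp [Ex.toExpr, Expr.cost, cellExpr]) rfl
  obtain ⟨t, ht, ρ₁, μ₁, _, _, hρ₁, hμ₁, ⟨rfl, rfl⟩, hex⟩ := hst ρ μ hρ hμ
  have h3' : A 3 = fun _ _ => 0 := by funext q j; exact h3 q j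
  obtain ⟨ρ', μ', s', os, ws, hex', hnd, hmem, hall, hch⟩ :=
    enumLoop_spec (n := n) (a := a) (w := fun _ _ => 0) hF ha
      ⟨fun _ _ _ => ⟨Nat.zero_le _, fun h => absurd rfl h⟩, fun _ _ _ => rfl⟩
      ((upd_table (by omega)).trans h1) ((upd_table (by omega)).trans h3')
      (by rw [upd_self]; omega) hρ₁ hμ₁ (s + t) []
  refine ⟨ρ', μ', s', os, ws, Exec.seq _ _ _ _ _ (hex s [] []) (by simpa using hex'), hnd, ?_,
    hall, fun D hD => hch D 0 (by omega) (by omega)⟩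
  intro x
  rw [hmem]
  refine ⟨fun h => h.1, fun h => ⟨h, not_lt.1 fun hlt => ?_⟩⟩
  obtain ⟨q, j, -, -, h⟩ := key_lt_key.1 hlt
  exact Nat.not_lt_zero _ h

end BasisWords

/-! ## Generating systems of the cut space and of the cycle space -/

namespace BasisWords

open WordRAM Finset
open scoped Classical

/-- The `ZMod 2`-valued indicator of an equality. -/
def ind (a b : ℕ) : ZMod 2 := if a = b then 1 else 0

/-- The boundary of a set of edges, where edge `t` joins `u t` and `v t`. -/
def bdry {m : ℕ} (u v : Fin m → ℕ) : (Fin m → ZMod 2) →ₗ[ZMod 2] (ℕ → ZMod 2) where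
  toFun x w := ∑ t, x t * (ind (u t) w + ind (v t) w)
  map_add' x y := by funext w; simp [add_mul, sum_add_distrib]
  map_smul' c x := by funext w; simp [mul_assoc, mul_sum]

theorem bdry_apply {m : ℕ} (u v : Fin m → ℕ) (x : Fin m → ZMod 2) (w : ℕ) :
    bdry u v x w = ∑ t, x t * (ind (u t) w + ind (v t) w) := rfl

theorem bdry_single {m : ℕ} (u v : Fin m → ℕ) (k : Fin m) :
    bdry u v (Pi.single k 1) = unit (u k) + unit (v k) := by
  funext w
  rw [bdry_apply, sum_eq_single k]
  · simp [ind, unit, Pi.single_apply, eq_comm]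
  · intro t _ ht; simp [ht]
  · intro h; exact absurd (mem_univ k) h

/-- The labels `comp` of the components of the forest formed by the first `k` edges, with paths
`P` from the vertices to the labels, and the fundamental cycles `M` of the other edges. -/
structure Forest {m : ℕ} (n : ℕ) (u v : Fin m → ℕ) (k : ℕ) (comp : ℕ → ℕ)
    (P : ℕ → Fin m → ZMod 2) (r : ℕ) (M : ℕ → Fin m → ZMod 2) (nt : ℕ → Fin m) : Prop where
  le : r ≤ k
  nt_lt : ∀ i < r, (nt i : ℕ) < k
  compEdge : ∀ t : Fin m, (t : ℕ) < k → comp (u t) = comp (v t)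
  bd : ∀ w < n, bdry u v (P w) = unit w + unit (comp w)
  supp : ∀ w < n, ∀ t, P w t ≠ 0 → (t : ℕ) < k ∧ ∀ i < r, t ≠ nt i
  cycle : ∀ i < r, bdry u v (M i) = 0
  dual : ∀ i < r, ∀ j < r, M i (nt j) = if i = j then 1 else 0
  rowSupp : ∀ i < r, ∀ t, M i t ≠ 0 → (t : ℕ) < k
  indep : ∀ x : Fin m → ZMod 2, (∀ t, x t ≠ 0 → (t : ℕ) < k ∧ ∀ i < r, t ≠ nt i) → bdry u v x = 0 → x = 0

section Forest

variable {m n : ℕ} {u v : Fin m → ℕ} {k r : ℕ} {comp comp' : ℕ → ℕ} {P P' : ℕ → Fin m → ZMod 2}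
  {M M' : ℕ → Fin m → ZMod 2} {nt : ℕ → Fin m}

theorem Forest.init {nt : ℕ → Fin m} (hc : ∀ w < n, comp w = w) (hP : ∀ w < n, P w = 0) :
    Forest n u v 0 comp P 0 M nt where
  le := le_rfl
  nt_lt := fun _ h => by omega
  compEdge := fun _ h => by omega
  bd := fun w hw => by rw [hP w hw, hc w hw, map_zero, add_self_zmod_two]
  supp := fun w hw t ht => absurd (by rw [hP w hw]; rfl) ht
  cycle := fun _ h => by omega
  dual := fun _ h => by omega
  rowSupp := fun _ h => by omega
  indep := fun x hx _ => by
    funext t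
    by_contra h
    exact Nat.not_lt_zero _ (hx t h).1

/-- The two stored paths and the new edge join into a walk between the two labels: a cycle if the
labels agree, a connection of two components otherwise. -/
theorem Forest.bdry_path (h : Forest n u v k comp P r M nt) (hk : k < m) (hu : u ⟨k, hk⟩ < n)
    (hv : v ⟨k, hk⟩ < n) :
    bdry u v (P (u ⟨k, hk⟩) + P (v ⟨k, hk⟩) + Pi.single ⟨k, hk⟩ 1) =
      unit (comp (u ⟨k, hk⟩)) + unit (comp (v ⟨k, hk⟩)) := by
  rw [map_add, map_add, h.bd _ hu, h.bd _ hv, bdry_single]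
  have h1 := add_self_zmod_two (unit (u ⟨k, hk⟩))
  have h2 := add_self_zmod_two (unit (v ⟨k, hk⟩))
  linear_combination (exp := 1) h1 + h2

theorem Forest.path_apply_self (h : Forest n u v k comp P r M nt) {w : ℕ} (hw : w < n) {t : Fin m}
    (ht : k ≤ t) : P w t = 0 := by
  by_contra h0
  have := (h.supp w hw t h0).1
  omega

/-- Stored paths use forest edges only, so the new cycle contains the new edge and no earlier chord,
and older cycles do not contain the new edge. -/
theorem Forest.chord (h : Forest n u v k comp P r M nt) (hk : k < m) (hu : u ⟨k, hk⟩ < n)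
    (hv : v ⟨k, hk⟩ < n) (hc : comp (u ⟨k, hk⟩) = comp (v ⟨k, hk⟩))
    (hM : ∀ i < r, M' i = M i)
    (hM' : M' r = P (u ⟨k, hk⟩) + P (v ⟨k, hk⟩) + Pi.single ⟨k, hk⟩ 1) :
    Forest n u v (k + 1) comp P (r + 1) M' (Function.update nt r ⟨k, hk⟩) := by
  have hnt : ∀ i < r, Function.update nt r ⟨k, hk⟩ i = nt i := fun i hi =>
    Function.update_of_ne (by omega) _ _
  have hr : Function.update nt r ⟨k, hk⟩ r = ⟨k, hk⟩ := Function.update_self ..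
  have hsplit : ∀ i, i < r + 1 → i < r ∨ i = r := fun i hi => by omega
  -- The new edge becomes a chord, so the set of forest edges stays the same, and with it the
  -- conditions on `P` and `indep`.
  have hsupp : ∀ t : Fin m, ((t : ℕ) < k ∧ ∀ i < r, t ≠ nt i) ↔
      ((t : ℕ) < k + 1 ∧ ∀ i < r + 1, t ≠ Function.update nt r ⟨k, hk⟩ i) := by
    intro t
    constructor
    · rintro ⟨h1, h2⟩
      refine ⟨by omega, fun i hi => ?_⟩
      rcases hsplit i hi with hi | rfl
      · rw [hnt i hi]; exact h2 i hi
      · rw [hr]; rintro rfl; exact lt_irrefl _ h1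
    · rintro ⟨h1, h2⟩
      refine ⟨?_, fun i hi => by rw [← hnt i hi]; exact h2 i (by omega)⟩
      have := h2 r (by omega)
      rw [hr] at this
      exact lt_of_le_of_ne (by omega) fun h => this (Fin.ext h)
  refine ⟨by have := h.le; omega, fun i hi => ?_, fun t ht => ?_, h.bd,
    fun w hw t ht => (hsupp t).1 (h.supp w hw t ht), fun i hi => ?_, fun i hi j hj => ?_,
    fun i hi t ht => ?_, fun x hx => h.indep x fun t ht => (hsupp t).2 (hx t ht)⟩
  · rcases hsplit i hi with hi | rfl
    · rw [hnt i hi]; have := h.nt_lt i hi; omega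
    · rw [hr]; exact Nat.lt_succ_self k
  · rcases Nat.lt_succ_iff_lt_or_eq.1 ht with ht | ht
    · exact h.compEdge t ht
    · obtain rfl : t = ⟨k, hk⟩ := Fin.ext ht
      exact hc
  · rcases hsplit i hi with hi | rfl
    · rw [hM i hi]; exact h.cycle i hi
    · rw [hM', h.bdry_path hk hu hv, hc, add_self_zmod_two]
  · rcases hsplit i hi with hi | rfl
    · rw [hM i hi]
      rcases hsplit j hj with hj | rfl
      · rw [hnt j hj]; exact h.dual i hi j hj
      · rw [hr, if_neg hi.ne]
        by_contra h0
        exact lt_irrefl _ (h.rowSupp i hi _ h0)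
    · rw [hM']
      rcases hsplit j hj with hj | rfl
      · rw [hnt j hj, if_neg hj.ne']
        have h1 : ∀ w < n, P w (nt j) = 0 := fun w hw => by
          by_contra h0
          exact (h.supp w hw _ h0).2 j hj rfl
        have h2 : nt j ≠ ⟨k, hk⟩ := fun h' => by
          have := h.nt_lt j hj
          rw [h'] at this
          exact lt_irrefl _ this
        simp [h1 _ hu, h1 _ hv, h2]
      · simp [h.path_apply_self hu, h.path_apply_self hv]
  · rcases hsplit i hi with hi | rfl
    · rw [hM i hi] at ht
      have := h.rowSupp i hi t ht
      omega
    · by_contra h0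
      have h1 : t ≠ ⟨k, hk⟩ := fun h' => h0 (by rw [h']; exact Nat.lt_succ_self k)
      refine ht ?_
      rw [hM']
      simp [h.path_apply_self hu (t := t) (by omega), h.path_apply_self hv (t := t) (by omega), h1]

/-- Boundary and coboundary are adjoint. -/
theorem sum_bdry (hu : ∀ t, u t < n) (hv : ∀ t, v t < n) (x : Fin m → ZMod 2) (χ : ℕ → ZMod 2) :
    ∑ w ∈ range n, χ w * bdry u v x w = ∑ t, x t * (χ (u t) + χ (v t)) := by
  simp only [bdry_apply, mul_sum]
  rw [sum_comm]
  refine sum_congr rfl fun t _ => ?_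
  have h : ∀ a < n, ∑ w ∈ range n, χ w * ind a w = χ a := fun a ha => by
    simp [ind, ha]
  rw [← h _ (hu t), ← h _ (hv t), ← sum_add_distrib, mul_sum]
  exact sum_congr rfl fun w _ => by ring

/-- The component of the second end takes over the label of the first; its paths are prolonged
through the new edge. -/
theorem Forest.link (h : Forest n u v k comp P r M nt) (hk : k < m) (hu : ∀ t, u t < n)
    (hv : ∀ t, v t < n) (hc : comp (u ⟨k, hk⟩) ≠ comp (v ⟨k, hk⟩))
    (hcomp : ∀ w < n, comp' w = if comp w = comp (v ⟨k, hk⟩) then comp (u ⟨k, hk⟩) else comp w)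
    (hP : ∀ w < n, P' w = if comp w = comp (v ⟨k, hk⟩) then
      P w + (P (u ⟨k, hk⟩) + P (v ⟨k, hk⟩) + Pi.single ⟨k, hk⟩ 1) else P w) :
    Forest n u v (k + 1) comp' P' r M nt := by
  have hle : ∀ t : Fin m, (t : ℕ) < k + 1 → (t : ℕ) < k ∨ t = ⟨k, hk⟩ := fun t ht => by
    rcases Nat.lt_succ_iff_lt_or_eq.1 ht with ht | ht
    · exact Or.inl ht
    · exact Or.inr (Fin.ext ht)
  refine ⟨h.le.trans (Nat.le_succ k), fun i hi => (h.nt_lt i hi).trans (Nat.lt_succ_self k),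
    fun t ht => ?_, fun w hw => ?_, fun w hw t ht => ?_, h.cycle, h.dual,
    fun i hi t ht => (h.rowSupp i hi t ht).trans (Nat.lt_succ_self k), fun x hx hbx => ?_⟩
  · rw [hcomp _ (hu t), hcomp _ (hv t)]
    rcases hle t ht with ht | rfl
    · rw [h.compEdge t ht]
    · rw [if_neg hc, if_pos rfl]
  · rw [hP w hw, hcomp w hw]
    split_ifs with h1
    · rw [map_add, h.bdry_path hk (hu _) (hv _), h.bd w hw, h1]
      have h2 := add_self_zmod_two (unit (comp (v ⟨k, hk⟩)))
      linear_combination (exp := 1) h2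
    · exact h.bd w hw
  · by_cases h1 : (t : ℕ) < k
    · refine ⟨by omega, fun i hi hti => ?_⟩
      have h2 : ∀ w < n, P w t = 0 := fun w hw => by
        by_contra h0
        exact (h.supp w hw t h0).2 i hi hti
      have h3 : t ≠ ⟨k, hk⟩ := fun h' => by rw [h'] at h1; exact lt_irrefl _ h1
      refine ht ?_
      rw [hP w hw]
      split_ifs
      · simp [h2 w hw, h2 _ (hu _), h2 _ (hv _), h3]
      · exact h2 w hw
    · have h2 : ∀ w < n, P w t = 0 := fun w hw => h.path_apply_self hw (by omega)
      have h3 : t = ⟨k, hk⟩ := by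
        by_contra h3
        refine ht ?_
        rw [hP w hw]
        split_ifs
        · simp [h2 w hw, h2 _ (hu _), h2 _ (hv _), h3]
        · exact h2 w hw
      subst h3
      refine ⟨Nat.lt_succ_self k, fun i hi hti => ?_⟩
      have := h.nt_lt i hi
      rw [← hti] at this
      exact lt_irrefl _ this
  -- Pair the zero boundary with the indicator of the old component of the first end. Both ends of
  -- any earlier edge lie in the same component, so only the new edge contributes.
  · have hxk : x ⟨k, hk⟩ = 0 := by
      have h1 := sum_bdry hu hv x fun w => ind (comp w) (comp (u ⟨k, hk⟩))
      rw [hbx, sum_eq_single (⟨k, hk⟩ : Fin m)] at h1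
      · simpa [ind, hc.symm] using h1.symm
      · intro t _ ht
        by_cases h0 : x t = 0
        · rw [h0, zero_mul]
        · rcases hle t (hx t h0).1 with h2 | h2
          · rw [h.compEdge t h2]
            have := add_self_zmod_two (ind (comp (v t)) (comp (u ⟨k, hk⟩)))
            rw [this, mul_zero]
          · exact absurd h2 ht
      · intro h2; exact absurd (mem_univ _) h2
    refine h.indep x (fun t ht => ⟨?_, (hx t ht).2⟩) hbx
    rcases hle t (hx t ht).1 with h2 | rfl
    · exact h2
    · exact absurd hxk ht

theorem Forest.linearIndependent (h : Forest n u v k comp P r M nt) :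
    LinearIndependent (ZMod 2) (fun i : Fin r => M i) := by
  refine Fintype.linearIndependent_iff.2 fun g hg j => ?_
  have h1 := congrFun hg (nt j)
  rw [Finset.sum_apply, sum_eq_single j] at h1
  · simpa [h.dual j j.2 j j.2] using h1
  · intro i _ hij
    simp [h.dual i i.2 j j.2, Fin.val_ne_of_ne hij]
  · intro h2; exact absurd (mem_univ _) h2

/-- Subtracting the combination of fundamental cycles with the same values on the chords leaves a
cycle supported on forest edges, which is zero by `indep`. -/
theorem Forest.span_eq (h : Forest n u v m comp P r M nt) :
    Submodule.span (ZMod 2) (Set.range fun i : Fin r => M i) = LinearMap.ker (bdry u v) := by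
  refine le_antisymm ?_ fun x hx => ?_
  · rw [Submodule.span_le]
    rintro _ ⟨i, rfl⟩
    exact h.cycle i i.2
  · have h1 : x - ∑ i : Fin r, x (nt i) • M i = 0 := by
      refine h.indep _ (fun t ht => ⟨t.2, fun j hj htj => ht ?_⟩) ?_
      · rw [htj, Pi.sub_apply, Finset.sum_apply, sum_eq_single (⟨j, hj⟩ : Fin r)]
        · simp [h.dual j hj j hj]
        · intro i _ hij
          have : (i : ℕ) ≠ j := fun h' => hij (Fin.ext h')
          simp [h.dual i i.2 j hj, this]
        · intro h2; exact absurd (mem_univ _) h2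
      · rw [map_sub, map_sum, LinearMap.mem_ker.1 hx, zero_sub, neg_eq_zero]
        refine sum_eq_zero fun i _ => ?_
        rw [map_smul, h.cycle i i.2, smul_zero]
    rw [sub_eq_zero.1 h1]
    exact sum_mem fun i _ => Submodule.smul_mem _ _ (Submodule.subset_span ⟨i, rfl⟩)

end Forest

end BasisWords

/-! ### The programs that write the two generating systems -/

namespace BasisWords

open WordRAM Finset
open scoped Classical

variable {W L n m : ℕ} {A A₀ : Arr}

/-- The ends of edge `t`. -/
def endU (A : Arr) (t : ℕ) : ℕ := A 0 0 (2 * t)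

def endV (A : Arr) (t : ℕ) : ℕ := A 0 0 (2 * t + 1)

def endUE (k : ℕ) : Ex := .ld 0 (.lit 0) (twice (.reg k))

def endVE (k : ℕ) : Ex := .ld 0 (.lit 0) (succE (twice (.reg k)))

/-- Write the cuts around the vertices `1, …, n - 1`. -/
def cutProg : Prog :=
  letIn 3 (.bin .sub (.reg 0) (.lit 1)) (forr 4 3 (forr 5 1 (st 1 (.reg 4) (.reg 5)
    (xorE (.bin .eq (endUE 5) (succE (.reg 4))) (.bin .eq (endVE 5) (succE (.reg 4)))))))

theorem cutProg_spec (hF : Fits W L m 0) (hn : n < L) (hm : 2 * m < L) :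
    Does W L cutProg (200 * ((n + 1) * (m + 1))) [n, m, L] A₀ fun A => A 3 = A₀ 3 ∧
      ∀ i < n - 1, ∀ k < m, A 1 i k =
        xor (if endU A₀ k = i + 1 then 1 else 0) (if endV A₀ k = i + 1 then 1 else 0) := by
  have hL := hF.hL
  have hLW := hF.lt
  have hc : (n - 1) * (100 * (m + 1) + 8) + 6 ≤ 110 * ((n + 1) * (m + 1)) :=
    loop_cost (by omega) (by omega)
  have hle : 0 < (n + 1) * (m + 1) := by positivity
  refine Does.letIn (T₁ := 110 * ((n + 1) * (m + 1))) rfl (by simp) (by simp [Op.eval]; omega) ?_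
    (by simp only [Ex.toExpr, Expr.cost]; omega)
  refine Does.forr (N := n - 1) (fun i A => A 0 = A₀ 0 ∧ A 3 = A₀ 3 ∧ ∀ i' < i, ∀ k < m, A 1 i' k =
    xor (if endU A₀ k = i' + 1 then 1 else 0) (if endV A₀ k = i' + 1 then 1 else 0)) rfl
    (by simp [Op.eval]) (by omega) ⟨rfl, rfl, fun _ h => by omega⟩ ?_ hc fun A h => h.2
  rintro i hi A ⟨h0, h3, h1⟩
  refine Does.fillRow (N := m) (i := i) (c := 60) (fun k =>
    xor (if endU A₀ k = i + 1 then 1 else 0) (if endV A₀ k = i + 1 then 1 else 0)) rfl rfl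
    (by omega) rfl (by omega) (by omega) hF.hW (fun x A => by simp) ?_ (by
      simp [Ex.toExpr, Expr.cost, cellExpr, succE, xorE, twice, endUE, endVE]) (by omega) ?_
  · intro k hk A' hA'
    have e0 : A' 0 0 = A₀ 0 0 := by
      funext j; rw [hA' _ _ _ (by omega), h0]
    refine ⟨?_, ?_, ?_⟩
    · simp [xorE, endUE, endVE, succE, twice, Op.eval]; omega
    · by_cases hu : A₀ 0 0 (2 * k) = i + 1 <;> by_cases hv : A₀ 0 0 (2 * k + 1) = i + 1 <;>
        simp [xorE, endUE, endVE, succE, twice, Op.eval, e0, xor, endU, endV, hu, hv]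
    · have := xor_le (if endU A₀ k = i + 1 then 1 else 0) (if endV A₀ k = i + 1 then 1 else 0)
      omega
  · refine ⟨by rw [setRow_table (by omega), h0], by rw [setRow_table (by omega), h3],
      fun i' hi' k hk => ?_⟩
    by_cases h : i' = i
    · subst h; simp [setRow, hk]
    · rw [setRow_of_ne (by omega)]; exact h1 i' (by omega) k hk

/-- Add row `3` of the temporary table to the paths of the vertices labelled `reg 7`, and
relabel them. -/
def linkProg : Prog :=
  forr 8 0 (.ite (Ex.bin .eq (.ld 7 (.lit 0) (.reg 8)) (.reg 7)).toExpr
    (.seq (addRow 9 6 8 8 3) (st 7 (.lit 0) (.reg 8) (.reg 6))) .nop)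

def chordProg : Prog :=
  letIn 8 (.ld 5 (.lit 0) (.lit 2)) (.seq (copyRow 9 1 8 8 3)
    (st 5 (.lit 0) (.lit 2) (succE (.reg 8))))

/-- Table `6` holds the paths, row `0` of table `7` the labels, and row `k` of table `8` the sum of
both paths and edge `k`. The labels of the ends are kept in registers `6` and `7`, so relabelling
cannot disturb the tests. -/
def edgeProg : Prog :=
  letIn 4 (endUE 3) (letIn 5 (endVE 3) (letIn 6 (.ld 7 (.lit 0) (.reg 4))
    (letIn 7 (.ld 7 (.lit 0) (.reg 5))
      (.seq (copyRow 8 8 3 6 4) (.seq (addRow 8 8 3 6 5) (.seq (st 8 (.reg 3) (.reg 3) (.lit 1))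
        (.ite (Ex.bin .eq (.reg 6) (.reg 7)).toExpr chordProg linkProg)))))))

/-- Write the fundamental cycles of a spanning forest, and count them. -/
def cycleProg : Prog := .seq (forr 3 0 (st 7 (.lit 0) (.reg 3) (.reg 3))) (forr 3 1 edgeProg)

structure ForestInv (n m k : ℕ) (A₀ A : Arr) : Prop where
  input : A 0 = A₀ 0
  word : A 3 = A₀ 3
  label : ∀ w < n, A 7 0 w < n
  path : ∀ w < n, Bits m (A 6 w)
  row : ∀ i < A 5 0 2, Bits m (A 1 i)
  forest : ∃ nt, Forest n (fun t : Fin m => endU A₀ t) (fun t : Fin m => endV A₀ t) k (A 7 0)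
    (fun w => vec m (A 6 w)) (A 5 0 2) (fun i => vec m (A 1 i)) nt

theorem linkProg_spec (hF : Fits W L m 0) (hn : n < L) {k x y c d : ℕ} (hk : k < m)
    (hc : c < n) (hpath : ∀ w < n, Bits m (A 6 w))
    (hD : Bits m (A 8 k)) :
    Does W L linkProg (200 * ((n + 1) * (m + 1))) [n, m, L, k, x, y, c, d] A fun A' =>
      A' 0 = A 0 ∧ A' 1 = A 1 ∧ A' 3 = A 3 ∧ A' 5 = A 5 ∧
      ∀ w < n, A' 7 0 w = (if A 7 0 w = d then c else A 7 0 w) ∧ Bits m (A' 6 w) ∧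
        vec m (A' 6 w) = if A 7 0 w = d then vec m (A 6 w) + vec m (A 8 k) else vec m (A 6 w) := by
  have hL := hF.hL
  have hm := hF.hm
  have hLW := hF.lt
  refine Does.forr (N := n) (c := 100 * (m + 1)) (fun i A' => A' 0 = A 0 ∧ A' 1 = A 1 ∧
    A' 3 = A 3 ∧ A' 5 = A 5 ∧ A' 8 = A 8 ∧
    (∀ w < i, A' 7 0 w = (if A 7 0 w = d then c else A 7 0 w) ∧ Bits m (A' 6 w) ∧
      vec m (A' 6 w) = if A 7 0 w = d then vec m (A 6 w) + vec m (A 8 k) else vec m (A 6 w)) ∧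
    ∀ w < n, i ≤ w → A' 7 0 w = A 7 0 w ∧ A' 6 w = A 6 w) rfl rfl (by omega)
    ⟨rfl, rfl, rfl, rfl, rfl, fun _ h => by omega, fun _ _ _ => ⟨rfl, rfl⟩⟩ ?_
    (loop_cost le_rfl (by omega)) fun B h => ⟨h.1, h.2.1, h.2.2.1, h.2.2.2.1, h.2.2.2.2.2.1⟩
  rintro i hi B ⟨h0, h1, h3, h5, h8, hold, hnew⟩
  obtain ⟨h7i, h6i⟩ := hnew i hi le_rfl
  refine Does.ite (T₁ := 80 * (m + 1)) ?_ (fun he => ?_) (fun he => ?_) (by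
    simp [Ex.toExpr, Expr.cost, cellExpr]; omega)
  · simp; omega
  · have he' : A 7 0 i = d := by simpa [Op.eval, h7i] using he
    refine Does.seq (T₁ := 50 * (m + 1)) (T₂ := 30) ?_ (by omega)
    refine addRow_spec hF rfl rfl rfl (i := i) (i' := k) rfl rfl (by omega) (by omega) (by omega)
      (by omega) ?_
    refine Does.st rfl (by omega) hF.hW trivial (by simp) (by simp) (by simp; omega)
      (by simp; omega) (by simp; omega) (by simp [Ex.toExpr, Expr.cost, cellExpr]) ?_
    simp only [Ex.ev, List.getD_cons_succ, List.getD_cons_zero, List.cons_append, List.nil_append]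
    have hx := bits_setRow_xor (A := B) (t := 6) (i := i) (t' := 8) (i' := k)
      (by rw [h6i]; exact hpath i hi) (by rw [h8]; exact hD)
    refine ⟨?_, ?_, ?_, ?_, ?_, fun w hw => ?_, fun w hw hw' => ?_⟩
    · rw [upd_table (by omega), setRow_table (by omega), h0]
    · rw [upd_table (by omega), setRow_table (by omega), h1]
    · rw [upd_table (by omega), setRow_table (by omega), h3]
    · rw [upd_table (by omega), setRow_table (by omega), h5]
    · rw [upd_table (by omega), setRow_table (by omega), h8]
    · by_cases hwi : w = i
      · subst hwi
        rw [upd_self, if_pos he', if_pos he', upd_table (by omega)]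
        refine ⟨rfl, hx.1, ?_⟩
        rw [hx.2, h6i, h8]
      · rw [upd, if_neg (by omega), setRow_table (by omega), upd_table (by omega),
          setRow_of_ne (by omega)]
        exact hold w (by omega)
    · rw [upd, if_neg (by omega), setRow_table (by omega), upd_table (by omega),
          setRow_of_ne (by omega)]
      exact hnew w hw (by omega)
  · have he' : A 7 0 i ≠ d := by simpa [Op.eval, h7i] using he
    refine Does.nop (by omega) ⟨h0, h1, h3, h5, h8, fun w hw => ?_,
      fun w hw hw' => hnew w hw (by omega)⟩
    by_cases hwi : w = i
    · subst hwi
      rw [if_neg he', if_neg he', h7i, h6i]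
      exact ⟨rfl, hpath w hi, rfl⟩
    · exact hold w (by omega)

theorem edgeProg_spec (hF : Fits W L m 0) (hn : n < L) (hm : 2 * m < L)
    (hu : ∀ t < m, endU A₀ t < n) (hv : ∀ t < m, endV A₀ t < n) {k : ℕ} (hk : k < m)
    (hA : ForestInv n m k A₀ A) :
    Does W L edgeProg (500 * ((n + 1) * (m + 1))) [n, m, L, k] A (ForestInv n m (k + 1) A₀) := by
  have hL := hF.hL
  have hLW := hF.lt
  obtain ⟨nt, hf⟩ := hA.forest
  have hle : 100 * (m + 1) ≤ 100 * ((n + 1) * (m + 1)) := le_cost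
  have hrk := hf.le
  have hu' := hu k hk
  have hv' := hv k hk
  have hcu := hA.label _ hu'
  have hcv := hA.label _ hv'
  have eu : A 0 0 (2 * k) = endU A₀ k := by rw [hA.input]; rfl
  have ev : A 0 0 (2 * k + 1) = endV A₀ k := by rw [hA.input]; rfl
  refine Does.letIn (T₁ := 460 * ((n + 1) * (m + 1))) rfl (by simp [endUE, twice, Op.eval]; omega) ?_ ?_ (by
    simp only [Ex.toExpr, Expr.cost, endUE, twice, cellExpr]; omega)
  · simp [endUE, twice, Op.eval, eu]; omega
  have e1 : (endUE 3).ev [n, m, L, k] A = endU A₀ k := by simp [endUE, twice, Op.eval, eu]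
  rw [e1]
  refine Does.letIn (T₁ := 420 * ((n + 1) * (m + 1))) rfl
    (by simp [endVE, succE, twice, Op.eval]; omega) ?_ ?_ (by
    simp only [Ex.toExpr, Expr.cost, endVE, twice, succE, cellExpr]; omega)
  · simp [endVE, succE, twice, Op.eval, ev]; omega
  have e2 : (endVE 3).ev ([n, m, L, k] ++ [endU A₀ k]) A = endV A₀ k := by
    simp [endVE, succE, twice, Op.eval, ev]
  rw [e2]
  refine Does.letIn (T₁ := 380 * ((n + 1) * (m + 1))) rfl (by simp; omega) (by simp; omega) ?_ (by
    simp only [Ex.toExpr, Expr.cost, cellExpr]; omega)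
  refine Does.letIn (T₁ := 340 * ((n + 1) * (m + 1))) rfl (by simp; omega) (by simp; omega) ?_ (by
    simp only [Ex.toExpr, Expr.cost, cellExpr]; omega)
  simp only [Ex.ev, List.getD_cons_succ, List.getD_cons_zero, List.cons_append, List.nil_append]
  set x := endU A₀ k with hx
  set y := endV A₀ k with hy
  set c := A 7 0 x with hc
  set d := A 7 0 y with hd
  refine Does.seq (T₁ := 50 * (m + 1)) (T₂ := 290 * ((n + 1) * (m + 1))) ?_ (by omega)
  refine copyRow_spec hF rfl rfl rfl (i := k) (i' := x) rfl rfl (by omega) (by omega) (by omega)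
    (by omega) (hA.path x hu') ?_
  set B := setRow A 8 k m (A 6 x) with hB
  have hB8 : ∀ t < m, B 8 k t = A 6 x t := fun t ht => by simp [hB, setRow, ht]
  have hBbits : Bits m (B 8 k) := fun t ht => by rw [hB8 t ht]; exact hA.path x hu' t ht
  have hBne : ∀ t, t ≠ 8 → B t = A t := fun t ht => setRow_table ht
  refine Does.seq (T₁ := 50 * (m + 1)) (T₂ := 240 * ((n + 1) * (m + 1))) ?_ (by omega)
  refine addRow_spec hF rfl rfl rfl (i := k) (i' := y) rfl rfl (by omega) (by omega) (by omega)
    (by omega) ?_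
  have hx2 := bits_setRow_xor (A := B) (t := 8) (i := k) (t' := 6) (i' := y) hBbits
    (by rw [hBne 6 (by omega)]; exact hA.path y hv')
  set C := setRow B 8 k m (fun j => xor (B 8 k j) (B 6 y j)) with hC
  have hCne : ∀ t, t ≠ 8 → C t = A t := fun t ht => (setRow_table ht).trans (hBne t ht)
  refine Does.seq (T₁ := 30) (T₂ := 210 * ((n + 1) * (m + 1))) ?_ (by omega)
  refine Does.st rfl (by omega) hF.hW (by simp) (by simp) (by simp) (by simp; omega)
    (by simp; omega) (by simp; omega) (by simp [Ex.toExpr, Expr.cost, cellExpr]) ?_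
  simp only [Ex.ev, List.getD_cons_succ, List.getD_cons_zero]
  set D := upd C 8 k k 1 with hD
  have hDne : ∀ t, t ≠ 8 → D t = A t := fun t ht => (upd_table ht).trans (hCne t ht)
  have hDbits : Bits m (D 8 k) := by
    intro t ht
    by_cases h : t = k
    · rw [h, hD, upd_self]
    · rw [hD, upd, if_neg (by omega)]; exact hx2.1 t ht
  -- Overwriting position `k` by `1` is the same as adding the unit vector, as the stored paths
  -- avoid edge `k`.
  have hDvec : vec m (D 8 k) = vec m (A 6 x) + vec m (A 6 y) + Pi.single ⟨k, hk⟩ 1 := by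
    have h1 : vec m (B 8 k) = vec m (A 6 x) := by
      funext t; simp only [vec, hB8 t t.2]
    rw [h1, hBne 6 (by omega)] at hx2
    rw [← hx2.2]
    funext t
    by_cases h : t = ⟨k, hk⟩
    · subst h
      have h2 : vec m (C 8 k) ⟨k, hk⟩ = 0 := by
        rw [hx2.2, Pi.add_apply, hf.path_apply_self hu' (t := ⟨k, hk⟩) le_rfl,
          hf.path_apply_self hv' (t := ⟨k, hk⟩) le_rfl, add_zero]
      rw [Pi.add_apply, h2, Pi.single_eq_same, zero_add, vec, hD, upd_self, Nat.cast_one]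
    · have h3 : (t : ℕ) ≠ k := fun h' => h (Fin.ext h')
      rw [Pi.add_apply, Pi.single_eq_of_ne h, add_zero, vec, vec, hD, upd, if_neg (by omega)]
  refine Does.ite (T₁ := 200 * ((n + 1) * (m + 1))) (by simp) (fun he => ?_) (fun he => ?_) (by
    simp only [Ex.toExpr, Expr.cost]; omega)
  · have hcd : c = d := by simpa [Op.eval] using he
    refine Does.letIn (T₁ := 80 * (m + 1)) rfl (by simp; omega)
      (by simp [hDne 5]; omega) ?_ (by simp only [Ex.toExpr, Expr.cost, cellExpr]; omega)
    simp only [Ex.ev, List.cons_append, List.nil_append, hDne 5 (by omega)]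
    refine Does.seq (T₁ := 50 * (m + 1)) (T₂ := 30) ?_ (by omega)
    refine copyRow_spec hF rfl rfl rfl (i := A 5 0 2) (i' := k) rfl rfl (by omega) (by omega)
      (by omega) (by omega) hDbits ?_
    refine Does.st rfl (by omega) hF.hW (by simp) (by simp) (by simp [succE]) (by simp; omega)
      (by simp; omega) (by simp [succE, Op.eval]; omega)
      (by simp [Ex.toExpr, Expr.cost, cellExpr, succE]) ?_
    simp only [Ex.ev, succE, Op.eval, List.getD_cons_succ, List.getD_cons_zero]
    have hnew : ∀ t < m, setRow D 1 (A 5 0 2) m (D 8 k) 1 (A 5 0 2) t = D 8 k t := fun t ht => by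
      simp [setRow, ht]
    refine ⟨?_, ?_, ?_, ?_, ?_, Function.update nt (A 5 0 2) ⟨k, hk⟩, ?_⟩
    · rw [upd_table (by omega), setRow_table (by omega), hDne 0 (by omega), hA.input]
    · rw [upd_table (by omega), setRow_table (by omega), hDne 3 (by omega), hA.word]
    · rw [upd_table (by omega), setRow_table (by omega), hDne 7 (by omega)]; exact hA.label
    · rw [upd_table (by omega), setRow_table (by omega), hDne 6 (by omega)]; exact hA.path
    · rw [upd_self, upd_table (by omega)]
      intro i hi
      rcases Nat.lt_succ_iff_lt_or_eq.1 hi with hi | rfl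
      · rw [setRow_of_ne (by omega), hDne 1 (by omega)]; exact hA.row i hi
      · intro t ht
        rw [hnew t ht]
        exact hDbits t ht
    · rw [upd_self, upd_table (by omega), upd_table (by omega), upd_table (by omega),
        setRow_table (by omega), setRow_table (by omega), hDne 7 (by omega), hDne 6 (by omega)]
      refine hf.chord hk hu' hv' hcd (fun i hi => ?_) ?_
      · rw [setRow_of_ne (by omega), hDne 1 (by omega)]
      · rw [← hx, ← hy, ← hDvec]
        funext t
        simp only [vec, hnew t t.2]
  · have hcd : c ≠ d := by simpa [Op.eval] using he
    refine (linkProg_spec hF hn hk hcu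
      (by rw [hDne 6 (by omega)]; exact hA.path) hDbits).mono (by omega) ?_
    rintro E ⟨h0, h1, h3, h5, hE⟩
    rw [hDne 7 (by omega), hDne 6 (by omega), hDvec] at hE
    refine ⟨?_, ?_, fun w hw => ?_, fun w hw => (hE w hw).2.1, ?_, nt, ?_⟩
    · rw [h0, hDne 0 (by omega), hA.input]
    · rw [h3, hDne 3 (by omega), hA.word]
    · rw [(hE w hw).1]
      split_ifs
      · exact hcu
      · exact hA.label w hw
    · rw [h5, h1, hDne 5 (by omega), hDne 1 (by omega)]; exact hA.row
    · rw [h5, h1, hDne 5 (by omega), hDne 1 (by omega)]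
      exact hf.link hk (fun t => hu t t.2) (fun t => hv t t.2) hcd (fun w hw => (hE w hw).1)
        fun w hw => (hE w hw).2.2

theorem cycleProg_spec (hF : Fits W L m 0) (hn : n < L) (hm : 2 * m < L)
    (hu : ∀ t < m, endU A₀ t < n) (hv : ∀ t < m, endV A₀ t < n) (hm0 : 0 < m)
    (h6 : ∀ w t, A₀ 6 w t = 0) (h5 : A₀ 5 0 2 = 0) :
    Does W L cycleProg (700 * ((m + 1) * ((n + 1) * (m + 1)))) [n, m, L] A₀
      (ForestInv n m m A₀) := by
  have hL := hF.hL
  have hLW := hF.lt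
  have hpos : 0 < (n + 1) * (m + 1) := by positivity
  have hcost : m * (500 * ((n + 1) * (m + 1)) + 8) + 6 ≤
      550 * ((m + 1) * ((n + 1) * (m + 1))) := by
    obtain ⟨K, hK⟩ : ∃ K, (n + 1) * (m + 1) = K + 1 := ⟨_, (Nat.succ_pred hpos.ne').symm⟩
    rw [hK]
    exact loop_cost le_rfl (by omega)
  have h1 : n + 1 ≤ (m + 1) * ((n + 1) * (m + 1)) :=
    (Nat.le_mul_of_pos_right _ (by omega)).trans (Nat.le_mul_of_pos_left _ (by omega))
  refine Does.seq (T₁ := 100 * (n + 1)) (T₂ := 550 * ((m + 1) * ((n + 1) * (m + 1)))) ?_ (by omega)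
  refine Does.fillRow (N := n) (i := 0) (c := 40) (fun w => w) rfl rfl (by omega) rfl (by omega)
    (by omega) hF.hW (fun x A => by simp) (fun x hx A' hA' => ⟨by simp, by simp, by omega⟩)
    (by simp [Ex.toExpr, Expr.cost, cellExpr]) (by omega) ?_
  refine Does.forr (ForestInv n m · A₀) rfl rfl (by omega) ?_
    (fun k hk A hA => edgeProg_spec hF hn hm hu hv hk hA) hcost fun _ h => h
  have hlab : ∀ w < n, setRow A₀ 7 0 n (fun w => w) 7 0 w = w := fun w hw => by simp [setRow, hw]
  -- The list of chords is still empty; edge `0` is a mere default value, available because `0 < m`.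
  refine ⟨setRow_table (by omega), setRow_table (by omega), fun w hw => by rwa [hlab w hw],
    fun w hw t ht => ?_, ?_, fun _ => ⟨0, hm0⟩, ?_⟩
  · rw [setRow_table (by omega), h6]; omega
  · rw [setRow_table (t' := 5) (by omega), h5]; intro i hi; omega
  · rw [setRow_table (t' := 5) (by omega), setRow_table (t' := 6) (by omega), h5]
    refine Forest.init hlab fun w hw => ?_
    funext t
    simp [vec, h6]

end BasisWords

/-! ## From vectors to edge sets -/

namespace BasisWords

open WordRAM GraphBases Finset
open scoped Classical

theorem IsBasisOf.card_le {V : Type*} [AddCommGroup V] [Module (ZMod 2) V] [FiniteDimensional (ZMod 2) V]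
    {U : Submodule (ZMod 2) V} {B : Finset V} (hU : ∀ v ∈ B, v ∈ U)
    (hB : LinearIndepOn (ZMod 2) id (B : Set V)) : B.card ≤ Module.finrank (ZMod 2) U := by
  rw [← finrank_span_finset_eq_card hB]
  exact Submodule.finrank_mono (Submodule.span_le.2 hU)

/-- The bases of a subspace are its maximal independent subsets. -/
theorem maximal_iff_isBasisOf {V : Type*} [AddCommGroup V] [Module (ZMod 2) V]
    [FiniteDimensional (ZMod 2) V] {U : Submodule (ZMod 2) V} {B : Finset V} :
    Maximal (fun B : Finset V => (∀ v ∈ B, v ∈ U) ∧ LinearIndepOn (ZMod 2) id (B : Set V)) B ↔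
      IsBasisOf U (Module.finrank (ZMod 2) U) B := by
  constructor
  · rintro ⟨⟨hU, hli⟩, hmax⟩
    refine ⟨hU, hli, le_antisymm (IsBasisOf.card_le hU hli) ?_⟩
    by_contra hlt
    have h1 : ¬ U ≤ Submodule.span (ZMod 2) (B : Set V) := fun h => hlt (by
      rw [← finrank_span_finset_eq_card hli]; exact Submodule.finrank_mono h)
    obtain ⟨v, hv, hvB⟩ := Set.not_subset.1 h1
    have h2 := hmax (y := insert v B) ⟨fun x hx => ?_, ?_⟩ (subset_insert v B)
    · exact hvB (Submodule.subset_span (h2 (mem_insert_self v B)))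
    · rcases mem_insert.1 hx with rfl | hx
      · exact hv
      · exact hU x hx
    · rw [coe_insert]
      exact hli.id_insert hvB
  · rintro ⟨hU, hli, hcard⟩
    refine ⟨⟨hU, hli⟩, fun I hI hBI => ?_⟩
    exact (eq_of_subset_of_card_le hBI (by rw [hcard]; exact IsBasisOf.card_le hI.1 hI.2)).ge

/-! ### Incidence vectors and edge sets -/

section Graph

variable {n m : ℕ} {G : SimpleGraph (Fin n)} {es : Fin m → Fin n × Fin n}

def edge (es : Fin m → Fin n × Fin n) (k : Fin m) : Sym2 (Fin n) := s((es k).1, (es k).2)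

/-- The edge set with a given incidence vector. -/
noncomputable def toEdges (es : Fin m → Fin n × Fin n) (x : Fin m → ZMod 2) : Finset (Sym2 (Fin n)) :=
  (univ.filter fun k => x k = 1).image (edge es)

theorem edge_mem_toEdges (hes : IsEdgeList G es) {x : Fin m → ZMod 2} {k : Fin m} :
    edge es k ∈ toEdges es x ↔ x k = 1 := by
  simp only [toEdges, mem_image, mem_filter, mem_univ, true_and]
  refine ⟨fun ⟨k', h, h'⟩ => ?_, fun h => ⟨k, h, rfl⟩⟩
  obtain rfl : k' = k := hes.1 h'
  exact h

theorem toEdges_injective (hes : IsEdgeList G es) : Function.Injective (toEdges es) := by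
  intro x y h
  funext k
  have h1 : x k = 1 ↔ y k = 1 := by rw [← edge_mem_toEdges hes, ← edge_mem_toEdges hes, h]
  rcases zmod_two (x k) with h2 | h2 <;> rcases zmod_two (y k) with h3 | h3 <;> simp_all

theorem exists_edge (hes : IsEdgeList G es) (e : G.edgeSet) : ∃ k, edge es k = e := by
  exact hes.2.ge e.2

theorem edge_mem (hes : IsEdgeList G es) (k : Fin m) : edge es k ∈ G.edgeSet :=
  hes.2 ▸ Set.mem_range_self (f := edge es) k

theorem ends_ne (hes : IsEdgeList G es) (k : Fin m) : (es k).1 ≠ (es k).2 := by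
  have := edge_mem hes k
  rw [edge, SimpleGraph.mem_edgeSet] at this
  exact this.ne

theorem eq_toEdges (hes : IsEdgeList G es) {F : Finset (Sym2 (Fin n))}
    (hF : (F : Set (Sym2 (Fin n))) ⊆ G.edgeSet) :
    toEdges es (fun k => if edge es k ∈ F then 1 else 0) = F := by
  ext e
  simp only [toEdges, mem_image, mem_filter, mem_univ, true_and]
  constructor
  · rintro ⟨k, h, rfl⟩
    by_contra h'
    rw [if_neg h'] at h
    exact zero_ne_one h
  · intro he
    obtain ⟨k, hk⟩ := exists_edge hes ⟨e, hF he⟩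
    exact ⟨k, by rw [if_pos (by rw [hk]; exact he)], hk⟩

theorem linearIndepOn_image_toEdges (hes : IsEdgeList G es) {B : Finset (Fin m → ZMod 2)} :
    LinearIndepOn (ZMod 2) (incVec G) ((B.image (toEdges es) : Finset _) : Set _) ↔
      LinearIndepOn (ZMod 2) id (B : Set (Fin m → ZMod 2)) := by
  -- Incidence vectors are indexed by edges and words by positions in the list; pulling back along
  -- the surjection `κ` is an injective linear map, so independence is the same on both sides.
  choose κ hκ using exists_edge hes
  have hκs : Function.Surjective κ := fun k =>
    ⟨⟨edge es k, edge_mem hes k⟩, hes.1 (hκ ⟨edge es k, edge_mem hes k⟩)⟩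
  have hcomp : incVec G ∘ toEdges es = LinearMap.funLeft (ZMod 2) (ZMod 2) κ ∘ id := by
    funext x e
    simp only [Function.comp_apply, incVec, LinearMap.funLeft_apply, id]
    have h1 := edge_mem_toEdges hes (x := x) (k := κ e)
    rw [hκ] at h1
    rcases zmod_two (x (κ e)) with h | h <;> simp [h1, h]
  rw [coe_image]
  constructor
  · intro h
    have h1 := h.comp_of_image (toEdges_injective hes).injOn
    rw [hcomp] at h1
    exact h1.of_comp _
  · intro h
    refine LinearIndepOn.image_of_comp _ _ ?_
    rw [hcomp]
    exact h.map_injOn _ (LinearMap.funLeft_injective_of_surjective _ _ _ hκs).injOn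

/-- Taking images under the injective `toEdges` preserves and reflects inclusion, and it reaches
every family of admissible edge sets, so maximality transfers. -/
theorem isBasis_iff (hes : IsEdgeList G es) {U : Submodule (ZMod 2) (Fin m → ZMod 2)}
    {S : Finset (Sym2 (Fin n)) → Prop} (hS : ∀ F, S F ↔ ∃ x ∈ U, toEdges es x = F)
    {B : Finset (Finset (Sym2 (Fin n)))} :
    IsBasis G S B ↔ ∃ B', IsBasisOf U (Module.finrank (ZMod 2) U) B' ∧ B'.image (toEdges es) = B := by
  have hgood : ∀ I : Finset (Fin m → ZMod 2),
      ((∀ F ∈ I.image (toEdges es), S F) ∧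
        LinearIndepOn (ZMod 2) (incVec G) ((I.image (toEdges es) : Finset _) : Set _)) ↔
      (∀ v ∈ I, v ∈ U) ∧ LinearIndepOn (ZMod 2) id (I : Set (Fin m → ZMod 2)) := by
    intro I
    rw [linearIndepOn_image_toEdges hes]
    refine and_congr_left fun _ => ?_
    simp only [mem_image, forall_exists_index, and_imp, forall_apply_eq_imp_iff₂, hS]
    refine forall₂_congr fun v _ => ⟨fun ⟨x, hx, h⟩ => toEdges_injective hes h ▸ hx,
      fun h => ⟨v, h, rfl⟩⟩
  have hex : ∀ I : Finset (Finset (Sym2 (Fin n))), (∀ F ∈ I, S F) →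
      ∃ I' : Finset (Fin m → ZMod 2), I'.image (toEdges es) = I := by
    intro I hI
    obtain ⟨I', -, h⟩ := subset_set_image_iff (s := Set.univ) (f := toEdges es) (t := I) |>.1
      fun F hF => by
        obtain ⟨x, -, hx⟩ := (hS F).1 (hI F hF)
        exact ⟨x, trivial, hx⟩
    exact ⟨I', h⟩
  have hsub : ∀ I J : Finset (Fin m → ZMod 2), I.image (toEdges es) ≤ J.image (toEdges es) ↔ I ≤ J :=
    fun I J => image_subset_image_iff (toEdges_injective hes)
  unfold IsBasis
  constructor
  · intro hB
    obtain ⟨B', rfl⟩ := hex B hB.1.1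
    refine ⟨B', maximal_iff_isBasisOf.1 ⟨(hgood B').1 hB.1, fun I hI hle => ?_⟩, rfl⟩
    exact (hsub _ _).1 (hB.2 ((hgood I).2 hI) ((hsub _ _).2 hle))
  · rintro ⟨B', hB', rfl⟩
    have hmax := maximal_iff_isBasisOf.2 hB'
    refine ⟨(hgood B').2 hmax.1, fun I hI hle => ?_⟩
    obtain ⟨I', rfl⟩ := hex I hI.1
    exact (hsub _ _).2 (hmax.2 ((hgood I').1 hI) ((hsub _ _).1 hle))

theorem encodes_code (hes : IsEdgeList G es) {r : ℕ} {a w : ℕ → ℕ → ℕ}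
    (he : LinearIndependent (ZMod 2) (fun i : Fin r => vec m (a i))) :
    Encodes es (code m r a w) ((famSet (fun i => vec m (a i)) w r).image (toEdges es)) := by
  have hli := linearIndependent_fam (e := fun i => vec m (a i)) he w
  refine ⟨(List.range r).map fun j => toEdges es (fam (fun i => vec m (a i)) w r j), ?_, ?_, ?_⟩
  · refine List.Nodup.map_on (fun i hi j hj h => ?_) List.nodup_range
    have := hli.injective (a₁ := ⟨i, List.mem_range.1 hi⟩) (a₂ := ⟨j, List.mem_range.1 hj⟩)
      (toEdges_injective hes h)
    simpa using this
  · ext F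
    simp [famSet]
  · rw [code, List.flatMap_map]
    congr 1
    funext j
    congr 1
    funext k
    have h := edge_mem_toEdges hes (x := fam (fun i => vec m (a i)) w r j) (k := k)
    unfold edge at h
    rcases zmod_two (fam (fun i => vec m (a i)) w r j k) with h' | h'
    · rw [if_neg (by rw [h, h']; exact zero_ne_one), h']; rfl
    · rw [if_pos (by rw [h, h']), h']; rfl

/-! ### The complete run on the machine -/

/-- Set the row length, run `prep`, put the number of rows written by `prep` into register `3`
and enumerate. -/
def fullProg (prep : Prog) (e : Ex) : Prog :=
  .seq (.setReg 2 (Ex.bin .mul (.lit 2) (.bin .add (.bin .add (.reg 0) (.reg 1)) (.lit 2))).toExpr)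
    (.seq prep (.seq (.setReg 3 e.toExpr) enumProg))

def initArr (es : Fin m → Fin n × Fin n) (L : ℕ) : Arr :=
  fun t i j => (initState es).mem ((t * L + i) * L + j)

/-- The tables hold a basis of `U` and a zero word. -/
structure Ready (U : Submodule (ZMod 2) (Fin m → ZMod 2)) (r : ℕ) (A : Arr) : Prop where
  word : ∀ q j, A 3 q j = 0
  bits : ∀ i < r, Bits m (A 1 i)
  indep : LinearIndependent (ZMod 2) (fun i : Fin r => vec m (A 1 i))
  span : Submodule.span (ZMod 2) (Set.range fun i : Fin r => vec m (A 1 i)) = U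

theorem fits {r : ℕ} (hn : 1 ≤ n) (hr : r < n + m + 2) :
    Fits ((n + m + 2) ^ 6) (2 * (n + m + 2)) m r := by
  refine ⟨?_, by omega, by omega, by omega⟩
  obtain ⟨K, hK⟩ : ∃ K, n + m + 2 = K + 3 := ⟨n + m - 1, by omega⟩
  rw [hK]
  -- The nine tables need `36 * (K + 3) ^ 2` words, and `36 ≤ 3 ^ 4`; this is where the exponent `6`
  -- of the word size suffices.
  have h1 : 3 ^ 4 ≤ (K + 3) ^ 4 := Nat.pow_le_pow_left (by omega) 4
  calc 9 * (2 * (K + 3)) * (2 * (K + 3)) = 36 * (K + 3) ^ 2 := by ring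
    _ ≤ (K + 3) ^ 4 * (K + 3) ^ 2 := Nat.mul_le_mul_right _ (by omega)
    _ = (K + 3) ^ 6 := by ring

theorem total_cost {r R T t c : ℕ} (hr : r ≤ R) (ht : t ≤ T) (hc : c ≤ 50) :
    1000 * ((r + 1) * (r + 1)) + (8 + t + (c + 1)) + 30 + 700 * ((r + 1) * ((r + 1) * (m + 1))) ≤
      T + 2000 * ((R + 1) * ((R + 1) * (m + 1))) := by
  have h1 : (r + 1) * ((r + 1) * (m + 1)) ≤ (R + 1) * ((R + 1) * (m + 1)) := by gcongr
  have h2 : (r + 1) * (r + 1) ≤ (r + 1) * ((r + 1) * (m + 1)) :=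
    Nat.mul_le_mul_left _ (Nat.le_mul_of_pos_right _ (by omega))
  have h3 : 0 < (R + 1) * ((R + 1) * (m + 1)) := by positivity
  omega

theorem enumerates (hes : IsEdgeList G es) (hn : 1 ≤ n) {prep : Prog} {e : Ex} {T D R : ℕ}
    {U : Submodule (ZMod 2) (Fin m → ZMod 2)} {P : Arr → Prop}
    {S : Finset (Sym2 (Fin n)) → Prop} (hS : ∀ F, S F ↔ ∃ x ∈ U, toEdges es x = F)
    (hprep : Does ((n + m + 2) ^ 6) (2 * (n + m + 2)) prep T [n, m, 2 * (n + m + 2)]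
      (initArr es (2 * (n + m + 2))) P)
    (hP : ∀ A, P A → ∃ r ≤ R, e.Ok (2 * (n + m + 2)) [n, m, 2 * (n + m + 2)] A ∧
      e.ev [n, m, 2 * (n + m + 2)] A = r ∧ Ready U r A)
    (hR : R < n + m + 2) (hcost : e.toExpr.cost ≤ 50)
    (hD : T + 2000 * ((R + 1) * ((R + 1) * (m + 1))) ≤ D) :
    EnumeratesWithDelay (fullProg prep e) ((n + m + 2) ^ 6) es (IsBasis G S) D := by
  set L := 2 * (n + m + 2) with hL
  have hLW := (fits (r := 0) (m := m) hn (by omega)).lt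
  set W := (n + m + 2) ^ 6 with hW
  have hag : Agree [n, m] (initState es).reg := by
    intro j hj
    simp only [List.length_cons, List.length_nil] at hj
    obtain rfl | rfl : j = 0 ∨ j = 1 := by omega
    · rfl
    · rfl
  obtain ⟨t, ht, ρ, μ, A, _, hρ, hμ, ⟨rfl, hA⟩, hex⟩ :=
    hprep _ _ (hag.snoc L) (fun _ _ _ _ _ => rfl)
  obtain ⟨r, hr, hok, hev, hready⟩ := hP A hA
  have hF : Fits W L m r := fits hn (by omega)
  have hval : ∀ s buf out, e.toExpr.eval ⟨ρ, μ, s, buf, out⟩ = r := fun s buf out =>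
    (Ex.eval_toExpr (σ := ⟨ρ, μ, s, buf, out⟩) hρ hμ e hok).trans hev
  -- The time so far: 8 for setting the row length, `t` for `prep`, and the assignment of the rank
  -- to register `3`.
  obtain ⟨ρ', μ', s', os, ws, hex', hnd, hmem, hall, hch⟩ :=
    enumProg_spec (n := n) hF hready.bits rfl hready.word (hρ.snoc r) hμ
      (8 + t + (e.toExpr.cost + 1))
  have hrank : Module.finrank (ZMod 2) U = r := by
    rw [← hready.span, finrank_span_eq_card hready.indep, Fintype.card_fin]
  refine ⟨⟨ρ', μ', s', [], os⟩, ?_, ⟨ws.map fun w =>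
    (famSet (fun i => vec m (A 1 i)) w r).image (toEdges es), ?_, ?_, ?_⟩, rfl, ?_⟩
  · refine Exec.seq _ _ _ _ _ (Exec.setReg _ _ _ ?_) ?_
    · simpa [Ex.toExpr, Expr.eval, Op.eval, initState] using hLW
    · refine Exec.seq _ _ _ ⟨ρ, μ, 8 + t, [], []⟩ _ ?_ ?_
      · simpa [State.tick, Ex.toExpr, Expr.eval, Expr.cost, Op.eval, initState] using hex 8 [] []
      · refine Exec.seq _ _ _ _ _ (Exec.setReg _ _ _ (by rw [hval]; have := hF.hr; omega)) ?_
        simpa [State.tick, hval] using hex'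
  · refine List.Nodup.map_on (fun w hw w' hw' h => ?_) hnd
    exact famSet_injective (e := fun i => vec m (A 1 i)) hready.indep ((hmem w).1 hw)
      ((hmem w').1 hw') (image_injective (toEdges_injective hes) h)
  · intro B
    rw [isBasis_iff hes hS, hrank, List.mem_map]
    constructor
    · rintro ⟨w, hw, rfl⟩
      exact ⟨_, hready.span ▸ isBasisOf_famSet (e := fun i => vec m (A 1 i)) hready.indep w, rfl⟩
    · rintro ⟨B', hB', rfl⟩
      rw [← hready.span] at hB'
      obtain ⟨w, hw, rfl⟩ := exists_valid_famSet_eq (e := fun i => vec m (A 1 i)) hB'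
      exact ⟨w, (hmem w).2 hw, rfl⟩
  · rw [List.forall₂_map_right_iff]
    refine hall.imp fun o w h => ?_
    rw [h]
    exact encodes_code hes hready.indep
  · refine (hch _ le_rfl).imp fun x y hxy => hxy.trans (Nat.add_le_add_left (le_trans ?_ hD) x)
    exact total_cost hr ht hcost

end Graph

end BasisWords

namespace BasisWords

open WordRAM GraphBases Finset
open scoped Classical

variable {n m : ℕ} {G : SimpleGraph (Fin n)} {es : Fin m → Fin n × Fin n}

/-! ## Cycles and cuts as spaces of words, and the two enumeration theorems -/

def fstEnd (es : Fin m → Fin n × Fin n) (k : Fin m) : ℕ := (es k).1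

def sndEnd (es : Fin m → Fin n × Fin n) (k : Fin m) : ℕ := (es k).2

theorem endU_initArr (L : ℕ) (k : Fin m) : endU (initArr es L) k = fstEnd es k := by
  have h := k.2
  simp [endU, initArr, initState, fstEnd]

theorem endV_initArr (L : ℕ) (k : Fin m) : endV (initArr es L) k = sndEnd es k := by
  have h := k.2
  have h1 : (2 * (k : ℕ) + 1) / 2 = k := by omega
  have h2 : (2 * (k : ℕ) + 1) % 2 = 1 := by omega
  simp [endV, initArr, initState, sndEnd, h1, h2]

/-- The input fills `2 * m ≤ L` cells, all of them in row `0` of table `0`. -/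
theorem initArr_eq_zero {L : ℕ} (hL : 2 * m ≤ L) (hL0 : 2 ≤ L) {t i j : ℕ} (ht : 1 ≤ t) :
    initArr es L t i j = 0 := by
  have h1 : 1 * L ≤ t * L := Nat.mul_le_mul_right _ ht
  have h2 : L * 1 ≤ (t * L + i) * L := Nat.mul_le_mul (by omega) (by omega)
  have h3 : ¬ ((t * L + i) * L + j) / 2 < m := by omega
  simp only [initArr, initState, dif_neg h3]

theorem isCycle_iff (hes : IsEdgeList G es) (F : Finset (Sym2 (Fin n))) :
    IsCycle G F ↔ ∃ x ∈ LinearMap.ker (bdry (fstEnd es) (sndEnd es)), toEdges es x = F := by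
  have hdeg : ∀ (x : Fin m → ZMod 2) (w : Fin n),
      (((toEdges es x).filter fun e => w ∈ e).card : ZMod 2) =
        bdry (fstEnd es) (sndEnd es) x w := by
    intro x w
    rw [toEdges, filter_image, card_image_of_injective _ (show Function.Injective (edge es) from hes.1), filter_filter, bdry_apply,
      card_filter, Nat.cast_sum]
    refine sum_congr rfl fun k _ => ?_
    -- Without loops, an edge at `w` has exactly one end there and contributes `1` to the boundary.
    have hne := ends_ne hes k
    have hmem : w ∈ edge es k ↔ (es k).1 = w ∨ (es k).2 = w := by
      rw [edge, Sym2.mem_iff]; exact or_congr eq_comm eq_comm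
    have h1 : ind (fstEnd es k) w = if (es k).1 = w then 1 else 0 := by
      simp only [ind, fstEnd, Fin.ext_iff]; congr
    have h2 : ind (sndEnd es k) w = if (es k).2 = w then 1 else 0 := by
      simp only [ind, sndEnd, Fin.ext_iff]; congr
    rw [h1, h2]
    simp only [hmem]
    rcases zmod_two (x k) with hx | hx
    · simp [hx]
    · by_cases ha : (es k).1 = w
      · have hb : (es k).2 ≠ w := fun hb => hne (ha.trans hb.symm)
        simp [hx, ha, hb]
      · by_cases hb : (es k).2 = w <;> simp [hx, ha, hb]
  have hker : ∀ x : Fin m → ZMod 2, bdry (fstEnd es) (sndEnd es) x = 0 ↔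
      ∀ w : Fin n, Even ((toEdges es x).filter fun e => w ∈ e).card := by
    intro x
    simp only [← ZMod.natCast_eq_zero_iff_even, hdeg]
    refine ⟨fun h w => by rw [h]; rfl, fun h => ?_⟩
    funext w
    by_cases hw : w < n
    · exact h ⟨w, hw⟩
    -- The boundary is a function on all of `ℕ`; beyond the vertices it vanishes trivially.
    · rw [bdry_apply]
      refine sum_eq_zero fun k _ => ?_
      have h1 : fstEnd es k ≠ w := fun h' => hw (h' ▸ (es k).1.2)
      have h2 : sndEnd es k ≠ w := fun h' => hw (h' ▸ (es k).2.2)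
      simp [ind, h1, h2]
  constructor
  · rintro ⟨hF, hev⟩
    refine ⟨_, LinearMap.mem_ker.2 ((hker _).2 fun w => ?_), eq_toEdges hes hF⟩
    rw [eq_toEdges hes hF]
    convert hev w
  · rintro ⟨x, hx, rfl⟩
    refine ⟨fun e he => ?_, fun w => ?_⟩
    · obtain ⟨k, -, rfl⟩ := mem_image.1 (mem_coe.1 he)
      exact edge_mem hes k
    · convert (hker x).1 (LinearMap.mem_ker.1 hx) w

/-! ### The cut space and its basis of vertex cuts -/

/-- The coboundary of a set of vertices. -/
def cobdry (es : Fin m → Fin n × Fin n) : (ℕ → ZMod 2) →ₗ[ZMod 2] (Fin m → ZMod 2) where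
  toFun f k := f (fstEnd es k) + f (sndEnd es k)
  map_add' f g := by funext k; simp only [Pi.add_apply]; ring
  map_smul' c f := by funext k; simp [mul_add]

theorem cobdry_apply (f : ℕ → ZMod 2) (k : Fin m) :
    cobdry es f k = f (fstEnd es k) + f (sndEnd es k) := rfl

theorem isCut_iff (hes : IsEdgeList G es) (F : Finset (Sym2 (Fin n))) :
    IsCut G F ↔ ∃ x ∈ LinearMap.range (cobdry es), toEdges es x = F := by
  have key : ∀ (f : ℕ → ZMod 2) (W : Set (Fin n)), (∀ w : Fin n, f w = 1 ↔ w ∈ W) → ∀ e,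
      e ∈ toEdges es (cobdry es f) ↔
        e ∈ G.edgeSet ∧ ∃ s t : Fin n, s ∈ W ∧ t ∉ W ∧ e = s(s, t) := by
    intro f W hfW e
    have hk : ∀ k, edge es k ∈ toEdges es (cobdry es f) ↔
        ((es k).1 ∈ W ∧ (es k).2 ∉ W ∨ (es k).2 ∈ W ∧ (es k).1 ∉ W) := by
      intro k
      rw [edge_mem_toEdges hes, cobdry_apply, ← hfW, ← hfW, fstEnd, sndEnd]
      rcases zmod_two (f (es k).1) with h1 | h1 <;> rcases zmod_two (f (es k).2) with h2 | h2 <;>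
        rw [h1, h2] <;> decide
    constructor
    · intro he
      obtain ⟨k, -, rfl⟩ := mem_image.1 he
      refine ⟨edge_mem hes k, ?_⟩
      rcases (hk k).1 he with ⟨h1, h2⟩ | ⟨h1, h2⟩
      · exact ⟨_, _, h1, h2, rfl⟩
      · exact ⟨_, _, h1, h2, Sym2.eq_swap⟩
    · rintro ⟨he, s, t, hs, ht, rfl⟩
      obtain ⟨k, hk'⟩ := exists_edge hes ⟨_, he⟩
      have hk'' : s((es k).1, (es k).2) = s(s, t) := hk'
      rw [← show edge es k = s(s, t) from hk', hk]
      rcases Sym2.eq_iff.1 hk'' with ⟨h1, h2⟩ | ⟨h1, h2⟩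
      · left; rw [h1, h2]; exact ⟨hs, ht⟩
      · right; rw [h1, h2]; exact ⟨hs, ht⟩
  constructor
  · rintro ⟨W, hW⟩
    let f : ℕ → ZMod 2 := fun w => if ∃ h : w < n, (⟨w, h⟩ : Fin n) ∈ W then 1 else 0
    refine ⟨_, ⟨f, rfl⟩, ?_⟩
    ext e
    rw [hW, key f W]
    intro w
    by_cases h : w ∈ W <;> simp [f, h]
  · rintro ⟨_, ⟨f, rfl⟩, rfl⟩
    exact ⟨{w | f w = 1}, key f _ fun w => Iff.rfl⟩

theorem cobdry_eq_sum {f : ℕ → ZMod 2} (hf : f 0 = 0) :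
    cobdry es f = ∑ i : Fin (n - 1), f (i + 1) • cobdry es (unit (i + 1)) := by
  have h : ∀ a < n, f a = ∑ i : Fin (n - 1), f (i + 1) * unit (i + 1) a := by
    intro a ha
    cases a with
    | zero =>
      rw [hf]
      exact (sum_eq_zero fun i _ => by simp [unit]).symm
    | succ a =>
      rw [sum_eq_single (⟨a, by omega⟩ : Fin (n - 1))]
      · simp [unit]
      · intro i _ hi
        have : (a + 1) ≠ (i : ℕ) + 1 := fun h => hi (Fin.ext (by simpa using h.symm))
        rw [unit, Pi.single_eq_of_ne this, mul_zero]
      · intro h; exact absurd (mem_univ _) h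
  funext k
  rw [cobdry_apply, h (fstEnd es k) (es k).1.2, h (sndEnd es k) (es k).2.2, ← sum_add_distrib, Finset.sum_apply]
  refine sum_congr rfl fun i _ => ?_
  simp only [Pi.smul_apply, cobdry_apply, smul_eq_mul, mul_add]

/-- A linear relation is a vertex function with value `0` at vertex `0` and zero coboundary. It is
constant along edges, hence constant by connectivity, hence zero. -/
theorem linearIndependent_cobdry (hes : IsEdgeList G es) (hG : G.Connected) :
    LinearIndependent (ZMod 2) (fun i : Fin (n - 1) => cobdry es (unit (i + 1))) := by
  refine Fintype.linearIndependent_iff.2 fun c hc j => ?_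
  let f : ℕ → ZMod 2 := fun a => if h : 0 < a ∧ a - 1 < n - 1 then c ⟨a - 1, h.2⟩ else 0
  have hf : ∀ i : Fin (n - 1), f (i + 1) = c i := fun i => by simp [f]
  have h0 : cobdry es f = 0 := by
    rw [cobdry_eq_sum (by simp [f]), ← hc]
    simp only [hf]
  have hadj : ∀ x y : Fin n, G.Adj x y → f x = f y := by
    intro x y hxy
    obtain ⟨k, hk⟩ := exists_edge hes ⟨s(x, y), hxy⟩
    have h1 : f (es k).1 + f (es k).2 = 0 := congrFun h0 k
    have h2 : f (es k).1 = f (es k).2 := by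
      rcases zmod_two (f (es k).1) with h | h <;> rcases zmod_two (f (es k).2) with h' | h' <;>
        rw [h, h'] at h1 ⊢ <;> revert h1 <;> decide
    rcases Sym2.eq_iff.1 (show s((es k).1, (es k).2) = s(x, y) from hk) with ⟨h, h'⟩ | ⟨h, h'⟩
    · rw [h, h'] at h2; exact h2
    · rw [h, h'] at h2; exact h2.symm
  have hconst : ∀ x y : Fin n, f x = f y := by
    intro x y
    obtain ⟨p⟩ := hG.preconnected x y
    induction p with
    | nil => rfl
    | cons h _ ih => exact (hadj _ _ h).trans ih
  have hj := j.2
  rw [← hf j]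
  refine (hconst ⟨j + 1, by omega⟩ ⟨0, by omega⟩).trans ?_
  simp [f]

theorem span_cobdry : Submodule.span (ZMod 2)
    (Set.range fun i : Fin (n - 1) => cobdry es (unit (i + 1))) = LinearMap.range (cobdry es) := by
  refine le_antisymm ?_ ?_
  · rw [Submodule.span_le]
    rintro _ ⟨i, rfl⟩
    exact ⟨_, rfl⟩
  · rintro _ ⟨f, rfl⟩
    -- Constants have zero coboundary, so the function may be normalized to vanish at vertex `0`,
    -- which corresponds to complementing the vertex set of a cut.
    have h : cobdry es f = cobdry es fun a => f a + f 0 := by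
      funext k
      have := add_self_zmod_two (f 0)
      simp only [cobdry_apply]
      linear_combination -this
    rw [h, cobdry_eq_sum (add_self_zmod_two _)]
    exact sum_mem fun i _ => Submodule.smul_mem _ _ (Submodule.subset_span ⟨i, rfl⟩)

/-! ### Size comparisons and the final bounds -/

theorem one_le_of_connected (hG : G.Connected) : 1 ≤ n := by
  obtain ⟨v⟩ := hG.nonempty
  exact v.pos

theorem le_mul_self_of_isEdgeList (hes : IsEdgeList G es) : m ≤ n * n := by
  have h : Function.Injective es := fun k k' h => hes.1 (by simp only [h])
  simpa using Fintype.card_le_of_injective es h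

theorem le_succ_of_connected (hes : IsEdgeList G es) (hG : G.Connected) : n ≤ m + 1 := by
  have h := hG.card_vert_le_card_edgeSet_add_one
  have h2 : Nat.card G.edgeSet = m := by
    rw [← hes.2, Nat.card_range_of_injective hes.1, Nat.card_fin]
  rwa [h2, Nat.card_fin] at h

theorem cut_enumerates (hes : IsEdgeList G es) (hG : G.Connected) :
    EnumeratesWithDelay (fullProg cutProg (.bin .sub (.reg 0) (.lit 1))) ((n + m + 2) ^ 6) es
      (IsCutBasis G) (5000 * n ^ 5) := by
  have hn := one_le_of_connected hG
  refine enumerates (R := n - 1) hes hn (isCut_iff hes)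
    (cutProg_spec (fits hn (by omega)) (by omega) (by omega)) ?_ (by omega) (by
      simp [Ex.toExpr, Expr.cost]) ?_
  · rintro A ⟨h3, h1⟩
    have hvec : ∀ i < n - 1, vec m (A 1 i) = cobdry es (unit (i + 1)) := by
      intro i hi
      funext k
      rw [vec, h1 i hi k k.2, cast_xor (by split_ifs <;> omega) (by split_ifs <;> omega),
        endU_initArr, endV_initArr, cobdry_apply]
      simp [unit, Pi.single_apply]
    have hfun : (fun i : Fin (n - 1) => vec m (A 1 i)) =
        fun i : Fin (n - 1) => cobdry es (unit (i + 1)) := funext fun i => hvec i i.2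
    refine ⟨n - 1, le_rfl, by simp, by simp [Op.eval], fun q j => ?_, fun i hi k hk => ?_, ?_, ?_⟩
    · rw [h3]; exact initArr_eq_zero (by omega) (by omega) (by omega)
    · rw [h1 i hi k hk]; exact xor_le _ _
    · rw [hfun]; exact linearIndependent_cobdry hes hG
    · rw [hfun]; exact span_cobdry
  · have hm := le_mul_self_of_isEdgeList hes
    have hn' : n - 1 + 1 = n := by omega
    have h1 : 1 ≤ n * n := Nat.mul_pos hn hn
    rw [hn']
    -- Simplicity of the graph bounds the length of a vector in terms of `n`; the total is then of
    -- order `n ^ 4`.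
    have h2 : m + 1 ≤ 2 * (n * n) := by omega
    calc 200 * ((n + 1) * (m + 1)) + 2000 * (n * (n * (m + 1)))
        ≤ 200 * ((2 * n) * (2 * (n * n))) + 2000 * (n * (n * (2 * (n * n)))) := by
          gcongr; omega
      _ = 800 * n ^ 3 + 4000 * n ^ 4 := by ring
      _ ≤ 800 * n ^ 5 + 4000 * n ^ 5 := by
          gcongr <;> first | exact hn | omega
      _ ≤ 5000 * n ^ 5 := by omega

theorem cycleProg_ready {W L : ℕ} (hF : Fits W L m 0) (hn : n < L) (hm : 2 * m < L) :
    Does W L cycleProg (700 * ((m + 1) * ((n + 1) * (m + 1)))) [n, m, L] (initArr es L)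
      fun A => A 5 0 2 ≤ m ∧
        Ready (LinearMap.ker (bdry (fstEnd es) (sndEnd es))) (A 5 0 2) A := by
  have hL := hF.hL
  have hz : ∀ t i j, 1 ≤ t → initArr es L t i j = 0 := fun t i j ht =>
    initArr_eq_zero (by omega) (by omega) ht
  have hu : (fun k : Fin m => endU (initArr es L) k) = fstEnd es := funext fun k => endU_initArr L k
  have hv : (fun k : Fin m => endV (initArr es L) k) = sndEnd es := funext fun k => endV_initArr L k
  rcases Nat.eq_zero_or_pos m with rfl | hm0
  -- Without edges there is no default chord in `Fin 0` for `Forest`; the vector space is trivial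
  -- and the edge loop makes no round.
  · have hLW := hF.lt
    refine Does.seq (T₁ := 100 * (n + 1)) (T₂ := 6) ?_ (by omega)
    refine Does.fillRow (N := n) (i := 0) (c := 40) (fun w => w) rfl rfl (by omega) rfl (by omega)
      (by omega) hF.hW (fun x A => by simp) (fun x hx A' hA' => ⟨by simp, by simp, by omega⟩)
      (by simp [Ex.toExpr, Expr.cost, cellExpr]) (by omega) ?_
    refine Does.forr (N := 0) (c := 0)
      (fun _ A => A = setRow (initArr es L) 7 0 n fun w => w) rfl rfl (by omega) rfl
      (fun k hk => by omega) (by omega) ?_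
    rintro A rfl
    have h5 : setRow (initArr es L) 7 0 n (fun w => w) 5 0 2 = 0 := by
      rw [setRow_table (by omega), hz _ _ _ (by omega)]
    rw [h5]
    refine ⟨le_rfl, fun q j => ?_, fun i hi => by omega, linearIndependent_empty_type,
      Subsingleton.elim _ _⟩
    rw [setRow_table (by omega), hz _ _ _ (by omega)]
  · refine (cycleProg_spec hF hn hm (fun t ht => ?_) (fun t ht => ?_) hm0
      (fun _ _ => hz _ _ _ (by omega)) (hz _ _ _ (by omega))).mono le_rfl fun A hA => ?_
    · rw [endU_initArr L ⟨t, ht⟩]; exact (es ⟨t, ht⟩).1.2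
    · rw [endV_initArr L ⟨t, ht⟩]; exact (es ⟨t, ht⟩).2.2
    · obtain ⟨nt, hf⟩ := hA.forest
      rw [hu, hv] at hf
      exact ⟨hf.le, fun q j => by rw [hA.word]; exact hz _ _ _ (by omega), hA.row,
        hf.linearIndependent, hf.span_eq⟩

theorem cycle_enumerates (hes : IsEdgeList G es) (hG : G.Connected) :
    EnumeratesWithDelay (fullProg cycleProg (.ld 5 (.lit 0) (.lit 2))) ((n + m + 2) ^ 6) es
      (IsCycleBasis G) (30000 * (m ^ 5 + 1)) := by
  have hn := one_le_of_connected hG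
  have hnm := le_succ_of_connected hes hG
  refine enumerates (R := m) hes hn (isCycle_iff hes)
    (cycleProg_ready (fits hn (by omega)) (by omega) (by omega)) ?_ (by omega) (by
      simp [Ex.toExpr, Expr.cost, cellExpr]) ?_
  · rintro A ⟨hr, hready⟩
    exact ⟨A 5 0 2, hr, by simp; omega, by simp, hready⟩
  -- The total is cubic in `m + 1`; the summand `1` on the right is needed for `m = 0` only.
  · have h1 : (m + 1) ^ 3 ≤ 8 * (m ^ 5 + 1) := by
      rcases Nat.eq_zero_or_pos m with rfl | hm
      · norm_num
      · calc (m + 1) ^ 3 ≤ (2 * m) ^ 3 := Nat.pow_le_pow_left (by omega) 3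
          _ = 8 * m ^ 3 := by ring
          _ ≤ 8 * (m ^ 5 + 1) :=
            Nat.mul_le_mul_left _ ((Nat.pow_le_pow_right hm (by omega)).trans (Nat.le_succ _))
    calc 700 * ((m + 1) * ((n + 1) * (m + 1))) + 2000 * ((m + 1) * ((m + 1) * (m + 1)))
        ≤ 700 * ((m + 1) * ((2 * (m + 1)) * (m + 1))) + 2000 * ((m + 1) * ((m + 1) * (m + 1))) := by
          gcongr; omega
      _ = 3400 * (m + 1) ^ 3 := by ring
      _ ≤ 3400 * (8 * (m ^ 5 + 1)) := Nat.mul_le_mul_left _ h1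
      _ ≤ 30000 * (m ^ 5 + 1) := by omega

end BasisWords

/-- All cycle bases of a connected graph with `n` vertices and `m` edges can be enumerated with
delay `O(m ^ 5)`, and all its cut bases with delay `O(n ^ 5)`, each by one fixed program on a
word RAM whose words have `O(log (n + m))` bits. (The summand `1` in the first bound matters only
for the graph without edges.) -/
theorem mainTheorem8 :
    (∃ (p : WordRAM.Prog) (c C : ℕ),
      ∀ (n m : ℕ) (G : SimpleGraph (Fin n)) (es : Fin m → Fin n × Fin n),
        G.Connected → GraphBases.IsEdgeList G es →
          GraphBases.EnumeratesWithDelay p ((n + m + 2) ^ c) es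
            (GraphBases.IsCycleBasis G) (C * (m ^ 5 + 1))) ∧
    (∃ (p : WordRAM.Prog) (c C : ℕ),
      ∀ (n m : ℕ) (G : SimpleGraph (Fin n)) (es : Fin m → Fin n × Fin n),
        G.Connected → GraphBases.IsEdgeList G es →
          GraphBases.EnumeratesWithDelay p ((n + m + 2) ^ c) es
            (GraphBases.IsCutBasis G) (C * n ^ 5)) :=
  ⟨⟨_, 6, 30000, fun _ _ _ _ hG hes => BasisWords.cycle_enumerates hes hG⟩,
    ⟨_, 6, 5000, fun _ _ _ _ hG hes => BasisWords.cut_enumerates hes hG⟩⟩
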